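/- **Setting.** Base stations (BSs) form a homogeneous Poisson point process of density $\lambda_b>0$ on $\mathbb R^2$; all BSs transmit with power $P_b>0$, the noise variance is $\sigma^2>0$, and the power of a link with Nakagami-$k$ fading ($k\ge1$ an integer) is Gamma distributed with shape $k$ and rate $k$ (unit mean). All fading powers are independent of each other and of the locations. *Connected user.* It is at a fixed distance $r_c>0$ from its serving BS; the BSs at distance more than $r_c$ interfere. Direct links have path loss $Cd^{-\alpha_c}$, $C>0$, $\alpha_c>2$. Its desired link has fading power $|h_c|^2$ with parameter $m_c$, its interfering links have fading powers with parameter $m$; $I_c=\sum P_b|h_I|^2C\,d_I^{-\alpha_c}$ is the interference. With power allocation $a_c>a_t>0$, $a_c+a_t=1$, put $$\gamma_c=\frac{a_cP_b|h_c|^2Cr_c^{-\alpha_c}}{a_tP_b|h_c|^2Cr_c^{-\alpha_c}+I_c+\sigma^2},\qquad \gamma_c^{OMA}=\frac{P_b|h_c|^2Cr_c^{-\alpha_c}}{I_c+\sigma^2},\qquad \gamma_c^{th}=2^{R_c/B_w}-1\quad(R_c,B_w>0),$$ assume $a_t\gamma_c^{th}<a_c$, and let $\theta_c=\gamma_c^{th}/(a_c-a_t\gamma_c^{th})$.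 *Typical user.* It is at the origin and is served through a reconfigurable intelligent surface (RIS) of half-length $L>0$ located uniformly in the disc of radius $R_L>0$ about the origin, by the BS nearest to the RIS among those outside the disc; the other BSs outside the disc interfere, and a fraction $\rho_t\in[0,1]$ of this interference is received. With BS–RIS distance $r$ and RIS–user distance $u$ the path loss is $P_t^{RIS}(r,u)=C_E\,(ru)^{-\alpha_t}$, $\alpha_t>2$, where, for a given $\rho_a\in(0,1)$, $$C_E=\frac1\pi\int_0^\pi\Big(\frac{L}{4\pi}\big(\cos(\rho_a\vartheta)+\cos((1-\rho_a)\vartheta)\big)\Big)^2d\vartheta .$$ All its links have fading parameter $m_t$. Let $r_{BR}$, $r_{RU}$ be the distances of its serving BS to the RIS and of the RIS to it, $|h_t|^2$ the fading power of its desired link, $I_{t,\rho_t}$ its interference, and $$\gamma_t^E=\mathbb E\big[\gamma_t^{OMA}\big]\in[0,\infty],\qquad\gamma_t^{OMA}=\frac{P_b|h_t|^2P_t^{RIS}(r_{BR},r_{RU})}{I_{t,\rho_t}+\sigma^2}.$$ The coverage probability of the connected user is $\mathbb P_c=\Pr\{\gamma_c>\gamma_c^{th},\ \gamma_t^E>\gamma_c^{OMA}\}$.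 **Theorem.** Let $\eta_c=m_c(m_c!)^{-1/m_c}$. For $\kappa>0$ and $0\le\theta<\infty$ put $$S_\kappa(\theta)=\sum_{n=1}^{m_c}(-1)^{n+1}\binom{m_c}{n}\exp\big(-\mu\,r_c^2-\mu'\,r_c^{\alpha_c}\big),$$ $$\mu=\pi\lambda_b\Big({}_2F_1\Big(-\tfrac2{\alpha_c},m;1-\tfrac2{\alpha_c};-\tfrac{n\kappa\theta}{m}\Big)-1\Big),\qquad \mu'=\frac{n\kappa\theta\sigma^2}{P_bC},$$ and $S_\kappa(\infty)=0$. 1. Let $G$ be the tail function of $|h_c|^2$ and $G_\kappa(x)=1-(1-e^{-\kappa x})^{m_c}$. Then $G_{m_c}(x)\le G(x)\le G_{\eta_c}(x)$ for all $x\ge0$. 2. Write $E_F(\theta)=\mathbb E\big[F\big(\theta(I_c+\sigma^2)/(P_bCr_c^{-\alpha_c})\big)\big]$, and $E_F(\infty)=0$. If $\theta_c\le\gamma_t^E$, then $\mathbb P_c=E_G(\theta_c)-E_G(\gamma_t^E)$. If $\gamma_t^E\le\theta_c$, then $\mathbb P_c=0$. 3. The approximation of $\mathbb P_c$ obtained by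 replacing $G$ by $G_{\eta_c}$ has a closed form: $E_{G_{\eta_c}}(\theta_c)-E_{G_{\eta_c}}(\gamma_t^E)=S_{\eta_c}(\theta_c)-S_{\eta_c}(\gamma_t^E)$, so that $\mathbb P_c\approx S_{\eta_c}(\theta_c)-S_{\eta_c}(\gamma_t^E)$; the identity also holds with any $\gamma\in[0,\infty]$ (for example an approximate value) in place of $\gamma_t^E$. 4. If $\theta_c\le\gamma_t^E$, the error of this approximation is controlled by $$S_{m_c}(\theta_c)-S_{\eta_c}(\gamma_t^E)\ \le\ \mathbb P_c\ \le\ S_{\eta_c}(\theta_c)-S_{m_c}(\gamma_t^E).$$ 5. For a RIS at a fixed location at distance $u>0$ from the typical user and for $r>0$, the interference received through it from all the BSs at distance more than $r$ from it has the finite mean $$\bar I(r,u)=2\pi\lambda_b\rho_tP_bC_E\,u^{-\alpha_t}\frac{r^{2-\alpha_t}}{\alpha_t-2},\qquad\text{and}\qquad \frac{P_bP_t^{RIS}(r,u)}{\bar I(r,u)}=\frac{\alpha_t-2}{2\pi\lambda_b\rho_tr^2}\quad\text{if }\rho_t>0 .$$ Replacing the interference by this mean approximates $\gamma_t^E$ from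 below: $$\gamma_t^E\ \ge\ \mathbb E\left[\frac{P_bP_t^{RIS}(r_{BR},r_{RU})}{\bar I(r_{BR},r_{RU})+\sigma^2}\right].$$ -/

import Mathlib

open MeasureTheory ProbabilityTheory
open scoped ENNReal

noncomputable section

/-- The plane, with the Euclidean distance. -/
abbrev Plane : Type := EuclideanSpace ℝ (Fin 2)

/-- Number of points of the (enumerated) point configuration `x` that lie in `B`. -/
def pointCount (x : ℕ → Plane) (B : Set Plane) : ℕ∞ := {n : ℕ | x n ∈ B}.encard

/-- `X 0, X 1, …` enumerates a homogeneous Poisson point process of density `lam` on the plane: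
the number of points in a Borel set of finite area is Poisson distributed with mean `lam * area`,
and the numbers of points in pairwise disjoint Borel sets are independent. -/
structure IsHomogeneousPoisson {Ω : Type*} [MeasurableSpace Ω] (P : Measure Ω)
    (X : ℕ → Ω → Plane) (lam : ℝ) : Prop where
  measurable : ∀ n, Measurable (X n)
  count_law : ∀ B : Set Plane, MeasurableSet B → volume B ≠ ∞ → ∀ k : ℕ,
    P {ω | pointCount (fun n => X n ω) B = k} =
      ENNReal.ofReal (Real.exp (-(lam * (volume B).toReal)) *
        (lam * (volume B).toReal) ^ k / (k.factorial : ℝ))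
  count_indep : ∀ B : ℕ → Set Plane, (∀ i, MeasurableSet (B i)) →
    Pairwise (Function.onFun Disjoint B) →
    iIndepFun (fun i ω => pointCount (fun n => X n ω) (B i)) P

/-- Law of the power `|h|²` of a Nakagami-`m` fading coefficient `h` with unit mean power:
the Gamma law of shape `m` and rate `m`. -/
def nakagamiPower (m : ℕ) : Measure ℝ := gammaMeasure (m : ℝ) (m : ℝ)

/-- Complementary distribution function of the power of unit-mean Nakagami-`m` fading. -/
def nakagamiTail (m : ℕ) (x : ℝ) : ℝ := (nakagamiPower m).real (Set.Ioi x)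

/-- The function `1 - (1 - exp (-κ x)) ^ m`, a surrogate for the tail of normalized Gamma
variables. -/
def expTail (m : ℕ) (κ : ℝ) (x : ℝ) : ℝ := 1 - (1 - Real.exp (-(κ * x))) ^ m

/-- `η = m (m!)^(-1/m)`. -/
def alzerConst (m : ℕ) : ℝ := (m : ℝ) * (m.factorial : ℝ) ^ (-(1 / (m : ℝ)))

/-- The Gauss hypergeometric function `₂F₁(a, b; c; z)` (principal branch) for real `z < 1 / 2`,
in particular for every `z ≤ 0`. Mathlib's `ordinaryHypergeometric` is the sum of the Gauss
series, which converges only for `|z| < 1`; the analytic continuation to `z ≤ -1` is given by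
Pfaff's transformation
`₂F₁(a, b; c; z) = (1 - z)^(-b) ₂F₁(c - a, b; c; z / (z - 1))`, where `|z / (z - 1)| < 1`. -/
def gaussHyp (a b c z : ℝ) : ℝ :=
  (1 - z) ^ (-b) * ordinaryHypergeometric (c - a) b c (z / (z - 1))

/-- The deterministic parameters of the network, with their standing assumptions. -/
structure Network where
  /-- density of the base stations -/
  lamB : ℝ
  lamB_pos : 0 < lamB
  /-- transmit power of the base stations -/
  Pb : ℝ
  Pb_pos : 0 < Pb
  /-- noise variance `σ²` -/
  noise : ℝ
  noise_pos : 0 < noise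
  /-- power allocation coefficient of the connected user -/
  ac : ℝ
  /-- power allocation coefficient of the typical user -/
  aT : ℝ
  aT_pos : 0 < aT
  aT_lt_ac : aT < ac
  ac_add_aT : ac + aT = 1
  /-- intercept of the direct links -/
  C : ℝ
  C_pos : 0 < C
  /-- path loss exponent of the direct links -/
  alphaC : ℝ
  two_lt_alphaC : 2 < alphaC
  /-- location of the associated base station -/
  xB : Plane
  /-- location of the connected user -/
  xc : Plane
  xB_ne_xc : xB ≠ xc
  /-- fading parameter of the link between the connected user and its base station -/
  mC : ℕ
  mC_pos : 0 < mC
  /-- fading parameter of the links between the connected user and interfering base stations -/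
  m : ℕ
  m_pos : 0 < m
  /-- threshold rate of the connected user -/
  Rc : ℝ
  Rc_pos : 0 < Rc
  /-- bandwidth -/
  Bw : ℝ
  Bw_pos : 0 < Bw
  /-- half-length of the reconfigurable intelligent surface (RIS) -/
  L : ℝ
  L_pos : 0 < L
  /-- radius of the RIS ball around the typical user -/
  RL : ℝ
  RL_pos : 0 < RL
  /-- proportion of the angle `BS-RIS-user` that is the angle of incidence -/
  rhoA : ℝ
  rhoA_pos : 0 < rhoA
  rhoA_lt_one : rhoA < 1
  /-- fraction of the interference that reaches the typical user through the RIS -/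
  rhoT : ℝ
  rhoT_nonneg : 0 ≤ rhoT
  rhoT_le_one : rhoT ≤ 1
  /-- path loss exponent of the RIS links -/
  alphaT : ℝ
  two_lt_alphaT : 2 < alphaT
  /-- fading parameter of the typical user's links -/
  mT : ℕ
  mT_pos : 0 < mT

namespace Network

variable (N : Network)

/-- Distance between the connected user and its base station. -/
def rc : ℝ := dist N.xB N.xc

/-- Path loss of a direct link between a base station at `x` and the connected user. -/
def pathLossC (x : Plane) : ℝ := N.C * dist x N.xc ^ (-N.alphaC)

/-- SINR threshold `γ_c^th = 2^(R_c / B_w) - 1` of the connected user. -/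
def gammaTh : ℝ := (2 : ℝ) ^ (N.Rc / N.Bw) - 1

/-- `γ_c^th / (a_c - a_t γ_c^th)`: the OMA-SINR level equivalent to `γ_c > γ_c^th`. -/
def thetaC : ℝ := N.gammaTh / (N.ac - N.aT * N.gammaTh)

/-- `C_RIS = L / (4π) (cos θ_BR + cos θ_RU)` with `θ_BR = ρ_a θ`, `θ_RU = (1 - ρ_a) θ`. -/
def coeffRIS (θ : ℝ) : ℝ :=
  N.L / (4 * Real.pi) * (Real.cos (N.rhoA * θ) + Real.cos ((1 - N.rhoA) * θ))

/-- The mean of `C_RIS²` when `θ` is uniform on `(0, π)`. -/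
def coeffRISMean : ℝ := (1 / Real.pi) * ∫ θ in (0 : ℝ)..Real.pi, N.coeffRIS θ ^ 2

/-- Average path loss of the reflected link with base station-RIS distance `r` and RIS-user
distance `u`. -/
def pathLossRIS (r u : ℝ) : ℝ := N.coeffRISMean * (r * u) ^ (-N.alphaT)

/-- Mean interference at the typical user, when the distances base station-RIS and RIS-user are
`r` and `u` and every base station at distance more than `r` from the RIS interferes. -/
def meanInterference (r u : ℝ) : ℝ :=
  N.rhoT * (2 * Real.pi * N.lamB * N.Pb * N.coeffRISMean * u ^ (-N.alphaT) *
    r ^ (2 - N.alphaT) / (N.alphaT - 2))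

/-- `π λ_b (₂F₁(-2/α_c, m; 1 - 2/α_c; -n κ θ / m) - 1)`. -/
def muInterference (κ θ : ℝ) (n : ℕ) : ℝ :=
  Real.pi * N.lamB *
    (gaussHyp (-(2 / N.alphaC)) (N.m : ℝ) (1 - 2 / N.alphaC) (-((n : ℝ) * κ * θ / (N.m : ℝ))) - 1)

/-- `n κ θ σ² / (P_b C)`. -/
def muNoise (κ θ : ℝ) (n : ℕ) : ℝ := (n : ℝ) * κ * θ * N.noise / (N.Pb * N.C)

/-- The alternating binomial sum
`∑_{n=1}^{m_c} (-1)^(n+1) (m_c choose n) exp (-μ r_c² - μ' r_c^α_c)` at the SINR level `θ`;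
its value at `θ = ∞` is the limit `0`. -/
def binomialSum (κ : ℝ) (θ : ℝ≥0∞) : ℝ :=
  if θ = ∞ then 0 else
    ∑ n ∈ Finset.Icc 1 N.mC, (-1 : ℝ) ^ (n + 1) * (N.mC.choose n : ℝ) *
      Real.exp (-(N.muInterference κ θ.toReal n * N.rc ^ 2) -
        N.muNoise κ θ.toReal n * N.rc ^ N.alphaC)

end Network

/-- The random objects seen by the connected user: base stations `X 0, X 1, …`, the fading powers
`g n` of the interfering links and the fading power `h` of the link to its own base station. -/
structure ConnectedScenario (N : Network) {Ω : Type*} [MeasurableSpace Ω] (P : Measure Ω) where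
  X : ℕ → Ω → Plane
  g : ℕ → Ω → ℝ
  h : Ω → ℝ
  poisson : IsHomogeneousPoisson P X N.lamB
  g_measurable : ∀ n, Measurable (g n)
  g_law : ∀ n, P.map (g n) = nakagamiPower N.m
  g_indep : iIndepFun g P
  h_measurable : Measurable h
  h_law : P.map h = nakagamiPower N.mC
  g_h_indep : IndepFun (fun ω n => g n ω) h P
  X_fading_indep : IndepFun (fun ω n => X n ω) (fun ω => ((fun n => g n ω), h ω)) P

namespace ConnectedScenario

variable {N : Network} {Ω : Type*} [MeasurableSpace Ω] {P : Measure Ω} (S : ConnectedScenario N P)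

/-- Interference `I_c` at the connected user. The serving base station, at distance `r_c`, is the
nearest one, so that the interferers are the base stations at distance more than `r_c`. -/
def interference (ω : Ω) : ℝ := by
  classical exact
    ∑' n, if N.rc < dist (S.X n ω) N.xc then N.Pb * S.g n ω * N.pathLossC (S.X n ω) else 0

/-- Decoding SINR `γ_c` of the connected user. -/
def sinr (ω : Ω) : ℝ :=
  N.ac * N.Pb * S.h ω * N.pathLossC N.xB /
    (N.aT * N.Pb * S.h ω * N.pathLossC N.xB + S.interference ω + N.noise)

/-- OMA received SINR `γ_c^OMA` of the connected user. -/
def sinrOMA (ω : Ω) : ℝ :=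
  N.Pb * S.h ω * N.pathLossC N.xB / (S.interference ω + N.noise)

/-- `Pr {γ_c > γ_c^th, γ > γ_c^OMA}`: the coverage probability of the connected user, when `γ` is
the average OMA SINR of the typical user. -/
def coverage (γ : ℝ≥0∞) : ℝ :=
  P.real {ω | N.gammaTh < S.sinr ω ∧ ENNReal.ofReal (S.sinrOMA ω) < γ}

/-- `𝔼[G (θ (I_c + σ²) / (P_b C r_c^(-α_c)))]` for a tail function `G`; it is `0` at `θ = ∞`.
For the tail function of `h` it is `Pr {h > θ (I_c + σ²) / (P_b C r_c^(-α_c))}`. -/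
def meanTail (G : ℝ → ℝ) (θ : ℝ≥0∞) : ℝ :=
  if θ = ∞ then 0 else
    ∫ ω, G (θ.toReal * (S.interference ω + N.noise) / (N.Pb * N.pathLossC N.xB)) ∂P

end ConnectedScenario

/-- The random objects seen by the typical user, who is at the origin: base stations
`X 0, X 1, …`, the location `R` of the RIS, the fading powers `g n` of the interfering links and
the fading power `h` of the desired link. -/
structure TypicalScenario (N : Network) {Ω : Type*} [MeasurableSpace Ω] (P : Measure Ω) where
  X : ℕ → Ω → Plane
  R : Ω → Plane
  g : ℕ → Ω → ℝ
  h : Ω → ℝ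
  poisson : IsHomogeneousPoisson P X N.lamB
  R_measurable : Measurable R
  R_uniform : pdf.IsUniform R (Metric.ball (0 : Plane) N.RL) P volume
  g_measurable : ∀ n, Measurable (g n)
  g_law : ∀ n, P.map (g n) = nakagamiPower N.mT
  g_indep : iIndepFun g P
  h_measurable : Measurable h
  h_law : P.map h = nakagamiPower N.mT
  g_h_indep : IndepFun (fun ω n => g n ω) h P
  X_R_indep : IndepFun (fun ω n => X n ω) R P
  geometry_fading_indep :
    IndepFun (fun ω => ((fun n => X n ω), R ω)) (fun ω => ((fun n => g n ω), h ω)) P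

namespace TypicalScenario

variable {N : Network} {Ω : Type*} [MeasurableSpace Ω] {P : Measure Ω} (T : TypicalScenario N P)

/-- Distance between the RIS and the associated base station, the nearest to the RIS among the
base stations outside the RIS ball of the typical user. -/
def rBR (ω : Ω) : ℝ := sInf {d | ∃ n, N.RL < ‖T.X n ω‖ ∧ d = dist (T.X n ω) (T.R ω)}

/-- Interference `I_{t,ρ_t}` at the typical user, from the base stations outside the RIS ball other
than the associated one. -/
def interference (ω : Ω) : ℝ := by
  classical exact
    N.rhoT * ∑' n, if N.RL < ‖T.X n ω‖ ∧ T.rBR ω < dist (T.X n ω) (T.R ω) then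
      N.Pb * T.g n ω * N.pathLossRIS (dist (T.X n ω) (T.R ω)) ‖T.R ω‖ else 0

/-- OMA received SINR `γ_t^OMA` of the typical user. -/
def sinrOMA (ω : Ω) : ℝ :=
  N.Pb * T.h ω * N.pathLossRIS (T.rBR ω) ‖T.R ω‖ / (T.interference ω + N.noise)

/-- `γ_t^E = 𝔼[γ_t^OMA]`, in `[0, ∞]`. -/
def avgSINR : ℝ≥0∞ := ∫⁻ ω, ENNReal.ofReal (T.sinrOMA ω) ∂P

/-- Interference received through a RIS at the fixed location `x` from all the base stations at
distance more than `r` from `x`. -/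
def interferenceBeyond (x : Plane) (r : ℝ) (ω : Ω) : ℝ := by
  classical exact
    N.rhoT * ∑' n, if r < dist (T.X n ω) x then
      N.Pb * T.g n ω * N.pathLossRIS (dist (T.X n ω) x) ‖x‖ else 0

end TypicalScenario

end

/-! Three arguments carry the theorem: a sign-change argument for Gamma tails, the Laplace
functional of a Poisson process with independent marks, and Jensen's inequality conditionally on the
geometry.

Tail bounds. The difference of the Gamma distribution function and `(1 - exp (-κ x)) ^ m` vanishes
at `0` and at infinity, so a fixed sign follows once its derivative, with the right orientation,
cannot become nonnegative again after being negative. `StaysNeg` records this pattern. It passes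
from a derivative to a function vanishing at `0` (`StaysNeg.of_deriv`) and survives removal of
positive factors and of common powers (`StaysNeg.of_pow`), which reduces both bounds to an evident
monotonicity.

Connected user. Since `a_t γ_c^th < a_c`, the decoding condition says that the OMA SINR exceeds
`θ_c`, so the coverage event places the OMA SINR between `θ_c` and `γ_t^E`. For a given interference
this is an interval for the fading power of the desired link, which is independent of the
interference and has no atoms; integrating it out gives a difference of mean tails (`coverage_eq`).
The binomial expansion of the surrogate tail turns its mean into Laplace transforms of the
interference. These come from `integral_exp_neg_tsum_mul`, and the radial integral in their exponent
is a Gauss hypergeometric value (`integral_ite_one_sub_inv_pow`). The error bounds insert the two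
tail bounds into the two terms of the difference in opposite directions.

Typical user. Campbell's formula gives the mean interference through a fixed surface. For the lower
bound on `γ_t^E`, the convex map `I ↦ W / (I + σ²)` is compared with its tangent at the mean
interference (`tangent_le`). What remains is that, after weighting by the nonnegative slope, the
true interference is at most its replacement in mean (`lintegral_sinrSlope_mul_interference_le`).
Conditioning on the nearest point is avoided by rounding its distance up to a grid: the rounded
distance depends on counts within a disc, which are independent of the points beyond it. The mesh,
and then a truncation near distance zero, are removed by limit theorems. -/

/-! ### Exponential bounds for the Gamma tail -/

/-- A function on `[0, ∞)` that, once negative, remains negative. -/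
def StaysNeg (f : ℝ → ℝ) : Prop := ∀ x y, 0 ≤ x → x ≤ y → f x < 0 → f y < 0

/-- The mean value theorem on `[0, x]` gives a point `ξ < x` of negative slope; the slope stays
negative from `ξ` on, so `f` decreases there. -/
lemma StaysNeg.exists_antitoneOn {f f' : ℝ → ℝ} (hf : ContinuousOn f (Set.Ici 0))
    (hd : ∀ x, 0 < x → HasDerivAt f (f' x) x) (h0 : f 0 = 0) (h' : StaysNeg f') {x : ℝ}
    (hx : 0 ≤ x) (hneg : f x < 0) : ∀ y, x ≤ y → f y ≤ f x := by
  have hx0 : 0 < x := lt_of_le_of_ne hx (by rintro rfl; linarith)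
  obtain ⟨ξ, hξ, hξ'⟩ := exists_hasDerivAt_eq_slope f f' hx0
    (hf.mono fun t ht => ht.1) (fun t ht => hd t ht.1)
  have hξneg : f' ξ < 0 := by
    rw [hξ']
    apply div_neg_of_neg_of_pos <;> linarith
  have hanti : AntitoneOn f (Set.Ici ξ) := by
    apply antitoneOn_of_deriv_nonpos (convex_Ici ξ)
      (hf.mono fun t (ht : ξ ≤ t) => (hξ.1.le.trans ht : (0 : ℝ) ≤ t))
    · intro t ht
      rw [interior_Ici] at ht
      exact (hd t (hξ.1.trans ht)).differentiableAt.differentiableWithinAt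
    · intro t ht
      rw [interior_Ici] at ht
      rw [(hd t (hξ.1.trans ht)).deriv]
      exact (h' ξ t hξ.1.le (le_of_lt ht) hξneg).le
  intro y hy
  exact hanti hξ.2.le (hξ.2.le.trans hy) hy

lemma StaysNeg.of_deriv {f f' : ℝ → ℝ} (hf : ContinuousOn f (Set.Ici 0))
    (hd : ∀ x, 0 < x → HasDerivAt f (f' x) x) (h0 : f 0 = 0) (h' : StaysNeg f') :
    StaysNeg f := fun _ _ hx hxy hneg =>
  (StaysNeg.exists_antitoneOn hf hd h0 h' hx hneg _ hxy).trans_lt hneg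

/-- A negative value would bound `f` from above ever after, which is incompatible with the limit
`0`. -/
lemma StaysNeg.nonneg_of_tendsto {f f' : ℝ → ℝ} (hf : ContinuousOn f (Set.Ici 0))
    (hd : ∀ x, 0 < x → HasDerivAt f (f' x) x) (h0 : f 0 = 0) (h' : StaysNeg f')
    (hlim : Filter.Tendsto f Filter.atTop (nhds 0)) {x : ℝ} (hx : 0 ≤ x) : 0 ≤ f x := by
  by_contra! hneg
  have := StaysNeg.exists_antitoneOn hf hd h0 h' hx hneg
  have h2 : (0 : ℝ) ≤ f x :=
    le_of_tendsto hlim ((Filter.eventually_ge_atTop x).mono fun y hy => this y hy)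
  linarith

lemma isProbabilityMeasure_nakagamiPower {m : ℕ} (hm : 0 < m) :
    IsProbabilityMeasure (nakagamiPower m) :=
  isProbabilityMeasure_gammaMeasure (Nat.cast_pos.2 hm) (Nat.cast_pos.2 hm)

/-- Density of the power of unit-mean Nakagami-`m` fading on `[0, ∞)`. -/
noncomputable def nakagamiDensity (m : ℕ) (x : ℝ) : ℝ :=
  (m : ℝ) ^ m / ((m - 1).factorial : ℝ) * x ^ (m - 1) * Real.exp (-(m * x))

lemma continuous_nakagamiDensity (m : ℕ) : Continuous (nakagamiDensity m) := by
  unfold nakagamiDensity; fun_prop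

lemma gammaPDFReal_eq_nakagamiDensity {m : ℕ} (hm : 0 < m) {x : ℝ} (hx : 0 ≤ x) :
    gammaPDFReal m m x = nakagamiDensity m x := by
  obtain ⟨k, rfl⟩ := Nat.exists_eq_succ_of_ne_zero hm.ne'
  have : ((k.succ : ℕ) : ℝ) - 1 = (k : ℕ) := by push_cast; ring
  rw [gammaPDFReal, if_pos hx, this, Real.rpow_natCast, Real.rpow_natCast]
  have h2 : Real.Gamma ((k.succ : ℕ) : ℝ) = k.factorial := by
    push_cast; exact Real.Gamma_nat_eq_factorial k
  rw [h2]; rfl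

lemma nakagamiTail_eq {m : ℕ} (hm : 0 < m) {x : ℝ} (hx : 0 ≤ x) :
    nakagamiTail m x = 1 - ∫ t in (0 : ℝ)..x, nakagamiDensity m t := by
  have := isProbabilityMeasure_nakagamiPower hm
  have h1 : nakagamiTail m x = 1 - cdf (nakagamiPower m) x := by
    rw [nakagamiTail, cdf_eq_real, ← Set.compl_Iic, probReal_compl_eq_one_sub measurableSet_Iic]
  rw [h1, nakagamiPower, cdf_gammaMeasure_eq_integral (Nat.cast_pos.2 hm) (Nat.cast_pos.2 hm)]
  have hsplit : (∫ t in Set.Iic x, gammaPDFReal m m t) =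
      ∫ t in Set.Ioc 0 x, gammaPDFReal m m t := by
    apply setIntegral_eq_of_subset_of_ae_sdiff_eq_zero
      measurableSet_Iic.nullMeasurableSet (fun t ht => ht.2)
    -- The point `0` is discarded because the density need not vanish there: for `m = 1` its value
    -- is `1`.
    have h0 : ∀ᵐ t : ℝ, t ≠ 0 := by simp [ae_iff]
    filter_upwards [h0] with t ht0 ht
    have : ¬ (0 < t) := fun h => ht.2 ⟨h, ht.1⟩
    have : ¬ (0 ≤ t) := fun h => this (lt_of_le_of_ne h ht0.symm)
    simp [gammaPDFReal, this]
  rw [hsplit, intervalIntegral.integral_of_le hx]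
  congr 1
  exact setIntegral_congr_fun measurableSet_Ioc fun t ht =>
    gammaPDFReal_eq_nakagamiDensity hm ht.1.le

lemma tendsto_integral_nakagamiDensity {m : ℕ} (hm : 0 < m) :
    Filter.Tendsto (fun x => ∫ t in (0 : ℝ)..x, nakagamiDensity m t) Filter.atTop (nhds 1) := by
  have := isProbabilityMeasure_nakagamiPower hm
  refine (tendsto_cdf_atTop (nakagamiPower m)).congr' ?_
  filter_upwards [Filter.eventually_ge_atTop 0] with x hx
  have h1 : nakagamiTail m x = 1 - cdf (nakagamiPower m) x := by
    rw [nakagamiTail, cdf_eq_real, ← Set.compl_Iic, probReal_compl_eq_one_sub measurableSet_Iic]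
  linarith [nakagamiTail_eq hm hx]

lemma hasDerivAt_integral_nakagamiDensity (m : ℕ) (x : ℝ) :
    HasDerivAt (fun x => ∫ t in (0 : ℝ)..x, nakagamiDensity m t) (nakagamiDensity m x) x :=
  (continuous_nakagamiDensity m).integral_hasStrictDerivAt 0 x |>.hasDerivAt

lemma hasDerivAt_one_sub_exp_pow (m : ℕ) (κ x : ℝ) :
    HasDerivAt (fun x => (1 - Real.exp (-(κ * x))) ^ m)
      (m * (1 - Real.exp (-(κ * x))) ^ (m - 1) * (κ * Real.exp (-(κ * x)))) x := by
  have h1 : HasDerivAt (fun x : ℝ => -(κ * x)) (-κ) x := by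
    simpa using ((hasDerivAt_id x).const_mul κ).fun_neg
  exact ((h1.exp.const_sub 1).fun_pow m).congr_deriv (by ring)

lemma tendsto_one_sub_exp_pow (m : ℕ) {κ : ℝ} (hκ : 0 < κ) :
    Filter.Tendsto (fun x => (1 - Real.exp (-(κ * x))) ^ m) Filter.atTop (nhds 1) := by
  have h1 : Filter.Tendsto (fun x : ℝ => Real.exp (-(κ * x))) Filter.atTop (nhds 0) :=
    Real.tendsto_exp_neg_atTop_nhds_zero.comp (Filter.tendsto_id.const_mul_atTop hκ)
  simpa using (h1.const_sub 1).pow m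

lemma alzerConst_pos {m : ℕ} (hm : 0 < m) : 0 < alzerConst m := by
  unfold alzerConst
  have : (0 : ℝ) < m := by exact_mod_cast hm
  positivity

/-- `(m / η) ^ m = m!`. -/
lemma alzerConst_pow {m : ℕ} (hm : 0 < m) :
    alzerConst m ^ m * (m.factorial : ℝ) = (m : ℝ) ^ m := by
  have hm' : (m : ℝ) ≠ 0 := by positivity
  have hf : (0 : ℝ) < m.factorial := by positivity
  rw [alzerConst, mul_pow, ← Real.rpow_natCast (_ ^ _) m, ← Real.rpow_mul hf.le]
  have : -(1 / (m : ℝ)) * m = -1 := by field_simp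
  rw [this, Real.rpow_neg_one]
  field_simp

/-- If `c y` stays below `d y` once it is below it, then the same is true for the corresponding
multiples of powers. -/
lemma StaysNeg.of_pow {k : ℕ} (hk : k ≠ 0) {c d w f : ℝ → ℝ} (hcd : StaysNeg (fun y => c y - d y))
    (hc : ∀ y, 0 ≤ y → 0 ≤ c y) (hd : ∀ y, 0 ≤ y → 0 ≤ d y) (hw : ∀ y, 0 ≤ y → 0 < w y)
    (hf : ∀ y, 0 ≤ y → f y = w y * (c y ^ k - d y ^ k)) : StaysNeg f := by
  have key : ∀ y, 0 ≤ y → (f y < 0 ↔ c y - d y < 0) := by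
    intro y hy
    rw [hf y hy, mul_neg_iff, sub_neg, sub_neg, pow_lt_pow_iff_left₀ (hc y hy) (hd y hy) hk]
    constructor
    · rintro (h | h)
      · exact h.2
      · exact absurd h.1 (hw y hy).not_gt
    · exact fun h => Or.inl ⟨hw y hy, h⟩
  intro x y hx hxy hneg
  rw [key x hx] at hneg
  rw [key y (hx.trans hxy)]
  exact hcd x y hx hxy hneg

/-- With rate `m` both derivatives contain the same factor `exp (-m y)`. What is left to compare is
the `(m - 1)`-th power of the concave function `1 - exp (-m y)` with that of a linear function `b
y`; a concave function that starts at `0` and falls below the line stays below it. -/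
lemma expTail_le_nakagamiTail {m : ℕ} (hm : 0 < m) {x : ℝ} (hx : 0 ≤ x) :
    expTail m m x ≤ nakagamiTail m x := by
  rw [nakagamiTail_eq hm hx, expTail]
  have hm' : (0 : ℝ) < m := by exact_mod_cast hm
  suffices h : 0 ≤ (1 - Real.exp (-((m : ℝ) * x))) ^ m - ∫ t in (0 : ℝ)..x, nakagamiDensity m t by
    linarith
  have hd : ∀ y : ℝ, HasDerivAt (fun x => (1 - Real.exp (-((m : ℝ) * x))) ^ m -
      ∫ t in (0 : ℝ)..x, nakagamiDensity m t)
      (m * (1 - Real.exp (-(m * y))) ^ (m - 1) * (m * Real.exp (-(m * y))) -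
        nakagamiDensity m y) y := fun y =>
    (hasDerivAt_one_sub_exp_pow m m y).sub (hasDerivAt_integral_nakagamiDensity m y)
  refine StaysNeg.nonneg_of_tendsto (f := fun x => (1 - Real.exp (-((m : ℝ) * x))) ^ m -
      ∫ t in (0 : ℝ)..x, nakagamiDensity m t)
    (fun y _ => (hd y).continuousAt.continuousWithinAt) (fun y _ => hd y)
    (by simp [hm.ne']) ?_ ?_ hx
  · obtain ⟨k, rfl⟩ := Nat.exists_eq_succ_of_ne_zero hm.ne'
    -- For `m = 1` the two tails coincide and the derivative vanishes identically; the comparison of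
    -- powers needs a nonzero exponent.
    rcases Nat.eq_zero_or_pos k with rfl | hk
    · intro x y _ _ h
      simp [nakagamiDensity] at h
    -- The slope for which the Gamma density divided by `m² exp (-m y)` is `(b y) ^ k`.
    set b : ℝ := (((k + 1 : ℕ) : ℝ) ^ k / ((k + 1).factorial)) ^ (1 / (k : ℝ)) with hb
    have hbk : b ^ k = ((k + 1 : ℕ) : ℝ) ^ k / ((k + 1).factorial) := by
      rw [hb, ← Real.rpow_natCast, ← Real.rpow_mul (by positivity)]
      rw [one_div_mul_cancel (by positivity), Real.rpow_one]
    have hb0 : 0 < b := by positivity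
    refine StaysNeg.of_pow hk.ne' (c := fun y => 1 - Real.exp (-((k + 1 : ℕ) * y)))
      (d := fun y => b * y) (w := fun y => ((k + 1 : ℕ) : ℝ) ^ 2 * Real.exp (-((k + 1 : ℕ) * y)))
      ?_ ?_ ?_ ?_ ?_
    · refine StaysNeg.of_deriv
        (f' := fun y => ((k + 1 : ℕ) : ℝ) * Real.exp (-(((k + 1 : ℕ) : ℝ) * y)) - b)
        (by fun_prop) ?_ (by simp) ?_
      · intro y _
        have h1 : HasDerivAt (fun x : ℝ => -(((k + 1 : ℕ) : ℝ) * x)) (-((k + 1 : ℕ) : ℝ)) y := by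
          simpa using ((hasDerivAt_id y).const_mul ((k + 1 : ℕ) : ℝ)).fun_neg
        exact ((h1.exp.const_sub 1).fun_sub ((hasDerivAt_id y).const_mul b)).congr_deriv (by ring)
      · intro x y hx hxy h
        refine lt_of_le_of_lt ?_ h
        dsimp only
        gcongr
    · intro y hy
      have : Real.exp (-(((k + 1 : ℕ) : ℝ) * y)) ≤ 1 := Real.exp_le_one_iff.2 (by
        have : 0 ≤ ((k + 1 : ℕ) : ℝ) * y := by positivity
        linarith)
      linarith
    · intro y hy; positivity
    · intro y hy; positivity
    · intro y hy
      rw [mul_pow, hbk, nakagamiDensity, Nat.succ_eq_add_one, Nat.add_sub_cancel,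
        Nat.factorial_succ]
      push_cast
      field_simp
      ring
  · simpa using (tendsto_one_sub_exp_pow m hm').sub (tendsto_integral_nakagamiDensity hm)

/-- This is Alzer's inequality. The value of `η`, through `η ^ m * m! = m ^ m`, gives the density
the same constant as the derivative of the surrogate, so that after removal of `m η exp (-η y)` two
`(m - 1)`-th powers are compared, with no numerical factor left. -/
lemma nakagamiTail_le_expTail {m : ℕ} (hm : 0 < m) {x : ℝ} (hx : 0 ≤ x) :
    nakagamiTail m x ≤ expTail m (alzerConst m) x := by
  rw [nakagamiTail_eq hm hx, expTail]
  have hm' : (0 : ℝ) < m := by exact_mod_cast hm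
  have hη := alzerConst_pos hm
  have hpow := alzerConst_pow hm
  set η := alzerConst m
  suffices h : 0 ≤ (∫ t in (0 : ℝ)..x, nakagamiDensity m t) - (1 - Real.exp (-(η * x))) ^ m by
    linarith
  have hd : ∀ y : ℝ, HasDerivAt (fun x => (∫ t in (0 : ℝ)..x, nakagamiDensity m t) -
      (1 - Real.exp (-(η * x))) ^ m)
      (nakagamiDensity m y -
        m * (1 - Real.exp (-(η * y))) ^ (m - 1) * (η * Real.exp (-(η * y)))) y := fun y =>
    (hasDerivAt_integral_nakagamiDensity m y).sub (hasDerivAt_one_sub_exp_pow m η y)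
  refine StaysNeg.nonneg_of_tendsto (f := fun x => (∫ t in (0 : ℝ)..x, nakagamiDensity m t) -
      (1 - Real.exp (-(η * x))) ^ m)
    (fun y _ => (hd y).continuousAt.continuousWithinAt) (fun y _ => hd y)
    (by simp [hm.ne']) ?_ ?_ hx
  · obtain ⟨k, rfl⟩ := Nat.exists_eq_succ_of_ne_zero hm.ne'
    rcases Nat.eq_zero_or_pos k with rfl | hk
    · intro x y _ _ h
      simp at hpow
      simp [nakagamiDensity, hpow] at h
    have hk' : (k : ℝ) ≠ 0 := by positivity
    -- Chosen so that `exp (-η y) * exp (-c y) ^ k = exp (-m y)`: the surplus exponential of the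
    -- density is absorbed into the `k`-th power.
    set c : ℝ := (((k + 1 : ℕ) : ℝ) - η) / k with hc
    have hck : c * k = ((k + 1 : ℕ) : ℝ) - η := by rw [hc]; field_simp
    refine StaysNeg.of_pow hk.ne' (c := fun y => η * y * Real.exp (-(c * y)))
      (d := fun y => 1 - Real.exp (-(η * y)))
      (w := fun y => ((k + 1 : ℕ) : ℝ) * η * Real.exp (-(η * y)))
      ?_ ?_ ?_ ?_ ?_
    -- After multiplication by `exp (c y)` the difference and its first derivative vanish at `0`,
    -- and the second derivative is `exp (c y)` times a decreasing function. Two uses of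
    -- `StaysNeg.of_deriv` then suffice, whatever the sign of `c`.
    · have key : StaysNeg (fun y => η * y - Real.exp (c * y) + Real.exp ((c - η) * y)) := by
        have hexp : ∀ a y : ℝ, HasDerivAt (fun y => Real.exp (a * y)) (a * Real.exp (a * y)) y := by
          intro a y
          have h1 : HasDerivAt (fun x : ℝ => a * x) a y := by
            simpa using (hasDerivAt_id y).const_mul a
          exact h1.exp.congr_deriv (by ring)
        refine StaysNeg.of_deriv
          (f' := fun y => η - c * Real.exp (c * y) + (c - η) * Real.exp ((c - η) * y))
          (by fun_prop) ?_ (by simp) ?_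
        · intro y _
          have h1 : HasDerivAt (fun x : ℝ => η * x) η y := by
            simpa using (hasDerivAt_id y).const_mul η
          exact (h1.sub (hexp c y)).add (hexp (c - η) y)
        · refine StaysNeg.of_deriv
            (f' := fun y => Real.exp (c * y) * ((c - η) ^ 2 * Real.exp (-(η * y)) - c ^ 2))
            (by fun_prop) ?_ (by simp) ?_
          · intro y _
            refine ((((hexp c y).const_mul c).const_sub η).fun_add
              ((hexp (c - η) y).const_mul (c - η))).congr_deriv ?_
            have : (c - η) * y = c * y + -(η * y) := by ring
            rw [this, Real.exp_add]
            ring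
          · intro x y hx hxy h
            have h1 : (c - η) ^ 2 * Real.exp (-(η * x)) - c ^ 2 < 0 :=
              neg_of_mul_neg_right h (Real.exp_pos _).le
            refine mul_neg_of_pos_of_neg (Real.exp_pos _) (lt_of_le_of_lt ?_ h1)
            gcongr
      have heq : ∀ y, η * y * Real.exp (-(c * y)) - (1 - Real.exp (-(η * y))) =
          Real.exp (-(c * y)) * (η * y - Real.exp (c * y) + Real.exp ((c - η) * y)) := by
        intro y
        have h1 : Real.exp (-(c * y)) * Real.exp (c * y) = 1 := by rw [← Real.exp_add]; simp
        have h2 : Real.exp (-(c * y)) * Real.exp ((c - η) * y) = Real.exp (-(η * y)) := by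
          rw [← Real.exp_add]; ring_nf
        linear_combination h1 - h2
      intro x y hx hxy h
      simp only [heq] at h ⊢
      exact mul_neg_of_pos_of_neg (Real.exp_pos _)
        (key x y hx hxy (neg_of_mul_neg_right h (Real.exp_pos _).le))
    · intro y hy; positivity
    · intro y hy
      have : Real.exp (-(η * y)) ≤ 1 := Real.exp_le_one_iff.2 (by
        have : 0 ≤ η * y := by positivity
        linarith)
      linarith
    · intro y hy; positivity
    · intro y hy
      rw [Nat.succ_eq_add_one] at hpow
      have he : Real.exp (-(η * y)) * Real.exp (-(c * y)) ^ k =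
          Real.exp (-(((k + 1 : ℕ) : ℝ) * y)) := by
        rw [← Real.exp_nat_mul, ← Real.exp_add]
        congr 1
        linear_combination (-y) * hck
      rw [nakagamiDensity, Nat.succ_eq_add_one, Nat.add_sub_cancel, mul_sub, mul_pow, mul_pow,
        ← he, ← hpow, Nat.factorial_succ]
      push_cast
      field_simp
      ring
  · simpa using (tendsto_integral_nakagamiDensity hm).sub (tendsto_one_sub_exp_pow m hη)

/-! ### Mean and Laplace transform of the fading power -/

lemma measurable_gammaPDF (a r : ℝ) : Measurable (gammaPDF a r) :=
  (measurable_gammaPDFReal a r).ennreal_ofReal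

lemma lintegral_nakagamiPower (m : ℕ) {f : ℝ → ℝ≥0∞} (hf : Measurable f) :
    ∫⁻ x, f x ∂nakagamiPower m = ∫⁻ x, gammaPDF m m x * f x := by
  rw [nakagamiPower, gammaMeasure,
    lintegral_withDensity_eq_lintegral_mul _ (measurable_gammaPDF _ _) hf]
  rfl

/-- Multiplication by `x` turns the density with shape and rate `m` into the Gamma density of shape
`m + 1` and rate `m`, with constant `1`. -/
lemma lintegral_ofReal_nakagamiPower {m : ℕ} (hm : 0 < m) :
    ∫⁻ x, ENNReal.ofReal x ∂nakagamiPower m = 1 := by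
  have hm' : (0 : ℝ) < m := by exact_mod_cast hm
  rw [lintegral_nakagamiPower m ENNReal.measurable_ofReal,
    ← lintegral_gammaPDF_eq_one (a := (m : ℝ) + 1) (r := m) (by positivity) hm']
  refine lintegral_congr fun x => ?_
  rcases lt_or_ge x 0 with hx | hx
  · simp [gammaPDF_of_neg hx]
  rw [gammaPDF, gammaPDF, ← ENNReal.ofReal_mul (gammaPDFReal_nonneg hm' hm' x)]
  congr 1
  rw [gammaPDFReal, gammaPDFReal, if_pos hx, if_pos hx, Real.Gamma_add_one hm'.ne',
    Real.rpow_add_one hm'.ne', add_sub_cancel_right]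
  rcases hx.eq_or_lt with rfl | hx'
  · simp [Real.zero_rpow hm'.ne']
  · rw [Real.rpow_sub_one hx'.ne']
    have := (Real.Gamma_pos_of_pos hm').ne'
    field_simp

/-- Exponential tilting: `exp (-t x)` times the density is a constant times the Gamma density of
shape `m` and rate `m + t`. -/
lemma lintegral_exp_neg_nakagamiPower {m : ℕ} (hm : 0 < m) {t : ℝ} (ht : 0 ≤ t) :
    ∫⁻ x, ENNReal.ofReal (Real.exp (-(t * x))) ∂nakagamiPower m =
      ENNReal.ofReal (((1 + t / m) ^ m)⁻¹) := by
  have hm' : (0 : ℝ) < m := by exact_mod_cast hm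
  have hmt : 0 < (m : ℝ) + t := by positivity
  rw [lintegral_nakagamiPower m (by fun_prop),
    ← mul_one (ENNReal.ofReal (((1 + t / m) ^ m)⁻¹)),
    ← lintegral_gammaPDF_eq_one (a := (m : ℝ)) (r := m + t) hm' hmt,
    ← lintegral_const_mul _ (measurable_gammaPDF _ _)]
  refine lintegral_congr fun x => ?_
  rcases lt_or_ge x 0 with hx | hx
  · simp [gammaPDF_of_neg hx]
  rw [gammaPDF, gammaPDF, ← ENNReal.ofReal_mul (gammaPDFReal_nonneg hm' hm' x),
    ← ENNReal.ofReal_mul (by positivity)]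
  congr 1
  rw [gammaPDFReal, gammaPDFReal, if_pos hx, if_pos hx, mul_assoc, ← Real.exp_add,
    Real.rpow_natCast, Real.rpow_natCast]
  have h1 : 1 + t / m = (m + t) / m := by field_simp
  have h2 : -(m * x) + -(t * x) = -((m + t) * x) := by ring
  rw [h1, h2, div_pow]
  have := (Real.Gamma_pos_of_pos hm').ne'
  field_simp

lemma ae_nonneg_nakagamiPower (m : ℕ) : ∀ᵐ x ∂nakagamiPower m, 0 ≤ x := by
  rw [ae_iff]
  have : {x : ℝ | ¬ 0 ≤ x} = Set.Iio 0 := by ext; simp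
  rw [this, nakagamiPower, gammaMeasure, withDensity_apply _ measurableSet_Iio]
  exact lintegral_gammaPDF_of_nonpos le_rfl

instance nullSingletonClass_nakagamiPower (m : ℕ) : NullSingletonClass (nakagamiPower m) := by
  unfold nakagamiPower gammaMeasure
  infer_instance

lemma ae_nonneg_of_map_eq_nakagamiPower {Ω : Type*} [MeasurableSpace Ω] {P : Measure Ω} {m : ℕ}
    {h : Ω → ℝ} (hh : Measurable h) (hlaw : P.map h = nakagamiPower m) : ∀ᵐ ω ∂P, 0 ≤ h ω := by
  have := ae_nonneg_nakagamiPower m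
  rw [← hlaw] at this
  exact ae_of_ae_map hh.aemeasurable this

lemma lintegral_ofReal_of_map_eq_nakagamiPower {Ω : Type*} [MeasurableSpace Ω] {P : Measure Ω}
    {m : ℕ} (hm : 0 < m) {h : Ω → ℝ} (hh : Measurable h) (hlaw : P.map h = nakagamiPower m) :
    ∫⁻ ω, ENNReal.ofReal (h ω) ∂P = 1 := by
  rw [← lintegral_ofReal_nakagamiPower hm, ← hlaw, lintegral_map ENNReal.measurable_ofReal hh]

/-- If `X` is independent of `(Y, Z)` and `Y` of `Z`, then `(X, Y)` is independent of `Z`. -/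
lemma indepFun_prodMk_of_indepFun_prodMk {Ω α β γ : Type*} [MeasurableSpace Ω] [MeasurableSpace α]
    [MeasurableSpace β] [MeasurableSpace γ] {P : Measure Ω} [IsProbabilityMeasure P]
    {X : Ω → α} {Y : Ω → β} {Z : Ω → γ} (hX : Measurable X) (hY : Measurable Y)
    (hZ : Measurable Z) (h1 : IndepFun X (fun ω => (Y ω, Z ω)) P) (h2 : IndepFun Y Z P) :
    IndepFun (fun ω => (X ω, Y ω)) Z P := by
  have hXY : IndepFun X Y P := h1.comp measurable_id measurable_fst
  rw [indepFun_iff_map_prod_eq_prod_map_map (by fun_prop) (by fun_prop)] at h1 h2 hXY ⊢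
  have := Measure.isProbabilityMeasure_map (μ := P) hX.aemeasurable
  have := Measure.isProbabilityMeasure_map (μ := P) hY.aemeasurable
  have := Measure.isProbabilityMeasure_map (μ := P) hZ.aemeasurable
  -- The joint law of the triple is the product of its three marginals, and this product is
  -- associative.
  rw [hXY, ← (measurePreserving_prodAssoc (P.map X) (P.map Y) (P.map Z)).symm.map_eq, ← h2, ← h1,
    Measure.map_map (by fun_prop) (by fun_prop)]
  rfl

/-! ### Poisson counts and Campbell's formula -/

/-- Counts as series of indicators: this makes them measurable and lets Tonelli's theorem apply. -/
lemma toENNReal_pointCount (x : ℕ → Plane) (B : Set Plane) :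
    (pointCount x B : ℝ≥0∞) = ∑' n, B.indicator 1 (x n) := by
  rw [pointCount, ← ENNReal.tsum_set_one, tsum_subtype {n : ℕ | x n ∈ B} (fun _ => (1 : ℝ≥0∞))]
  rfl

lemma pointCount_eq_zero_iff (x : ℕ → Plane) (B : Set Plane) :
    pointCount x B = 0 ↔ ∀ n, x n ∉ B := by
  simp [pointCount, Set.encard_eq_zero, Set.eq_empty_iff_forall_notMem]

lemma measurable_pointCount {Ω : Type*} [MeasurableSpace Ω] {X : ℕ → Ω → Plane}
    (hX : ∀ n, Measurable (X n)) {B : Set Plane} (hB : MeasurableSet B) :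
    Measurable fun ω => pointCount (fun n => X n ω) B := by
  have h1 : Measurable fun ω => (pointCount (fun n => X n ω) B : ℝ≥0∞) := by
    simp_rw [toENNReal_pointCount]
    exact Measurable.tsum fun n => (measurable_one.indicator hB).comp (hX n)
  refine measurable_to_countable' fun k => ?_
  have : (fun ω => pointCount (fun n => X n ω) B) ⁻¹' {k} =
      (fun ω => (pointCount (fun n => X n ω) B : ℝ≥0∞)) ⁻¹' {(k : ℝ≥0∞)} := by
    ext ω; simp
  rw [this]
  exact h1 (measurableSet_singleton _)

/-- Laplace transform of the Poisson distribution. -/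
lemma lintegral_exp_neg_poissonMeasure (r : NNReal) (t : ℝ) :
    ∫⁻ k, ENNReal.ofReal (Real.exp (-(t * k))) ∂poissonMeasure r =
      ENNReal.ofReal (Real.exp (-(r * (1 - Real.exp (-t))))) := by
  have hterm : ∀ n : ℕ, Real.exp (-r) * (r : ℝ) ^ n / n.factorial * Real.exp (-(t * n)) =
      Real.exp (-r) * ((r * Real.exp (-t)) ^ n / n.factorial) := by
    intro n
    rw [mul_pow, ← Real.exp_nat_mul, mul_neg, mul_comm (n : ℝ) t]
    ring
  have hs : HasSum (fun n : ℕ => Real.exp (-r) * (r : ℝ) ^ n / n.factorial * Real.exp (-(t * n)))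
      (Real.exp (-(r * (1 - Real.exp (-t))))) := by
    simp_rw [hterm]
    have h1 := (NormedSpace.expSeries_div_hasSum_exp (r * Real.exp (-t))).mul_left (Real.exp (-r))
    rw [← Real.exp_eq_exp_ℝ, ← Real.exp_add] at h1
    convert! h1 using 2
    ring
  rw [poissonMeasure, lintegral_sum_measure, ← hs.tsum_eq, ENNReal.ofReal_tsum_of_nonneg
    (fun n => by positivity) hs.summable]
  refine tsum_congr fun n => ?_
  rw [lintegral_smul_measure, lintegral_dirac, smul_eq_mul, ← ENNReal.ofReal_mul (by positivity)]

/-- The mean of the Poisson distribution. -/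
lemma lintegral_id_poissonMeasure (r : NNReal) :
    ∫⁻ k, (k : ℝ≥0∞) ∂poissonMeasure r = r := by
  have hs : HasSum (fun n : ℕ => Real.exp (-r) * (r : ℝ) ^ n / n.factorial * n) (r : ℝ) := by
    -- The term of index `0` vanishes; after the shift each term is `r` times a Poisson weight.
    rw [← hasSum_nat_add_iff' 1]
    simp only [Finset.range_one, Finset.sum_singleton, CharP.cast_eq_zero, mul_zero, sub_zero]
    have h1 := (hasSum_one_poissonMeasure r).mul_left (r : ℝ)
    rw [mul_one] at h1
    convert! h1 using 2 with n
    rw [Nat.factorial_succ]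
    push_cast
    field_simp
    ring
  have hsum : (r : ℝ≥0∞) = ∑' n : ℕ,
      ENNReal.ofReal (Real.exp (-r) * (r : ℝ) ^ n / n.factorial * n) := by
    rw [← ENNReal.ofReal_tsum_of_nonneg (fun n => by positivity) hs.summable, hs.tsum_eq,
      ENNReal.ofReal_coe_nnreal]
  rw [poissonMeasure, lintegral_sum_measure, hsum]
  refine tsum_congr fun n => ?_
  rw [lintegral_smul_measure, lintegral_dirac, smul_eq_mul, ENNReal.ofReal_mul (by positivity),
    ENNReal.ofReal_natCast]

namespace IsHomogeneousPoisson

variable {Ω : Type*} [MeasurableSpace Ω] {P : Measure Ω} {X : ℕ → Ω → Plane} {lam : ℝ}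

lemma measurable_count (hX : IsHomogeneousPoisson P X lam) {B : Set Plane}
    (hB : MeasurableSet B) : Measurable fun ω => pointCount (fun n => X n ω) B :=
  measurable_pointCount hX.measurable hB

variable [IsProbabilityMeasure P]

/-- `count_law` prescribes only the masses of the finite values. They already sum to `1`, which
leaves no mass for `⊤`. -/
lemma map_count (hX : IsHomogeneousPoisson P X lam) (hlam : 0 < lam) {B : Set Plane}
    (hB : MeasurableSet B) (hvol : volume B ≠ ∞) :
    P.map (fun ω => pointCount (fun n => X n ω) B) =
      (poissonMeasure (lam * (volume B).toReal).toNNReal).map ((↑) : ℕ → ℕ∞) := by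
  have hr : ((lam * (volume B).toReal).toNNReal : ℝ) = lam * (volume B).toReal :=
    Real.coe_toNNReal _ (by positivity)
  have hN := hX.measurable_count hB
  set N := fun ω => pointCount (fun n => X n ω) B with hNdef
  have := Measure.isProbabilityMeasure_map (μ := P) hN.aemeasurable
  have := Measure.isProbabilityMeasure_map (μ := poissonMeasure (lam * (volume B).toReal).toNNReal)
    (f := ((↑) : ℕ → ℕ∞)) measurable_from_nat.aemeasurable
  have hpt : ∀ k : ℕ, P.map N {(k : ℕ∞)} =
      (poissonMeasure (lam * (volume B).toReal).toNNReal).map ((↑) : ℕ → ℕ∞) {(k : ℕ∞)} := by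
    intro k
    rw [Measure.map_apply hN (measurableSet_singleton _),
      Measure.map_apply measurable_from_nat (measurableSet_singleton _)]
    have h1 : ((↑) : ℕ → ℕ∞) ⁻¹' {(k : ℕ∞)} = {k} := by ext; simp
    rw [h1, poissonMeasure_singleton, hr]
    exact hX.count_law B hB hvol k
  have htop2 : (poissonMeasure (lam * (volume B).toReal).toNNReal).map ((↑) : ℕ → ℕ∞) {⊤} = 0 := by
    rw [Measure.map_apply measurable_from_nat (measurableSet_singleton _)]
    have h1 : ((↑) : ℕ → ℕ∞) ⁻¹' {⊤} = ∅ := by ext; simp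
    rw [h1, measure_empty]
  have hrange : (Set.range ((↑) : ℕ → ℕ∞)) = {⊤}ᶜ := by
    ext k
    simp only [Set.mem_range, Set.mem_compl_iff, Set.mem_singleton_iff]
    exact ENat.ne_top_iff_exists.symm
  have hsum : ∀ μ : Measure ℕ∞, μ {⊤}ᶜ = ∑' k : ℕ, μ {(k : ℕ∞)} := by
    intro μ
    rw [← hrange, ← Set.iUnion_singleton_eq_range, measure_iUnion _ fun _ => MeasurableSet.singleton _]
    intro i j hij
    simpa using hij
  have htop1 : P.map N {⊤} = 0 := by
    rw [← prob_compl_eq_one_iff (measurableSet_singleton _), hsum, tsum_congr hpt, ← hsum,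
      prob_compl_eq_one_iff (measurableSet_singleton _), htop2]
  refine Measure.ext_of_singleton fun k => ?_
  induction k using ENat.recTopCoe with
  | top => rw [htop1, htop2]
  | coe k => exact hpt k

lemma ae_count_ne_top (hX : IsHomogeneousPoisson P X lam) (hlam : 0 < lam) {B : Set Plane}
    (hB : MeasurableSet B) (hvol : volume B ≠ ∞) :
    ∀ᵐ ω ∂P, pointCount (fun n => X n ω) B ≠ ⊤ := by
  refine ae_of_ae_map (p := fun k => k ≠ ⊤) (hX.measurable_count hB).aemeasurable ?_
  rw [hX.map_count hlam hB hvol, ae_map_iff measurable_from_nat.aemeasurable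
    (MeasurableSet.of_discrete)]
  exact Filter.Eventually.of_forall fun k => ENat.natCast_ne_top k

lemma lintegral_exp_neg_count (hX : IsHomogeneousPoisson P X lam) (hlam : 0 < lam) {B : Set Plane}
    (hB : MeasurableSet B) (hvol : volume B ≠ ∞) (t : ℝ) :
    ∫⁻ ω, ENNReal.ofReal (Real.exp (-(t * (pointCount (fun n => X n ω) B).toNat))) ∂P =
      ENNReal.ofReal (Real.exp (-(lam * (volume B).toReal * (1 - Real.exp (-t))))) := by
  have hr : ((lam * (volume B).toReal).toNNReal : ℝ) = lam * (volume B).toReal :=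
    Real.coe_toNNReal _ (by positivity)
  rw [← lintegral_map (f := fun k : ℕ∞ => ENNReal.ofReal (Real.exp (-(t * k.toNat))))
    .of_discrete (hX.measurable_count hB), hX.map_count hlam hB hvol,
    lintegral_map .of_discrete measurable_from_nat]
  simp only [ENat.toNat_natCast]
  rw [lintegral_exp_neg_poissonMeasure, hr]

lemma lintegral_pointCount (hX : IsHomogeneousPoisson P X lam) (hlam : 0 < lam) {B : Set Plane}
    (hB : MeasurableSet B) (hvol : volume B ≠ ∞) :
    ∫⁻ ω, (pointCount (fun n => X n ω) B : ℝ≥0∞) ∂P = ENNReal.ofReal lam * volume B := by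
  rw [← lintegral_map (f := fun k : ℕ∞ => (k : ℝ≥0∞))
    .of_discrete (hX.measurable_count hB), hX.map_count hlam hB hvol,
    lintegral_map .of_discrete measurable_from_nat]
  simp only [ENat.toENNReal_coe]
  rw [lintegral_id_poissonMeasure]
  nth_rw 2 [← ENNReal.ofReal_toReal hvol]
  rw [← ENNReal.ofReal_mul hlam.le, ENNReal.ofReal]

/-- Campbell's formula for the points in `B`, on an event `E` that is independent of the
configuration in `B`. -/
lemma setLIntegral_tsum_indicator (hX : IsHomogeneousPoisson P X lam) (hlam : 0 < lam)
    {E : Set Ω} {B : Set Plane} (hB : MeasurableSet B)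
    (hEB : ∀ C, MeasurableSet C → C ⊆ B →
      ∫⁻ ω in E, (pointCount (fun n => X n ω) C : ℝ≥0∞) ∂P =
        P E * ∫⁻ ω, (pointCount (fun n => X n ω) C : ℝ≥0∞) ∂P)
    {v : Plane → ℝ≥0∞} (hv : Measurable v) :
    ∫⁻ ω in E, ∑' n, B.indicator v (X n ω) ∂P = P E * (ENNReal.ofReal lam * ∫⁻ x in B, v x) := by
  -- The sum of the laws of the points on the event `E` is, inside `B`, a multiple of Lebesgue
  -- measure. It is identified on balls of integer radius, where the area is finite and the mean
  -- count is known.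
  have hmeas : (Measure.sum fun n => (P.restrict E).map (X n)).restrict B =
      (P E * ENNReal.ofReal lam) • (volume.restrict B : Measure Plane) := by
    rw [Measure.ext_iff_of_iUnion_eq_univ (s := fun k : ℕ => Metric.ball (0 : Plane) k)
      (Metric.iUnion_ball_nat 0)]
    intro k
    ext C hC
    rw [Measure.restrict_apply hC, Measure.restrict_apply hC, Measure.smul_apply,
      Measure.restrict_apply (hC.inter measurableSet_ball),
      Measure.restrict_apply (hC.inter measurableSet_ball)]
    set D := C ∩ Metric.ball (0 : Plane) k ∩ B with hD
    have hDm : MeasurableSet D := (hC.inter measurableSet_ball).inter hB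
    have hDvol : volume D ≠ ∞ := measure_ne_top_of_subset
      (fun x hx => hx.1.2 : D ⊆ Metric.ball (0 : Plane) k) measure_ball_lt_top.ne
    rw [Measure.sum_apply _ hDm, smul_eq_mul, mul_assoc, ← hX.lintegral_pointCount hlam hDm hDvol,
      ← hEB D hDm Set.inter_subset_right]
    simp_rw [toENNReal_pointCount]
    rw [lintegral_tsum (f := fun n ω => D.indicator 1 (X n ω)) fun n =>
      ((measurable_one.indicator hDm).comp (hX.measurable n)).aemeasurable]
    refine tsum_congr fun n => ?_
    rw [← lintegral_map (measurable_one.indicator hDm) (hX.measurable n), lintegral_indicator_one hDm]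
  rw [lintegral_tsum (f := fun n ω => B.indicator v (X n ω))
    fun n => ((hv.indicator hB).comp (hX.measurable n)).aemeasurable]
  simp_rw [← fun n => lintegral_map (μ := P.restrict E) (hv.indicator hB) (hX.measurable n)]
  rw [← lintegral_sum_measure, lintegral_indicator hB, hmeas, lintegral_smul_measure, smul_eq_mul,
    mul_assoc]

/-- Campbell's formula. -/
lemma lintegral_sum_points (hX : IsHomogeneousPoisson P X lam) (hlam : 0 < lam)
    {v : Plane → ℝ≥0∞} (hv : Measurable v) :
    ∫⁻ ω, ∑' n, v (X n ω) ∂P = ENNReal.ofReal lam * ∫⁻ x, v x := by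
  have := hX.setLIntegral_tsum_indicator (E := Set.univ) hlam MeasurableSet.univ
    (fun C _ _ => by simp) hv
  simpa using this

/-- Campbell's formula for the points in `B`, on an event determined by the numbers of points in
two sets that are disjoint from `B`. -/
lemma setLIntegral_tsum_indicator_of_disjoint (hX : IsHomogeneousPoisson P X lam) (hlam : 0 < lam)
    {A₀ A₁ B : Set Plane} (hA₀ : MeasurableSet A₀) (hA₁ : MeasurableSet A₁) (hB : MeasurableSet B)
    (h01 : Disjoint A₀ A₁) (h0 : Disjoint A₀ B) (h1 : Disjoint A₁ B) (K : Set (ℕ∞ × ℕ∞))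
    {v : Plane → ℝ≥0∞} (hv : Measurable v) :
    let E := {ω | (pointCount (fun n => X n ω) A₀, pointCount (fun n => X n ω) A₁) ∈ K}
    ∫⁻ ω in E, ∑' n, B.indicator v (X n ω) ∂P = P E * (ENNReal.ofReal lam * ∫⁻ x in B, v x) := by
  intro E
  have hZ : Measurable fun ω => (pointCount (fun n => X n ω) A₀, pointCount (fun n => X n ω) A₁) :=
    (hX.measurable_count hA₀).prodMk (hX.measurable_count hA₁)
  have hK : MeasurableSet K := .of_discrete
  have hE : MeasurableSet E := hZ hK
  refine hX.setLIntegral_tsum_indicator hlam hB (fun C hC hCB => ?_) hv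
  -- Independence of counts is formulated for sequences of sets, so the three sets are continued by
  -- `∅`.
  let F : ℕ → Set Plane := fun i => if i = 0 then A₀ else if i = 1 then A₁ else
    if i = 2 then C else ∅
  have hF : ∀ i, MeasurableSet (F i) := by
    intro i; simp only [F]; split_ifs <;> first | assumption | exact MeasurableSet.empty
  have h0C := h0.mono_right hCB
  have h1C := h1.mono_right hCB
  have hdisj : Pairwise (Function.onFun Disjoint F) := by
    intro i j hij
    simp only [Function.onFun, F]
    split_ifs <;> first | omega | simp [*] | skip
    all_goals first | exact h01 | exact h01.symm | exact h0C.symm | exact h1C.symm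
  have hind := (hX.count_indep F hF hdisj).indepFun_prodMk (fun i => hX.measurable_count (hF i))
    0 1 2 (by norm_num) (by norm_num)
  have hFi : F 0 = A₀ ∧ F 1 = A₁ ∧ F 2 = C := by simp [F]
  simp only [hFi] at hind
  have hprod := lintegral_mul_eq_lintegral_mul_lintegral_of_indepFun''
    ((measurable_one.indicator hK).comp hZ).aemeasurable
    ((Measurable.of_discrete (f := fun k : ℕ∞ => (k : ℝ≥0∞))).comp
      (hX.measurable_count hC)).aemeasurable
    (hind.comp (φ := K.indicator (1 : ℕ∞ × ℕ∞ → ℝ≥0∞)) (ψ := fun k : ℕ∞ => (k : ℝ≥0∞))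
      (measurable_one.indicator hK) .of_discrete)
  have hPE : ∫⁻ ω, (K.indicator (1 : ℕ∞ × ℕ∞ → ℝ≥0∞) ∘ fun ω =>
      (pointCount (fun n => X n ω) A₀, pointCount (fun n => X n ω) A₁)) ω ∂P = P E := by
    rw [← lintegral_indicator_one hE]; rfl
  rw [hPE] at hprod
  rw [← lintegral_indicator hE]
  refine Eq.trans (lintegral_congr fun ω => ?_) hprod
  by_cases hω : (pointCount (fun n => X n ω) A₀, pointCount (fun n => X n ω) A₁) ∈ K
  · have hωE : ω ∈ E := hω
    simp [hω, hωE]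
  · have hωE : ω ∉ E := hω
    simp [hω, hωE]

end IsHomogeneousPoisson

/-! ### The Laplace functional of a Poisson process -/

namespace IsHomogeneousPoisson

variable {Ω : Type*} [MeasurableSpace Ω] {P : Measure Ω} {X : ℕ → Ω → Plane} {lam : ℝ}
  [IsProbabilityMeasure P]

lemma ae_tsum_ne_top (hX : IsHomogeneousPoisson P X lam) (hlam : 0 < lam)
    {v : Plane → ℝ≥0∞} (hv : Measurable v) (hfin : ∫⁻ x, v x ≠ ∞) :
    ∀ᵐ ω ∂P, ∑' n, v (X n ω) ≠ ∞ := by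
  have h1 := hX.lintegral_sum_points hlam hv
  have h2 : ∫⁻ ω, ∑' n, v (X n ω) ∂P ≠ ∞ := by
    rw [h1]; exact ENNReal.mul_ne_top ENNReal.ofReal_ne_top hfin
  filter_upwards [ae_lt_top (Measurable.tsum fun n => hv.comp (hX.measurable n)) h2] with ω hω
  exact hω.ne

lemma ae_summable (hX : IsHomogeneousPoisson P X lam) (hlam : 0 < lam)
    {f : Plane → ℝ} (hf : Measurable f) (hint : Integrable f) (hf0 : ∀ x, 0 ≤ f x) :
    ∀ᵐ ω ∂P, Summable fun n => f (X n ω) := by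
  have hfin : ∫⁻ x, ENNReal.ofReal (f x) ≠ ∞ := hint.lintegral_lt_top.ne
  filter_upwards [hX.ae_tsum_ne_top hlam hf.ennreal_ofReal hfin] with ω hω
  have := ENNReal.summable_toReal hω
  refine this.congr fun n => ?_
  rw [ENNReal.toReal_ofReal (hf0 _)]

/-- The points are grouped by the value of `g`. In `ℝ≥0∞` the sums may be exchanged freely; finite
counts bring the right side back to real numbers. -/
lemma tsum_natCast_eq_sum_pointCount {g : Plane → ℕ} {K : ℕ} (hK : ∀ x, g x ≤ K)
    {x : ℕ → Plane} (hfin : ∀ i ∈ Finset.Icc 1 K, pointCount x (g ⁻¹' {i}) ≠ ⊤) :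
    ∑' n, (g (x n) : ℝ) =
      ∑ i ∈ Finset.Icc 1 K, (i : ℝ) * (pointCount x (g ⁻¹' {i})).toNat := by
  have h1 : ∑' n, (g (x n) : ℝ≥0∞) =
      ∑ i ∈ Finset.Icc 1 K, (i : ℝ≥0∞) * (pointCount x (g ⁻¹' {i}) : ℝ≥0∞) := by
    simp_rw [toENNReal_pointCount, ← ENNReal.tsum_mul_left]
    rw [← Summable.tsum_finsetSum fun i _ => ENNReal.summable]
    refine tsum_congr fun n => ?_
    classical
    simp only [Set.indicator_apply, Set.mem_preimage, Set.mem_singleton_iff, Pi.one_apply,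
      mul_ite, mul_one, mul_zero]
    rw [Finset.sum_ite_eq]
    split_ifs with h
    · rfl
    · have : g (x n) = 0 := by
        by_contra h0
        exact h (Finset.mem_Icc.2 ⟨Nat.one_le_iff_ne_zero.2 h0, hK _⟩)
      simp [this]
  have h2 : ∑' n, (g (x n) : ℝ) = (∑' n, (g (x n) : ℝ≥0∞)).toReal := by
    rw [ENNReal.tsum_toReal_eq fun n => ENNReal.natCast_ne_top _]
    simp
  rw [h2, h1, ENNReal.toReal_sum]
  · refine Finset.sum_congr rfl fun i hi => ?_
    obtain ⟨k, hk⟩ := ENat.ne_top_iff_exists.1 (hfin i hi)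
    rw [← hk]; simp
  · intro i hi
    obtain ⟨k, hk⟩ := ENat.ne_top_iff_exists.1 (hfin i hi)
    rw [← hk]
    exact ENNReal.mul_ne_top (ENNReal.natCast_ne_top _) (by simp)

/-- Laplace functional of a Poisson process at a bounded `ℕ`-valued function, times a constant. -/
lemma lintegral_exp_neg_tsum_natCast (hX : IsHomogeneousPoisson P X lam) (hlam : 0 < lam)
    {g : Plane → ℕ} (hg : Measurable g) {K : ℕ} (hK : ∀ x, g x ≤ K)
    (hvol : volume {x | g x ≠ 0} ≠ ∞) (c : ℝ) :
    ∫⁻ ω, ENNReal.ofReal (Real.exp (-∑' n, c * (g (X n ω) : ℝ))) ∂P =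
      ENNReal.ofReal (Real.exp (-(lam * ∫ x, (1 - Real.exp (-(c * g x)))))) := by
  have hmeas : ∀ i, MeasurableSet (g ⁻¹' {i}) := fun i => hg (measurableSet_singleton i)
  have hvoli : ∀ i ∈ Finset.Icc 1 K, volume (g ⁻¹' {i}) ≠ ∞ := by
    intro i hi
    refine measure_ne_top_of_subset (fun x hx => ?_) hvol
    rw [Set.mem_preimage, Set.mem_singleton_iff] at hx
    rw [Set.mem_ofPred_eq, hx]
    exact Nat.one_le_iff_ne_zero.1 (Finset.mem_Icc.1 hi).1
  have hdisj : Pairwise (Function.onFun Disjoint fun i => g ⁻¹' {i}) := fun i j hij =>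
    Disjoint.preimage _ (by simpa using hij)
  have hind := hX.count_indep (fun i => g ⁻¹' {i}) hmeas hdisj
  -- Almost surely the exponential factors over the level sets of `g`, and the factors are functions
  -- of independent Poisson counts.
  have hprod : ∀ᵐ ω ∂P, ENNReal.ofReal (Real.exp (-∑' n, c * (g (X n ω) : ℝ))) =
      ∏ i ∈ Finset.Icc 1 K, ENNReal.ofReal
        (Real.exp (-(c * i * (pointCount (fun n => X n ω) (g ⁻¹' {i})).toNat))) := by
    have hall : ∀ᵐ ω ∂P, ∀ i ∈ Finset.Icc 1 K, pointCount (fun n => X n ω) (g ⁻¹' {i}) ≠ ⊤ :=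
      (Finset.eventually_all _).2 fun i hi => hX.ae_count_ne_top hlam (hmeas i) (hvoli i hi)
    filter_upwards [hall] with ω hω
    rw [tsum_mul_left, tsum_natCast_eq_sum_pointCount hK hω,
      ← ENNReal.ofReal_prod_of_nonneg fun _ _ => (Real.exp_pos _).le, ← Real.exp_sum,
      Finset.mul_sum, ← Finset.sum_neg_distrib]
    simp_rw [mul_assoc]
  rw [lintegral_congr_ae hprod, lintegral_prod_eq_prod_lintegral_of_indepFun _
    (fun i ω => ENNReal.ofReal
        (Real.exp (-(c * i * (pointCount (fun n => X n ω) (g ⁻¹' {i})).toNat))))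
    (hind.comp (fun (i : ℕ) (k : ℕ∞) => ENNReal.ofReal (Real.exp (-(c * i * k.toNat))))
      fun _ => .of_discrete)
    (fun i => (Measurable.of_discrete (f := fun k : ℕ∞ =>
      ENNReal.ofReal (Real.exp (-(c * i * k.toNat))))).comp (hX.measurable_count (hmeas i)))]
  rw [Finset.prod_congr rfl fun i hi => hX.lintegral_exp_neg_count hlam (hmeas i) (hvoli i hi) _,
    ← ENNReal.ofReal_prod_of_nonneg fun _ _ => (Real.exp_pos _).le, ← Real.exp_sum,
    Finset.sum_neg_distrib]
  congr 3
  have hpt : ∀ x, 1 - Real.exp (-(c * g x)) = ∑ i ∈ Finset.Icc 1 K,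
      (g ⁻¹' {i}).indicator (fun _ => 1 - Real.exp (-(c * i))) x := by
    intro x
    classical
    simp only [Set.indicator_apply, Set.mem_preimage, Set.mem_singleton_iff]
    rw [Finset.sum_ite_eq]
    split_ifs with h
    · rfl
    · have : g x = 0 := by
        by_contra h0
        exact h (Finset.mem_Icc.2 ⟨Nat.one_le_iff_ne_zero.2 h0, hK _⟩)
      simp [this]
  simp_rw [hpt]
  rw [integral_finsetSum _ fun i hi =>
    (integrableOn_const (hvoli i hi)).integrable_indicator (hmeas i), Finset.mul_sum]
  refine Finset.sum_congr rfl fun i _ => ?_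
  rw [integral_indicator_const _ (hmeas i), smul_eq_mul, measureReal_def]
  ring

/-- Laplace functional of a Poisson process. -/
lemma integral_exp_neg_tsum (hX : IsHomogeneousPoisson P X lam) (hlam : 0 < lam)
    {f : Plane → ℝ} (hf : Measurable f) (hint : Integrable f) (hf0 : ∀ x, 0 ≤ f x)
    {M : ℝ} (hM : ∀ x, f x ≤ M) :
    ∫ ω, Real.exp (-∑' n, f (X n ω)) ∂P =
      Real.exp (-(lam * ∫ x, (1 - Real.exp (-f x)))) := by
  -- The functions `⌊(k + 1) f⌋ / (k + 1)` lie below `f` and converge to it. They take finitely many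
  -- values because `f` is bounded, and have support of finite area because `f` is integrable; `f`
  -- then dominates both the sums over points and the integrals.
  let g : ℕ → Plane → ℕ := fun k x => ⌊((k : ℝ) + 1) * f x⌋₊
  let c : ℕ → ℝ := fun k => 1 / ((k : ℝ) + 1)
  have hc : ∀ k, 0 < c k := fun k => by positivity
  have hg : ∀ k, Measurable (g k) := fun k => Nat.measurable_floor.comp (hf.const_mul _)
  have hle : ∀ k x, c k * g k x ≤ f x := by
    intro k x
    have : (g k x : ℝ) ≤ ((k : ℝ) + 1) * f x :=
      Nat.floor_le (mul_nonneg (by positivity) (hf0 x))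
    simp only [c]
    rw [one_div, inv_mul_le_iff₀ (by positivity)]
    exact this
  have hnn : ∀ k x, 0 ≤ c k * g k x := fun k x => mul_nonneg (hc k).le (Nat.cast_nonneg _)
  have hlim : ∀ x, Filter.Tendsto (fun k => c k * g k x) Filter.atTop (nhds (f x)) := by
    intro x
    have h1 : Filter.Tendsto (fun k : ℕ => (k : ℝ) + 1) Filter.atTop Filter.atTop :=
      Filter.tendsto_atTop_add_const_right _ _ tendsto_natCast_atTop_atTop
    refine ((tendsto_nat_floor_mul_div_atTop (hf0 x)).comp h1).congr fun k => ?_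
    simp only [Function.comp_apply, c, g, mul_comm (f x)]
    ring
  have hlap : ∀ k, ∫ ω, Real.exp (-∑' n, c k * (g k (X n ω) : ℝ)) ∂P =
      Real.exp (-(lam * ∫ x, (1 - Real.exp (-(c k * g k x))))) := by
    intro k
    have hvol : volume {x | g k x ≠ 0} ≠ ∞ := by
      refine measure_ne_top_of_subset (fun x hx => ?_)
        (hint.measure_ge_lt_top (hc k)).ne
      have h1 : (1 : ℝ) ≤ g k x := by exact_mod_cast Nat.one_le_iff_ne_zero.2 hx
      calc c k = c k * 1 := (mul_one _).symm
        _ ≤ c k * g k x := by gcongr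
        _ ≤ f x := hle k x
    have h1 := hX.lintegral_exp_neg_tsum_natCast hlam (hg k) (K := ⌊((k : ℝ) + 1) * M⌋₊)
      (fun x => Nat.floor_mono (by have := hM x; gcongr)) hvol (c k)
    rw [integral_eq_lintegral_of_nonneg_ae (Filter.Eventually.of_forall fun _ =>
      (Real.exp_pos _).le) ?_, h1, ENNReal.toReal_ofReal (Real.exp_pos _).le]
    refine Measurable.aestronglyMeasurable ?_
    refine Real.measurable_exp.comp (Measurable.neg ?_)
    exact Measurable.tsum fun n =>
      (measurable_from_nat.comp ((hg k).comp (hX.measurable n))).const_mul _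
  have hsummable := hX.ae_summable hlam hf hint hf0
  have hL : Filter.Tendsto (fun k => ∫ ω, Real.exp (-∑' n, c k * (g k (X n ω) : ℝ)) ∂P)
      Filter.atTop (nhds (∫ ω, Real.exp (-∑' n, f (X n ω)) ∂P)) := by
    refine tendsto_integral_of_dominated_convergence (fun _ => 1) (fun k => ?_)
      (integrable_const _) (fun k => Filter.Eventually.of_forall fun ω => ?_) ?_
    · refine (Real.measurable_exp.comp (Measurable.neg ?_)).aestronglyMeasurable
      exact Measurable.tsum fun n =>
        (measurable_from_nat.comp ((hg k).comp (hX.measurable n))).const_mul _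
    · rw [Real.norm_eq_abs, Real.abs_exp, Real.exp_le_one_iff, neg_nonpos]
      exact tsum_nonneg fun n => hnn k _
    · filter_upwards [hsummable] with ω hω
      refine (Real.continuous_exp.tendsto _).comp (Filter.Tendsto.neg ?_)
      refine tendsto_tsum_of_dominated_convergence hω (fun n => hlim _)
        (Filter.Eventually.of_forall fun k n => ?_)
      rw [Real.norm_of_nonneg (hnn k _)]
      exact hle k _
  have hR : Filter.Tendsto (fun k => Real.exp (-(lam * ∫ x, (1 - Real.exp (-(c k * g k x))))))
      Filter.atTop (nhds (Real.exp (-(lam * ∫ x, (1 - Real.exp (-f x)))))) := by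
    refine (Real.continuous_exp.tendsto _).comp (Filter.Tendsto.neg (Filter.Tendsto.const_mul _ ?_))
    refine tendsto_integral_of_dominated_convergence f (fun k => ?_) hint
      (fun k => Filter.Eventually.of_forall fun x => ?_) (Filter.Eventually.of_forall fun x => ?_)
    · refine Measurable.aestronglyMeasurable ?_
      exact measurable_const.sub (Real.measurable_exp.comp
        ((measurable_from_nat.comp (hg k)).const_mul _).neg)
    · have h1 : Real.exp (-(c k * g k x)) ≤ 1 := Real.exp_le_one_iff.2 (neg_nonpos.2 (hnn k x))
      have h2 := Real.add_one_le_exp (-(c k * g k x))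
      rw [Real.norm_of_nonneg (by linarith)]
      linarith [hle k x]
    · exact ((Real.continuous_exp.tendsto _).comp (hlim x).neg).const_sub 1
  simp_rw [hlap] at hL
  exact tendsto_nhds_unique hL hR

end IsHomogeneousPoisson

/-! ### The hypergeometric function as an Euler-type integral -/

lemma intervalIntegrable_rpow_mul {a : ℝ} (ha : -1 < a) {g : ℝ → ℝ}
    (hg : ContinuousOn g (Set.Icc 0 1)) :
    IntervalIntegrable (fun y : ℝ => y ^ a * g y) volume 0 1 :=
  (intervalIntegral.intervalIntegrable_rpow' ha).mul_continuousOn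
    (by rwa [Set.uIcc_of_le zero_le_one])

/-- Beta integrals with one integer parameter. -/
lemma integral_rpow_mul_one_sub_pow (j : ℕ) {a : ℝ} (ha : -1 < a) :
    ∫ y in (0 : ℝ)..1, y ^ a * (1 - y) ^ j =
      (j.factorial : ℝ) / (ascPochhammer ℝ (j + 1)).eval (a + 1) := by
  induction j generalizing a with
  | zero =>
    simp only [pow_zero, mul_one]
    rw [integral_rpow (Or.inl ha), Real.zero_rpow (by linarith)]
    simp
  | succ j ih =>
    have ha1 : 0 < a + 1 := by linarith
    have hint1 := intervalIntegrable_rpow_mul (a := a) ha (g := fun y => (1 - y) ^ (j + 1))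
      (by fun_prop)
    have hint2 := intervalIntegrable_rpow_mul (a := a + 1) (by linarith) (g := fun y => (1 - y) ^ j)
      (by fun_prop)
    -- The integrand is the derivative of `y ^ (a + 1) * (1 - y) ^ (j + 1)`, which vanishes at both
    -- ends; this lowers `j` at the price of raising `a`.
    have hparts : ∫ y in (0 : ℝ)..1, ((a + 1) * (y ^ a * (1 - y) ^ (j + 1)) -
        ((j : ℝ) + 1) * (y ^ (a + 1) * (1 - y) ^ j)) = 0 := by
      rw [intervalIntegral.integral_eq_sub_of_hasDerivAt_of_le (f := fun y => y ^ (a + 1) *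
        (1 - y) ^ (j + 1)) zero_le_one]
      · simp [Real.zero_rpow ha1.ne']
      · refine ContinuousOn.mul ?_ (by fun_prop)
        exact (Real.continuous_rpow_const ha1.le).continuousOn
      · intro y hy
        have h1 := Real.hasDerivAt_rpow_const (x := y) (p := a + 1) (Or.inl hy.1.ne')
        have h2 := ((hasDerivAt_id y).const_sub 1).fun_pow (j + 1)
        refine (h1.fun_mul h2).congr_deriv ?_
        simp only [id, add_sub_cancel_right, Nat.add_sub_cancel]
        push_cast
        ring
      · exact (hint1.const_mul _).sub (hint2.const_mul _)
    rw [intervalIntegral.integral_sub (hint1.const_mul _) (hint2.const_mul _),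
      intervalIntegral.integral_const_mul, intervalIntegral.integral_const_mul,
      ih (a := a + 1) (by linarith)] at hparts
    rw [ascPochhammer_succ_left, Polynomial.eval_mul, Polynomial.eval_X, Polynomial.eval_comp,
      Polynomial.eval_add, Polynomial.eval_X, Polynomial.eval_one]
    have hpos : 0 < (ascPochhammer ℝ (j + 1)).eval (a + 1 + 1) :=
      ascPochhammer_pos _ _ (by linarith)
    rw [eq_div_iff (by positivity), Nat.factorial_succ]
    push_cast
    field_simp at hparts
    linear_combination hparts

/-- Expansion of an Euler-type integral into a Gauss series. -/
lemma hasSum_integral_rpow_mul_inv_pow (m : ℕ) {δ w : ℝ} (hδ : δ < 1) (hw0 : 0 ≤ w) (hw1 : w < 1) :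
    HasSum (fun n : ℕ => ((n + m).choose m : ℝ) * w ^ n *
        ((n.factorial : ℝ) / (ascPochhammer ℝ (n + 1)).eval (1 - δ)))
      (∫ y in (0 : ℝ)..1, y ^ (-δ) * ((1 - w * (1 - y)) ^ (m + 1))⁻¹) := by
  have hgeom := hasSum_choose_mul_geometric_of_norm_lt_one m (r := w)
    (by rwa [Real.norm_of_nonneg hw0])
  -- The negative binomial series is integrated term by term. Replacing `1 - y` by `1` gives the
  -- majorant, which is summable since `w < 1`, and each term is a Beta integral.
  have key := intervalIntegral.hasSum_integral_of_dominated_convergence (μ := volume)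
    (a := 0) (b := 1)
    (F := fun (n : ℕ) (y : ℝ) => y ^ (-δ) * (((n + m).choose m : ℝ) * (w * (1 - y)) ^ n))
    (f := fun y => y ^ (-δ) * ((1 - w * (1 - y)) ^ (m + 1))⁻¹)
    (fun n y => y ^ (-δ) * (((n + m).choose m : ℝ) * w ^ n)) ?_ ?_ ?_ ?_ ?_
  · have hterm : ∀ n : ℕ, (∫ y in (0 : ℝ)..1,
        y ^ (-δ) * (((n + m).choose m : ℝ) * (w * (1 - y)) ^ n)) = ((n + m).choose m : ℝ) * w ^ n *
        ((n.factorial : ℝ) / (ascPochhammer ℝ (n + 1)).eval (1 - δ)) := by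
      intro n
      have h1 := integral_rpow_mul_one_sub_pow n (a := -δ) (by linarith)
      rw [show -δ + 1 = 1 - δ by ring] at h1
      rw [← h1, ← intervalIntegral.integral_const_mul]
      refine intervalIntegral.integral_congr fun y _ => ?_
      simp only [mul_pow]
      ring
    simpa only [hterm] using key
  · intro n
    refine Measurable.aestronglyMeasurable ?_
    fun_prop
  · intro n
    refine Filter.Eventually.of_forall fun y hy => ?_
    rw [Set.uIoc_of_le zero_le_one] at hy
    have h0 : 0 ≤ 1 - y := by linarith [hy.2]
    have h0' := hy.1.le
    rw [Real.norm_of_nonneg (by positivity)]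
    gcongr
    nlinarith [hy.1.le]
  · exact Filter.Eventually.of_forall fun y _ => hgeom.summable.mul_left _
  · simp_rw [tsum_mul_left]
    exact (intervalIntegral.intervalIntegrable_rpow' (by linarith)).mul_const _
  · refine Filter.Eventually.of_forall fun y hy => ?_
    rw [Set.uIoc_of_le zero_le_one] at hy
    have h0 : 0 ≤ 1 - y := by linarith [hy.2]
    have h1 : w * (1 - y) < 1 := by nlinarith [hy.1]
    have h2 := hasSum_choose_mul_geometric_of_norm_lt_one m (r := w * (1 - y))
      (by rwa [Real.norm_of_nonneg (by positivity)])
    rw [one_div] at h2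
    exact h2.mul_left (y ^ (-δ))

/-- In Pfaff's form the first parameter is `c - a = 1`, whose Pochhammer symbol cancels `n!`. With
`w = z / (1 + z)` the remaining series is the Euler integral, by the identity `1 + z y = (1 + z) (1
- w (1 - y))`. -/
lemma gaussHyp_eq {m : ℕ} {δ z : ℝ} (hδ : δ < 1) (hz : 0 ≤ z) :
    gaussHyp (-δ) m (1 - δ) (-z) = ((1 + z) ^ m)⁻¹ +
      m * z * ∫ y in (0 : ℝ)..1, y ^ (-δ) * ((1 + z * y) ^ (m + 1))⁻¹ := by
  have hz1 : 0 < 1 + z := by linarith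
  set w := z / (1 + z) with hw
  have hw0 : 0 ≤ w := by positivity
  have hw1 : w < 1 := by rw [hw, div_lt_one hz1]; linarith
  have hwz : -z / (-z - 1) = w := by
    rw [hw, ← neg_div_neg_eq]; congr 1 <;> ring
  have hJ := hasSum_integral_rpow_mul_inv_pow m hδ hw0 hw1
  set J := ∫ y in (0 : ℝ)..1, y ^ (-δ) * ((1 - w * (1 - y)) ^ (m + 1))⁻¹ with hJdef
  have hF : ordinaryHypergeometric (1 - δ - -δ) (m : ℝ) (1 - δ) w = 1 + m * w * J := by
    rw [ordinaryHypergeometric_eq_tsum]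
    refine HasSum.tsum_eq ?_
    rw [← hasSum_nat_add_iff' 1]
    have hsum := hJ.mul_left (m * w)
    simp only [Finset.range_one, Finset.sum_singleton, Nat.factorial_zero, Nat.cast_one, inv_one,
      ascPochhammer_zero, Polynomial.eval_one, pow_zero, smul_eq_mul, mul_one,
      add_sub_cancel_left]
    have hterm : ∀ n : ℕ, ((n + 1).factorial : ℝ)⁻¹ *
        (ascPochhammer ℝ (n + 1)).eval (1 - δ - -δ) * (ascPochhammer ℝ (n + 1)).eval (m : ℝ) *
        ((ascPochhammer ℝ (n + 1)).eval (1 - δ))⁻¹ * w ^ (n + 1) =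
        m * w * (((n + m).choose m : ℝ) * w ^ n *
          ((n.factorial : ℝ) / (ascPochhammer ℝ (n + 1)).eval (1 - δ))) := by
      intro n
      have h1 : m.ascFactorial (n + 1) = m * (n.factorial * (n + m).choose m) := by
        rw [Nat.ascFactorial_succ, ← Nat.succ_ascFactorial, Nat.succ_eq_add_one,
          Nat.ascFactorial_eq_factorial_mul_choose, add_comm m n, ← Nat.choose_symm_add]
      rw [sub_neg_eq_add, sub_add_cancel, ascPochhammer_eval_one,
        ascPochhammer_nat_eq_natCast_ascFactorial, h1]
      have h2 : ((n + 1).factorial : ℝ) ≠ 0 := by positivity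
      rw [inv_mul_cancel₀ h2]
      push_cast
      ring
    simp only [hterm]
    exact hsum
  have hI : ∫ y in (0 : ℝ)..1, y ^ (-δ) * ((1 + z * y) ^ (m + 1))⁻¹ = ((1 + z) ^ (m + 1))⁻¹ * J := by
    rw [hJdef, ← intervalIntegral.integral_const_mul]
    refine intervalIntegral.integral_congr fun y _ => ?_
    have : 1 + z * y = (1 + z) * (1 - w * (1 - y)) := by
      rw [hw]; field_simp; ring
    simp only [this, mul_pow, mul_inv]
    ring
  rw [gaussHyp, hwz, hF, hI, sub_neg_eq_add, Real.rpow_neg hz1.le, Real.rpow_natCast, hw]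
  field_simp
  ring

/-- Integration by parts for the hypergeometric integral. -/
lemma integral_rpow_mul_one_sub_inv_pow {m : ℕ} {δ z : ℝ} (hδ0 : 0 < δ) (hδ : δ < 1) (hz : 0 ≤ z) :
    ∫ y in (0 : ℝ)..1, δ * y ^ (-δ - 1) * (1 - ((1 + z * y) ^ m)⁻¹) =
      gaussHyp (-δ) m (1 - δ) (-z) - 1 := by
  have hpos : ∀ y ∈ Set.Icc (0 : ℝ) 1, 0 < 1 + z * y := by
    intro y hy
    have := mul_nonneg hz hy.1
    linarith
  -- Bernoulli's inequality: the bracket is of order `y`, which compensates one power of the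
  -- singularity `y ^ (-δ - 1)`. This yields both integrability and the vanishing of the boundary
  -- term at `0`.
  have hbern : ∀ y ∈ Set.Icc (0 : ℝ) 1, 1 - ((1 + z * y) ^ m)⁻¹ ≤ m * z * y := by
    intro y hy
    have h1 := hpos y hy
    have h2 : -2 ≤ -(z * y / (1 + z * y)) := by
      have : z * y / (1 + z * y) ≤ 1 := by rw [div_le_one h1]; linarith
      linarith
    have h3 := one_add_mul_le_pow h2 m
    have h4 : 1 + -(z * y / (1 + z * y)) = (1 + z * y)⁻¹ := by field_simp; ring
    rw [h4, inv_pow] at h3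
    have h5 : z * y / (1 + z * y) ≤ z * y := by
      rw [div_le_iff₀ h1]; nlinarith [mul_nonneg hz hy.1]
    have h6 : (m : ℝ) * (z * y / (1 + z * y)) ≤ m * (z * y) := by gcongr
    linarith
  have hnn : ∀ y ∈ Set.Icc (0 : ℝ) 1, 0 ≤ 1 - ((1 + z * y) ^ m)⁻¹ := by
    intro y hy
    have h1 : 1 ≤ 1 + z * y := by linarith [mul_nonneg hz hy.1]
    have := inv_le_one_of_one_le₀ (one_le_pow₀ h1 (n := m))
    linarith
  have hcont : ContinuousOn (fun y : ℝ => ((1 + z * y) ^ (m + 1))⁻¹) (Set.Icc 0 1) :=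
    ContinuousOn.inv₀ (by fun_prop) fun y hy => (pow_pos (hpos y hy) _).ne'
  have hcont' : ContinuousOn (fun y : ℝ => 1 - ((1 + z * y) ^ m)⁻¹) (Set.Icc 0 1) :=
    continuousOn_const.sub <|
      ContinuousOn.inv₀ (by fun_prop) fun y hy => (pow_pos (hpos y hy) _).ne'
  have hint2 : IntervalIntegrable
      (fun y : ℝ => m * z * (y ^ (-δ) * ((1 + z * y) ^ (m + 1))⁻¹)) volume 0 1 :=
    (intervalIntegrable_rpow_mul (by linarith) hcont).const_mul _
  have hint1 : IntervalIntegrable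
      (fun y : ℝ => δ * y ^ (-δ - 1) * (1 - ((1 + z * y) ^ m)⁻¹)) volume 0 1 := by
    have hb : IntervalIntegrable (fun y : ℝ => δ * (m * z) * y ^ (-δ)) volume 0 1 :=
      (intervalIntegral.intervalIntegrable_rpow' (by linarith)).const_mul _
    refine hb.mono_fun ?_ ?_
    · refine Measurable.aestronglyMeasurable ?_
      fun_prop
    · rw [Set.uIoc_of_le zero_le_one, Filter.EventuallyLE, ae_restrict_iff' measurableSet_Ioc]
      refine Filter.Eventually.of_forall fun y hy => ?_
      have hy' : y ∈ Set.Icc (0 : ℝ) 1 := ⟨hy.1.le, hy.2⟩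
      have h0 := hnn y hy'
      have hy0 := hy.1
      rw [Real.norm_of_nonneg (by positivity), Real.norm_of_nonneg (by positivity)]
      calc δ * y ^ (-δ - 1) * (1 - ((1 + z * y) ^ m)⁻¹)
          ≤ δ * y ^ (-δ - 1) * (m * z * y) := by
            gcongr
            exact hbern y hy'
        _ = δ * (m * z) * y ^ (-δ) := by
            rw [Real.rpow_sub_one hy0.ne']; field_simp
  have hparts : ∫ y in (0 : ℝ)..1, (δ * y ^ (-δ - 1) * (1 - ((1 + z * y) ^ m)⁻¹) -
      m * z * (y ^ (-δ) * ((1 + z * y) ^ (m + 1))⁻¹)) = -(1 - ((1 + z) ^ m)⁻¹) := by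
    rw [intervalIntegral.integral_eq_sub_of_hasDerivAt_of_le
      (f := fun y => -(y ^ (-δ) * (1 - ((1 + z * y) ^ m)⁻¹))) zero_le_one]
    · simp
    · intro y hy
      rcases hy.1.eq_or_lt with rfl | hy0
      -- Continuity of the antiderivative at `0`: it is squeezed by a multiple of `y ^ (1 - δ)`,
      -- which tends to `0` since `δ < 1`.
      · have hlim : Filter.Tendsto (fun y : ℝ => m * z * y ^ (1 - δ))
            (nhdsWithin 0 (Set.Icc 0 1)) (nhds 0) := by
          have h1 : ContinuousAt (fun y : ℝ => m * z * y ^ (1 - δ)) 0 :=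
            (Real.continuousAt_rpow_const 0 (1 - δ) (Or.inr (by linarith))).const_mul _
          have h2 : m * z * (0 : ℝ) ^ (1 - δ) = 0 := by
            simp [Real.zero_rpow (by linarith : 1 - δ ≠ 0)]
          have h3 := h1.tendsto
          rw [h2] at h3
          exact h3.mono_left nhdsWithin_le_nhds
        have h4 : Filter.Tendsto (fun y : ℝ => y ^ (-δ) * (1 - ((1 + z * y) ^ m)⁻¹))
            (nhdsWithin 0 (Set.Icc 0 1)) (nhds 0) := by
          refine squeeze_zero' ?_ ?_ hlim
          · filter_upwards [self_mem_nhdsWithin] with y hy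
            exact mul_nonneg (Real.rpow_nonneg hy.1 _) (hnn y hy)
          · filter_upwards [self_mem_nhdsWithin] with y hy
            rcases hy.1.eq_or_lt with rfl | hy0
            · simp [Real.zero_rpow (by linarith : 1 - δ ≠ 0)]
            · calc y ^ (-δ) * (1 - ((1 + z * y) ^ m)⁻¹) ≤ y ^ (-δ) * (m * z * y) := by
                    gcongr
                    exact hbern y hy
                _ = m * z * y ^ (1 - δ) := by
                    rw [sub_eq_neg_add, Real.rpow_add_one hy0.ne']; ring
        have h5 := h4.neg
        rw [ContinuousWithinAt]
        simpa using h5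
      · refine ContinuousWithinAt.neg (ContinuousWithinAt.mul ?_ (hcont' y hy))
        exact (Real.continuousAt_rpow_const y (-δ) (Or.inl hy0.ne')).continuousWithinAt
    · intro y hy
      have hy1 := (hpos y ⟨hy.1.le, hy.2.le⟩).ne'
      have h1 := Real.hasDerivAt_rpow_const (x := y) (p := -δ) (Or.inl hy.1.ne')
      have h2 : HasDerivAt (fun y : ℝ => 1 + z * y) z y := by
        simpa using ((hasDerivAt_id y).const_mul z).const_add 1
      have h3 := ((h2.fun_pow m).fun_inv (pow_ne_zero _ hy1)).const_sub 1
      refine (h1.fun_mul h3).fun_neg.congr_deriv ?_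
      rcases Nat.eq_zero_or_pos m with rfl | hm
      · simp
      obtain ⟨k, rfl⟩ := Nat.exists_eq_succ_of_ne_zero hm.ne'
      simp only [Nat.succ_eq_add_one, Nat.add_sub_cancel]
      field_simp
      ring
    · exact hint1.sub hint2
  rw [intervalIntegral.integral_sub hint1 hint2, intervalIntegral.integral_const_mul] at hparts
  rw [gaussHyp_eq hδ hz]
  linarith

/-! ### Radial integrals over the plane -/

lemma volume_real_unitBall_plane : (volume : Measure Plane).real (Metric.ball 0 1) = Real.pi := by
  rw [measureReal_def, EuclideanSpace.volume_ball_fin_two]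
  simp [Real.pi_pos.le]

/-- Polar coordinates for radial functions on the plane. -/
lemma integral_plane_dist (F : ℝ → ℝ) (c : Plane) :
    ∫ x : Plane, F (dist x c) = 2 * Real.pi * ∫ y in Set.Ioi (0 : ℝ), y * F y := by
  simp_rw [dist_eq_norm]
  rw [integral_sub_right_eq_self (fun x : Plane => F ‖x‖) c, integral_fun_norm_addHaar]
  rw [volume_real_unitBall_plane, finrank_euclideanSpace_fin]
  simp [mul_assoc]

lemma integrable_plane_dist_iff (F : ℝ → ℝ) (c : Plane) :
    Integrable (fun x : Plane => F (dist x c)) ↔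
      IntegrableOn (fun y : ℝ => y * F y) (Set.Ioi 0) := by
  simp_rw [dist_eq_norm]
  have h1 := integrable_fun_norm_addHaar (volume : Measure Plane) (f := F)
  rw [finrank_euclideanSpace_fin] at h1
  simp only [Nat.add_one_sub_one, pow_one, smul_eq_mul] at h1
  rw [← h1]
  exact ⟨fun h => by simpa using h.comp_add_right c, fun h => h.comp_sub_right c⟩

lemma measurable_ite_lt_dist {g : ℝ → ℝ} (hg : Measurable g) (r : ℝ) (c : Plane) :
    Measurable fun x : Plane => if r < dist x c then g (dist x c) else 0 :=
  Measurable.ite (measurableSet_lt measurable_const (by fun_prop))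
    (hg.comp (by fun_prop)) measurable_const

lemma mul_ite_eq_indicator_Ioi (r : ℝ) (g : ℝ → ℝ) :
    (fun y : ℝ => y * if r < y then g y else 0) = (Set.Ioi r).indicator fun y => y * g y := by
  ext y
  by_cases h : r < y <;> simp [h]

/-- In polar coordinates the exponent becomes `1 - α`, which is below `-1` exactly when `α > 2`. -/
lemma integrable_ite_dist_rpow {r α : ℝ} (hr : 0 < r) (hα : 2 < α) (c : Plane) :
    Integrable fun x : Plane => if r < dist x c then dist x c ^ (-α) else 0 := by
  rw [integrable_plane_dist_iff (fun y => if r < y then y ^ (-α) else 0) c,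
    mul_ite_eq_indicator_Ioi r fun y => y ^ (-α)]
  refine ((integrable_indicator_iff measurableSet_Ioi).2 ?_).integrableOn
  refine (integrableOn_Ioi_rpow_of_lt (a := -α + 1) (by linarith) hr).congr_fun ?_ measurableSet_Ioi
  intro y (hy : r < y)
  dsimp only
  rw [Real.rpow_add_one (hr.trans hy).ne', mul_comm]

lemma integral_ite_dist_rpow {r α : ℝ} (hr : 0 < r) (hα : 2 < α) (c : Plane) :
    ∫ x : Plane, (if r < dist x c then dist x c ^ (-α) else 0) =
      2 * Real.pi * (r ^ (2 - α) / (α - 2)) := by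
  rw [integral_plane_dist (fun y => if r < y then y ^ (-α) else 0) c,
    mul_ite_eq_indicator_Ioi r fun y => y ^ (-α), setIntegral_indicator measurableSet_Ioi]
  have h1 : Set.Ioi (0 : ℝ) ∩ Set.Ioi r = Set.Ioi r :=
    Set.inter_eq_right.2 (Set.Ioi_subset_Ioi hr.le)
  have h2 : ∫ y in Set.Ioi r, y * y ^ (-α) = ∫ y in Set.Ioi r, y ^ (-α + 1) := by
    refine setIntegral_congr_fun measurableSet_Ioi fun y (hy : r < y) => ?_
    rw [Real.rpow_add_one (hr.trans hy).ne', mul_comm]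
  rw [h1, h2, integral_Ioi_rpow_of_lt (by linarith) hr]
  have h3 : -α + 1 + 1 = -(α - 2) := by ring
  rw [h3, neg_div_neg_eq]
  congr 3
  ring

lemma lintegral_ite_dist_rpow {r α : ℝ} (hr : 0 < r) (hα : 2 < α) (c : Plane) {k : ℝ} (hk : 0 ≤ k) :
    ∫⁻ x : Plane, ENNReal.ofReal (if r < dist x c then k * dist x c ^ (-α) else 0) =
      ENNReal.ofReal (k * (2 * Real.pi * (r ^ (2 - α) / (α - 2)))) := by
  have h1 : ∀ x : Plane, (if r < dist x c then k * dist x c ^ (-α) else 0) =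
      k * if r < dist x c then dist x c ^ (-α) else 0 := by
    intro x; split_ifs <;> simp
  rw [← integral_ite_dist_rpow hr hα c, ← integral_const_mul, ofReal_integral_eq_lintegral_ofReal
    ((integrable_ite_dist_rpow hr hα c).const_mul k)]
  · simp_rw [← h1]
  · refine Filter.Eventually.of_forall fun x => ?_
    dsimp only [Pi.zero_apply]
    rw [← h1]
    split_ifs <;> positivity

/-- The exponent of the Laplace transform of the interference from outside a disc, for
Nakagami fading. -/
lemma integral_ite_one_sub_inv_pow {r α z : ℝ} (hr : 0 < r) (hα : 2 < α) (hz : 0 ≤ z) (m : ℕ)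
    (c : Plane) :
    ∫ x : Plane, (if r < dist x c then 1 - ((1 + z * (dist x c / r) ^ (-α)) ^ m)⁻¹ else 0) =
      Real.pi * r ^ 2 * (gaussHyp (-(2 / α)) m (1 - 2 / α) (-z) - 1) := by
  have hα0 : 0 < α := by linarith
  have hδ0 : 0 < 2 / α := by positivity
  have hδ1 : 2 / α < 1 := by rw [div_lt_one hα0]; exact hα
  rw [integral_plane_dist (fun y => if r < y then 1 - ((1 + z * (y / r) ^ (-α)) ^ m)⁻¹ else 0) c]
  set G : ℝ → ℝ := fun u => u * if 1 < u then 1 - ((1 + z * u ^ (-α)) ^ m)⁻¹ else 0 with hG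
  have h1 : ∫ y in Set.Ioi (0 : ℝ),
      y * (if r < y then 1 - ((1 + z * (y / r) ^ (-α)) ^ m)⁻¹ else 0) =
      r ^ 2 * ∫ u in Set.Ioi (0 : ℝ), G u := by
    have hsub := integral_comp_mul_left_Ioi
      (fun y => y * (if r < y then 1 - ((1 + z * (y / r) ^ (-α)) ^ m)⁻¹ else 0)) 0 hr
    rw [mul_zero, smul_eq_mul] at hsub
    have hpt : ∀ u : ℝ, r * u * (if r < r * u then 1 - ((1 + z * (r * u / r) ^ (-α)) ^ m)⁻¹ else 0) =
        r * G u := by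
      intro u
      have e1 : r < r * u ↔ 1 < u := by
        constructor <;> intro h <;> nlinarith
      simp only [hG, e1, mul_div_cancel_left₀ _ hr.ne']
      ring
    simp only [hpt] at hsub
    rw [integral_const_mul, eq_inv_mul_iff_mul_eq₀ hr.ne'] at hsub
    rw [← hsub]
    ring
  -- The substitution `u = x ^ (-1 / α)` maps `(0, 1)` onto `(1, ∞)` and turns `u ^ (-α)` into `x`;
  -- the result is half the integral computed by parts with `δ = 2 / α`.
  have h2 : ∫ u in Set.Ioi (0 : ℝ), G u =
      (1 / 2) * (gaussHyp (-(2 / α)) m (1 - 2 / α) (-z) - 1) := by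
    have hp : -(1 / α) ≠ 0 := by
      rw [neg_ne_zero]; positivity
    rw [← integral_rpow_mul_one_sub_inv_pow hδ0 hδ1 hz, ← integral_comp_rpow_Ioi G hp,
      intervalIntegral.integral_of_le zero_le_one, ← integral_const_mul,
      ← integral_indicator measurableSet_Ioc, ← integral_indicator measurableSet_Ioi]
    -- The condition `1 < u` is strict, whereas the interval integral includes `x = 1`.
    have h1' : ∀ᵐ x : ℝ, x ≠ 1 := by simp [ae_iff]
    refine integral_congr_ae ?_
    filter_upwards [h1'] with x hx1
    by_cases hx0 : 0 < x
    · rw [Set.indicator_of_mem (show x ∈ Set.Ioi (0 : ℝ) from hx0), smul_eq_mul, hG]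
      have habs : |-(1 / α)| = 1 / α := by rw [abs_neg, abs_of_pos (by positivity)]
      have hiff : 1 < x ^ (-(1 / α)) ↔ x < 1 := by
        rw [Real.one_lt_rpow_iff_of_pos hx0]
        have : -(1 / α) < 0 := by rw [neg_lt_zero]; positivity
        constructor
        · rintro (h | h)
          · linarith [h.2]
          · exact h.1
        · intro h
          exact Or.inr ⟨h, this⟩
      rcases lt_or_gt_of_ne hx1 with hlt | hgt
      · rw [Set.indicator_of_mem (show x ∈ Set.Ioc (0 : ℝ) 1 from ⟨hx0, hlt.le⟩)]
        dsimp only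
        rw [if_pos (hiff.2 hlt), habs, ← Real.rpow_mul hx0.le]
        have e1 : -(1 / α) * -α = 1 := by field_simp
        have e2 : x ^ (-(1 / α) - 1) * x ^ (-(1 / α)) = x ^ (-(2 / α) - 1) := by
          rw [← Real.rpow_add hx0]; congr 1; ring
        rw [e1, Real.rpow_one, ← e2]
        ring
      · rw [Set.indicator_of_notMem (show x ∉ Set.Ioc (0 : ℝ) 1 from fun h => hgt.not_ge h.2)]
        dsimp only
        rw [if_neg (fun h => hgt.not_gt (hiff.1 h))]
        simp
    · rw [Set.indicator_of_notMem (show x ∉ Set.Ioi (0 : ℝ) from hx0),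
        Set.indicator_of_notMem (show x ∉ Set.Ioc (0 : ℝ) 1 from fun h => hx0 h.1)]
  rw [h1, h2]
  ring

/-- The sum of cosines is `2 cos (θ / 2) cos ((2 ρ_a - 1) θ / 2)`, and both angles stay within `(-π
/ 2, π / 2)` because `0 < ρ_a < 1`. -/
lemma Network.coeffRISMean_pos (N : Network) : 0 < N.coeffRISMean := by
  have hL := N.L_pos
  have hπ := Real.pi_pos
  have hpos : ∀ θ ∈ Set.Ioo 0 Real.pi, 0 < N.coeffRIS θ := by
    intro θ hθ
    have h1 : 0 < Real.cos (θ / 2) :=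
      Real.cos_pos_of_mem_Ioo ⟨by linarith [hθ.1], by linarith [hθ.2]⟩
    have h2 : 0 < Real.cos ((2 * N.rhoA - 1) * θ / 2) := by
      apply Real.cos_pos_of_mem_Ioo
      constructor <;> nlinarith [hθ.1, hθ.2, N.rhoA_pos, N.rhoA_lt_one, mul_pos hθ.1 N.rhoA_pos,
        mul_pos hθ.1 (sub_pos.2 N.rhoA_lt_one)]
    have h3 : Real.cos (N.rhoA * θ) + Real.cos ((1 - N.rhoA) * θ) =
        2 * Real.cos (θ / 2) * Real.cos ((2 * N.rhoA - 1) * θ / 2) := by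
      rw [Real.cos_add_cos]
      congr 3 <;> ring
    rw [coeffRIS, h3]
    positivity
  have hint : 0 < ∫ θ in (0 : ℝ)..Real.pi, N.coeffRIS θ ^ 2 := by
    refine intervalIntegral.intervalIntegral_pos_of_pos_on ?_
      (fun θ hθ => pow_pos (hpos θ hθ) 2) hπ
    refine Continuous.intervalIntegrable ?_ _ _
    unfold coeffRIS
    fun_prop
  rw [coeffRISMean]
  positivity

/-! ### Sums over points with independent fading marks -/

lemma tsum_eq_toReal_tsum_ofReal {f : ℕ → ℝ} (hf : ∀ n, 0 ≤ f n) :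
    ∑' n, f n = (∑' n, ENNReal.ofReal (f n)).toReal := by
  rw [ENNReal.tsum_toReal_eq fun n => ENNReal.ofReal_ne_top]
  exact tsum_congr fun n => (ENNReal.toReal_ofReal (hf n)).symm

lemma ofReal_tsum_of_ne_top {f : ℕ → ℝ} (hf : ∀ n, 0 ≤ f n)
    (hfin : ∑' n, ENNReal.ofReal (f n) ≠ ∞) :
    ENNReal.ofReal (∑' n, f n) = ∑' n, ENNReal.ofReal (f n) := by
  rw [tsum_eq_toReal_tsum_ofReal hf, ENNReal.ofReal_toReal hfin]

/-- A divergent real series has the value `0`, so the inequality holds without any summability;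
upper bounds on the interference rely on this. -/
lemma ofReal_tsum_le {f : ℕ → ℝ} (hf : ∀ n, 0 ≤ f n) :
    ENNReal.ofReal (∑' n, f n) ≤ ∑' n, ENNReal.ofReal (f n) := by
  rw [tsum_eq_toReal_tsum_ofReal hf]
  exact ENNReal.ofReal_toReal_le

/-- Integration of independent random variables one after the other. -/
lemma lintegral_of_indepFun {Ω α β : Type*} [MeasurableSpace Ω] [MeasurableSpace α]
    [MeasurableSpace β] {P : Measure Ω} [IsProbabilityMeasure P] {X : Ω → α} {Y : Ω → β}
    (hX : Measurable X) (hY : Measurable Y) (h : IndepFun X Y P) {F : α × β → ℝ≥0∞}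
    (hF : Measurable F) :
    ∫⁻ ω, F (X ω, Y ω) ∂P = ∫⁻ ω, ∫⁻ ω', F (X ω, Y ω') ∂P ∂P := by
  have := Measure.isProbabilityMeasure_map (μ := P) hX.aemeasurable
  have := Measure.isProbabilityMeasure_map (μ := P) hY.aemeasurable
  rw [indepFun_iff_map_prod_eq_prod_map_map hX.aemeasurable hY.aemeasurable] at h
  rw [← lintegral_map (μ := P) (g := fun ω => (X ω, Y ω)) hF (hX.prodMk hY), h,
    lintegral_prod _ hF.aemeasurable, lintegral_map hF.lintegral_prod_right' hX]
  refine lintegral_congr fun ω => ?_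
  exact lintegral_map (hF.comp measurable_prodMk_left) hY

section Marks

variable {Ω : Type*} [MeasurableSpace Ω] {P : Measure Ω} {g : ℕ → Ω → ℝ} {m : ℕ}

/-- Laplace transform of a finite part of the interference, given the locations. -/
lemma lintegral_exp_neg_sum_mul (hm : 0 < m) (hg : ∀ n, Measurable (g n))
    (hlaw : ∀ n, P.map (g n) = nakagamiPower m) (hindep : iIndepFun g P) {a : ℕ → ℝ}
    (ha : ∀ n, 0 ≤ a n) (k : ℕ) :
    ∫⁻ ω, ENNReal.ofReal (Real.exp (-∑ n ∈ Finset.range k, g n ω * a n)) ∂P =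
      ENNReal.ofReal (∏ n ∈ Finset.range k, ((1 + a n / m) ^ m)⁻¹) := by
  have h1 : ∀ ω, ENNReal.ofReal (Real.exp (-∑ n ∈ Finset.range k, g n ω * a n)) =
      ∏ n ∈ Finset.range k, ENNReal.ofReal (Real.exp (-(a n * g n ω))) := by
    intro ω
    rw [← ENNReal.ofReal_prod_of_nonneg fun _ _ => (Real.exp_pos _).le, ← Real.exp_sum,
      Finset.sum_neg_distrib]
    simp_rw [mul_comm]
  simp_rw [h1]
  rw [lintegral_prod_eq_prod_lintegral_of_indepFun _
    (fun n ω => ENNReal.ofReal (Real.exp (-(a n * g n ω))))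
    (hindep.comp (fun n x => ENNReal.ofReal (Real.exp (-(a n * x)))) fun n => by fun_prop)
    (fun n => by have := hg n; fun_prop), ENNReal.ofReal_prod_of_nonneg fun n _ => by
      have := ha n; positivity]
  refine Finset.prod_congr rfl fun n _ => ?_
  rw [← lintegral_exp_neg_nakagamiPower hm (ha n), ← hlaw n, lintegral_map (by fun_prop) (hg n)]

/-- Independent fading powers of unit mean do not change the mean of a sum. -/
lemma lintegral_tsum_ofReal_mul {β : Type*} [MeasurableSpace β] {Y : Ω → β} (hY : Measurable Y)
    (hm : 0 < m) (hg : ∀ n, Measurable (g n)) (hlaw : ∀ n, P.map (g n) = nakagamiPower m)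
    (hind : IndepFun Y (fun ω n => g n ω) P) {φ : ℕ → β → ℝ≥0∞} (hφ : ∀ n, Measurable (φ n)) :
    ∫⁻ ω, ∑' n, ENNReal.ofReal (g n ω) * φ n (Y ω) ∂P = ∫⁻ ω, ∑' n, φ n (Y ω) ∂P := by
  rw [lintegral_tsum (f := fun n ω => ENNReal.ofReal (g n ω) * φ n (Y ω))
      fun n => ((hg n).ennreal_ofReal.mul ((hφ n).comp hY)).aemeasurable,
    lintegral_tsum (f := fun n ω => φ n (Y ω)) fun n => ((hφ n).comp hY).aemeasurable]
  refine tsum_congr fun n => ?_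
  have hind' : IndepFun (fun ω => ENNReal.ofReal (g n ω)) (fun ω => φ n (Y ω)) P :=
    (hind.comp (φ := φ n) (ψ := fun g : ℕ → ℝ => ENNReal.ofReal (g n)) (hφ n)
      (measurable_pi_apply n).ennreal_ofReal).symm
  rw [lintegral_mul_eq_lintegral_mul_lintegral_of_indepFun'' (g := fun ω => φ n (Y ω))
    (hg n).ennreal_ofReal.aemeasurable
    ((hφ n).comp hY).aemeasurable hind', lintegral_ofReal_of_map_eq_nakagamiPower hm (hg n) (hlaw n),
    one_mul]

variable {X : ℕ → Ω → Plane} {lam : ℝ} [IsProbabilityMeasure P]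

lemma lintegral_tsum_ofReal_mul_poisson (hX : IsHomogeneousPoisson P X lam) (hlam : 0 < lam)
    (hm : 0 < m) (hg : ∀ n, Measurable (g n)) (hlaw : ∀ n, P.map (g n) = nakagamiPower m)
    (hXg : IndepFun (fun ω n => X n ω) (fun ω n => g n ω) P) {w : Plane → ℝ} (hw : Measurable w)
    (hw0 : ∀ x, 0 ≤ w x) :
    ∫⁻ ω, ∑' n, ENNReal.ofReal (g n ω * w (X n ω)) ∂P =
      ENNReal.ofReal lam * ∫⁻ x, ENNReal.ofReal (w x) := by
  rw [← hX.lintegral_sum_points hlam hw.ennreal_ofReal]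
  have := lintegral_tsum_ofReal_mul (P := P) (Y := fun ω n => X n ω)
    (measurable_pi_iff.2 hX.measurable) hm hg hlaw hXg
    (φ := fun n x => ENNReal.ofReal (w (x n))) (fun n => (hw.comp (measurable_pi_apply n)).ennreal_ofReal)
  rw [← this]
  refine lintegral_congr fun ω => tsum_congr fun n => ?_
  rw [ENNReal.ofReal_mul' (hw0 _)]

lemma ae_summable_mul_poisson (hX : IsHomogeneousPoisson P X lam) (hlam : 0 < lam)
    (hm : 0 < m) (hg : ∀ n, Measurable (g n)) (hlaw : ∀ n, P.map (g n) = nakagamiPower m)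
    (hXg : IndepFun (fun ω n => X n ω) (fun ω n => g n ω) P) {w : Plane → ℝ} (hw : Measurable w)
    (hw0 : ∀ x, 0 ≤ w x) (hint : Integrable w) :
    ∀ᵐ ω ∂P, Summable fun n => g n ω * w (X n ω) := by
  have h1 := lintegral_tsum_ofReal_mul_poisson hX hlam hm hg hlaw hXg hw hw0
  have h2 : ∫⁻ ω, ∑' n, ENNReal.ofReal (g n ω * w (X n ω)) ∂P ≠ ∞ := by
    rw [h1]
    exact ENNReal.mul_ne_top ENNReal.ofReal_ne_top hint.lintegral_lt_top.ne
  have hg0 : ∀ᵐ ω ∂P, ∀ n, 0 ≤ g n ω :=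
    ae_all_iff.2 fun n => ae_nonneg_of_map_eq_nakagamiPower (hg n) (hlaw n)
  have hmeas : Measurable fun ω => ∑' n, ENNReal.ofReal (g n ω * w (X n ω)) :=
    Measurable.tsum fun n => ((hg n).fun_mul (hw.comp (hX.measurable n))).ennreal_ofReal
  filter_upwards [ae_lt_top hmeas h2, hg0] with ω hω hgω
  refine (ENNReal.summable_toReal hω.ne).congr fun n => ?_
  rw [ENNReal.toReal_ofReal (mul_nonneg (hgω n) (hw0 _))]

/-- Laplace transform of the interference. -/
lemma integral_exp_neg_tsum_mul (hX : IsHomogeneousPoisson P X lam) (hlam : 0 < lam)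
    (hm : 0 < m) (hg : ∀ n, Measurable (g n)) (hlaw : ∀ n, P.map (g n) = nakagamiPower m)
    (hindep : iIndepFun g P)
    (hXg : IndepFun (fun ω n => X n ω) (fun ω n => g n ω) P) {w : Plane → ℝ} (hw : Measurable w)
    (hw0 : ∀ x, 0 ≤ w x) (hint : Integrable w) {M : ℝ} (hM : ∀ x, w x ≤ M) :
    ∫ ω, Real.exp (-∑' n, g n ω * w (X n ω)) ∂P =
      Real.exp (-(lam * ∫ x, (1 - ((1 + w x / m) ^ m)⁻¹))) := by
  have hm' : (0 : ℝ) < m := by exact_mod_cast hm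
  -- Chosen so that `exp (-f)` is the Laplace transform of one fading power. Averaging over the
  -- marks for given locations then leaves the Laplace functional of the unmarked process at `f`.
  set f : Plane → ℝ := fun x => m * Real.log (1 + w x / m) with hf
  have hpos : ∀ x, 1 ≤ 1 + w x / m := fun x => by
    have := hw0 x
    have : 0 ≤ w x / m := by positivity
    linarith
  have hf0 : ∀ x, 0 ≤ f x := fun x => mul_nonneg hm'.le (Real.log_nonneg (hpos x))
  have hfw : ∀ x, f x ≤ w x := by
    intro x
    have h1 := Real.log_le_sub_one_of_pos (lt_of_lt_of_le one_pos (hpos x))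
    calc f x ≤ m * (1 + w x / m - 1) := by simp only [hf]; gcongr
      _ = w x := by field_simp; ring
  have hfm : Measurable f := by fun_prop
  have hexp : ∀ x, Real.exp (-f x) = ((1 + w x / m) ^ m)⁻¹ := by
    intro x
    rw [Real.exp_neg, hf, Real.exp_nat_mul, Real.exp_log (lt_of_lt_of_le one_pos (hpos x))]
  have hfint : Integrable f := hint.mono' hfm.aestronglyMeasurable
    (Filter.Eventually.of_forall fun x => by rw [Real.norm_of_nonneg (hf0 x)]; exact hfw x)
  have hlap := hX.integral_exp_neg_tsum hlam hfm hfint hf0 fun x => (hfw x).trans (hM x)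
  simp_rw [hexp] at hlap
  rw [← hlap]
  have hg0 : ∀ᵐ ω ∂P, ∀ n, 0 ≤ g n ω :=
    ae_all_iff.2 fun n => ae_nonneg_of_map_eq_nakagamiPower (hg n) (hlaw n)
  have hXm := hX.measurable
  -- The average over the marks is exact for partial sums; both full sums are reached by dominated
  -- convergence with bound `1`.
  have hlim : ∀ {a : ℕ → Ω → ℝ}, (∀ n, Measurable (a n)) → (∀ᵐ ω ∂P, ∀ n, 0 ≤ a n ω) →
      (∀ᵐ ω ∂P, Summable fun n => a n ω) →
      Filter.Tendsto (fun k => ∫ ω, Real.exp (-∑ n ∈ Finset.range k, a n ω) ∂P) Filter.atTop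
        (nhds (∫ ω, Real.exp (-∑' n, a n ω) ∂P)) := by
    intro a ha ha0 has
    refine tendsto_integral_of_dominated_convergence (fun _ => 1) (fun k => ?_)
      (integrable_const _) (fun k => ?_) ?_
    · exact (Real.measurable_exp.comp
        (Finset.measurable_fun_sum _ fun n _ => ha n).neg).aestronglyMeasurable
    · filter_upwards [ha0] with ω hω
      rw [Real.norm_eq_abs, Real.abs_exp, Real.exp_le_one_iff, neg_nonpos]
      exact Finset.sum_nonneg fun n _ => hω n
    · filter_upwards [has] with ω hω
      exact (Real.continuous_exp.tendsto _).comp hω.hasSum.tendsto_sum_nat.neg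
  have hL := hlim (a := fun n ω => g n ω * w (X n ω))
    (fun n => (hg n).mul (hw.comp (hXm n)))
    (by filter_upwards [hg0] with ω hω n using mul_nonneg (hω n) (hw0 _))
    (ae_summable_mul_poisson hX hlam hm hg hlaw hXg hw hw0 hint)
  have hR := hlim (a := fun n ω => f (X n ω)) (fun n => hfm.comp (hXm n))
    (Filter.Eventually.of_forall fun ω n => hf0 _) (hX.ae_summable hlam hfm hfint hf0)
  refine tendsto_nhds_unique hL (hR.congr fun k => ?_)
  have hsm : Measurable fun ω => Real.exp (-∑ n ∈ Finset.range k, g n ω * w (X n ω)) :=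
    Real.measurable_exp.comp
      (Finset.measurable_fun_sum _ fun n _ => (hg n).mul (hw.comp (hXm n))).neg
  have hsm' : Measurable fun ω => Real.exp (-∑ n ∈ Finset.range k, f (X n ω)) :=
    Real.measurable_exp.comp (Finset.measurable_fun_sum _ fun n _ => hfm.comp (hXm n)).neg
  rw [integral_eq_lintegral_of_nonneg_ae (Filter.Eventually.of_forall fun _ => (Real.exp_pos _).le)
    hsm'.aestronglyMeasurable,
    integral_eq_lintegral_of_nonneg_ae (Filter.Eventually.of_forall fun _ => (Real.exp_pos _).le)
    hsm.aestronglyMeasurable]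
  congr 1
  have hF : Measurable fun p : (ℕ → Plane) × (ℕ → ℝ) =>
      ENNReal.ofReal (Real.exp (-∑ n ∈ Finset.range k, p.2 n * w (p.1 n))) := by
    refine (Real.measurable_exp.comp (Measurable.neg ?_)).ennreal_ofReal
    refine Finset.measurable_fun_sum _ fun n _ => ?_
    exact ((measurable_pi_apply n).comp measurable_snd).mul
      (hw.comp ((measurable_pi_apply n).comp measurable_fst))
  have hjoint := lintegral_of_indepFun (measurable_pi_iff.2 hXm) (measurable_pi_iff.2 hg) hXg hF
  refine Eq.trans (lintegral_congr fun ω => ?_) hjoint.symm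
  rw [lintegral_exp_neg_sum_mul hm hg hlaw hindep (fun n => hw0 (X n ω)) k]
  congr 1
  rw [← Finset.sum_neg_distrib, Real.exp_sum]
  exact Finset.prod_congr rfl fun n _ => hexp _

end Marks

/-! ### Interference at the connected user and the closed form -/

namespace Network

variable (N : Network)

lemma rc_pos : 0 < N.rc := dist_pos.2 N.xB_ne_xc

lemma alphaC_pos : 0 < N.alphaC := by linarith [N.two_lt_alphaC]

lemma gammaTh_pos : 0 < N.gammaTh := by
  have : (1 : ℝ) < 2 ^ (N.Rc / N.Bw) :=
    Real.one_lt_rpow (by norm_num) (div_pos N.Rc_pos N.Bw_pos)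
  rw [gammaTh]; linarith

lemma thetaC_pos (hth : N.aT * N.gammaTh < N.ac) : 0 < N.thetaC :=
  div_pos N.gammaTh_pos (by linarith)

/-- Mean received power at the connected user from a base station at `x`, if it interferes. -/
noncomputable def interfererPower (x : Plane) : ℝ :=
  if N.rc < dist x N.xc then N.Pb * N.C * dist x N.xc ^ (-N.alphaC) else 0

lemma interfererPower_nonneg (x : Plane) : 0 ≤ N.interfererPower x := by
  have := N.Pb_pos
  have := N.C_pos
  unfold interfererPower
  split_ifs <;> positivity

lemma measurable_interfererPower : Measurable N.interfererPower :=
  measurable_ite_lt_dist (g := fun y => N.Pb * N.C * y ^ (-N.alphaC)) (by fun_prop) _ _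

lemma integrable_interfererPower : Integrable N.interfererPower := by
  refine ((integrable_ite_dist_rpow N.rc_pos N.two_lt_alphaC N.xc).const_mul (N.Pb * N.C)).congr
    (Filter.Eventually.of_forall fun x => ?_)
  dsimp only [interfererPower]
  split_ifs <;> simp

lemma interfererPower_le (x : Plane) :
    N.interfererPower x ≤ N.Pb * N.C * N.rc ^ (-N.alphaC) := by
  have := N.Pb_pos
  have := N.C_pos
  have hrc := N.rc_pos
  have hα := N.alphaC_pos
  unfold interfererPower
  split_ifs with h
  · refine mul_le_mul_of_nonneg_left ?_ (by positivity)
    exact Real.rpow_le_rpow_of_nonpos hrc h.le (by linarith)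
  · positivity

/-- Mean received power of the desired link of the connected user. -/
lemma Pb_mul_pathLossC_xB : N.Pb * N.pathLossC N.xB = N.Pb * N.C * N.rc ^ (-N.alphaC) := by
  rw [pathLossC, rc, mul_assoc]

lemma Pb_mul_pathLossC_xB_pos : 0 < N.Pb * N.pathLossC N.xB := by
  have := N.Pb_pos
  have := N.C_pos
  have hrc := N.rc_pos
  rw [Pb_mul_pathLossC_xB]
  positivity

/-- Division by the mean desired power makes the path loss a function of distance relative to `r_c`,
the form in which the radial integral is known. -/
lemma lamB_mul_integral_interfererPower {t : ℝ} (ht : 0 ≤ t) :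
    N.lamB * ∫ x, (1 - ((1 + t / (N.Pb * N.C * N.rc ^ (-N.alphaC)) * N.interfererPower x / N.m) ^
      N.m)⁻¹) = Real.pi * N.lamB * (gaussHyp (-(2 / N.alphaC)) (N.m : ℝ) (1 - 2 / N.alphaC)
        (-(t / N.m)) - 1) * N.rc ^ 2 := by
  have hP := N.Pb_pos
  have hC := N.C_pos
  have hrc := N.rc_pos
  have hm : (0 : ℝ) < N.m := by exact_mod_cast N.m_pos
  have hz : 0 ≤ t / N.m := by positivity
  trans N.lamB * (Real.pi * N.rc ^ 2 * (gaussHyp (-(2 / N.alphaC)) (N.m : ℝ) (1 - 2 / N.alphaC)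
    (-(t / N.m)) - 1))
  swap
  · ring
  rw [← integral_ite_one_sub_inv_pow hrc N.two_lt_alphaC hz N.m N.xc]
  congr 2 with x
  unfold interfererPower
  split_ifs with h
  · have hd : 0 < dist x N.xc := hrc.trans h
    rw [Real.div_rpow hd.le hrc.le]
    have : 0 < N.rc ^ (-N.alphaC) := by positivity
    congr 4
    field_simp
  · simp

end Network

/-- Alternating expansion of the surrogate tail. -/
lemma expTail_eq_sum (m : ℕ) (κ x : ℝ) :
    expTail m κ x = ∑ n ∈ Finset.Icc 1 m, (-1 : ℝ) ^ (n + 1) * (m.choose n : ℝ) *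
      Real.exp (-(n * (κ * x))) := by
  have h1 : (1 - Real.exp (-(κ * x))) ^ m = ∑ n ∈ Finset.range (m + 1),
      (-Real.exp (-(κ * x))) ^ n * (m.choose n : ℝ) := by
    rw [sub_eq_neg_add, add_pow]
    simp
  have h2 : Finset.Icc 1 m = Finset.Ico 1 (m + 1) := by ext; simp
  -- The binomial term of index `0` equals `1` and cancels the leading `1`.
  rw [expTail, h1, Finset.sum_range_succ', h2, Finset.sum_Ico_eq_sum_range, Nat.add_sub_cancel]
  simp only [pow_zero, Nat.choose_zero_right, Nat.cast_one, mul_one, sub_add_cancel_right]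
  rw [← Finset.sum_neg_distrib]
  refine Finset.sum_congr rfl fun k _ => ?_
  rw [neg_pow, ← Real.exp_nat_mul, add_comm 1 k, pow_succ (-1 : ℝ) (k + 1), mul_neg]
  ring

lemma expTail_mem_Icc (m : ℕ) {κ x : ℝ} (hκ : 0 ≤ κ) (hx : 0 ≤ x) :
    expTail m κ x ∈ Set.Icc (0 : ℝ) 1 := by
  have h0 : 0 < Real.exp (-(κ * x)) := Real.exp_pos _
  have h1 : Real.exp (-(κ * x)) ≤ 1 := Real.exp_le_one_iff.2 (by
    have : 0 ≤ κ * x := by positivity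
    linarith)
  have h2 : (1 - Real.exp (-(κ * x))) ^ m ≤ 1 := pow_le_one₀ (by linarith) (by linarith)
  have h3 : 0 ≤ (1 - Real.exp (-(κ * x))) ^ m := pow_nonneg (by linarith) _
  constructor <;> · rw [expTail]; linarith

namespace ConnectedScenario

variable {N : Network} {Ω : Type*} [MeasurableSpace Ω] {P : Measure Ω} (S : ConnectedScenario N P)

lemma interference_eq (ω : Ω) :
    S.interference ω = ∑' n, S.g n ω * N.interfererPower (S.X n ω) := by
  classical
  unfold interference Network.interfererPower
  refine tsum_congr fun n => ?_
  split_ifs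
  · rw [Network.pathLossC]; ring
  · simp

lemma X_g_indep : IndepFun (fun ω n => S.X n ω) (fun ω n => S.g n ω) P :=
  S.X_fading_indep.comp measurable_id measurable_fst

lemma X_measurable : Measurable fun ω n => S.X n ω := measurable_pi_iff.2 S.poisson.measurable

lemma g_measurable' : Measurable fun ω n => S.g n ω := measurable_pi_iff.2 S.g_measurable

lemma ae_g_nonneg : ∀ᵐ ω ∂P, ∀ n, 0 ≤ S.g n ω :=
  ae_all_iff.2 fun n => ae_nonneg_of_map_eq_nakagamiPower (S.g_measurable n) (S.g_law n)

lemma ae_h_nonneg : ∀ᵐ ω ∂P, 0 ≤ S.h ω :=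
  ae_nonneg_of_map_eq_nakagamiPower S.h_measurable S.h_law

lemma ae_interference_nonneg : ∀ᵐ ω ∂P, 0 ≤ S.interference ω := by
  filter_upwards [S.ae_g_nonneg] with ω hω
  rw [interference_eq]
  exact tsum_nonneg fun n => mul_nonneg (hω n) (N.interfererPower_nonneg _)

lemma measurable_interference : Measurable S.interference := by
  have : S.interference = fun ω => ∑' n, S.g n ω * N.interfererPower (S.X n ω) :=
    funext S.interference_eq
  rw [this]
  exact Measurable.tsum fun n => (S.g_measurable n).mul
    (N.measurable_interfererPower.comp (S.poisson.measurable n))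

variable [IsProbabilityMeasure P]

/-- Laplace transform of the interference of the connected user. -/
lemma integral_exp_neg_interference {t : ℝ} (ht : 0 ≤ t) :
    ∫ ω, Real.exp (-(t / (N.Pb * N.C * N.rc ^ (-N.alphaC)) * S.interference ω)) ∂P =
      Real.exp (-(Real.pi * N.lamB * (gaussHyp (-(2 / N.alphaC)) (N.m : ℝ) (1 - 2 / N.alphaC)
        (-(t / N.m)) - 1) * N.rc ^ 2)) := by
  have hP := N.Pb_pos
  have hC := N.C_pos
  have hrc := N.rc_pos
  have ha : 0 ≤ t / (N.Pb * N.C * N.rc ^ (-N.alphaC)) := by positivity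
  rw [← N.lamB_mul_integral_interfererPower ht]
  set a := t / (N.Pb * N.C * N.rc ^ (-N.alphaC)) with hadef
  have h1 := integral_exp_neg_tsum_mul S.poisson N.lamB_pos N.m_pos S.g_measurable S.g_law
    S.g_indep S.X_g_indep (w := fun x => a * N.interfererPower x)
    (N.measurable_interfererPower.const_mul a)
    (fun x => mul_nonneg ha (N.interfererPower_nonneg x))
    (N.integrable_interfererPower.const_mul a)
    (fun x => mul_le_mul_of_nonneg_left (N.interfererPower_le x) ha)
  rw [← h1]
  refine integral_congr_ae (Filter.Eventually.of_forall fun ω => ?_)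
  dsimp only
  rw [interference_eq, ← tsum_mul_left]
  congr 3
  ext n
  ring

/-- The closed form of the mean of the surrogate tail. -/
lemma meanTail_expTail {κ : ℝ} (hκ : 0 ≤ κ) (θ : ℝ≥0∞) :
    S.meanTail (expTail N.mC κ) θ = N.binomialSum κ θ := by
  rw [meanTail, Network.binomialSum]
  split_ifs with hθ
  · rfl
  set t := θ.toReal with ht
  have ht0 : 0 ≤ t := ENNReal.toReal_nonneg
  have hP := N.Pb_pos
  have hC := N.C_pos
  have hrc := N.rc_pos
  have hσ := N.noise_pos
  have hL : 0 < N.Pb * N.C * N.rc ^ (-N.alphaC) := by positivity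
  simp_rw [expTail_eq_sum, N.Pb_mul_pathLossC_xB]
  -- Each exponential separates into a deterministic noise factor and the variable whose mean is the
  -- Laplace transform of the interference at level `n κ t`.
  have hsplit : ∀ (n : ℕ) (ω : Ω), Real.exp (-(n * (κ * (t * (S.interference ω + N.noise) /
      (N.Pb * N.C * N.rc ^ (-N.alphaC)))))) =
      Real.exp (-(N.muNoise κ t n * N.rc ^ N.alphaC)) * Real.exp (-(n * κ * t /
        (N.Pb * N.C * N.rc ^ (-N.alphaC)) * S.interference ω)) := by
    intro n ω
    rw [← Real.exp_add, Network.muNoise, Real.rpow_neg hrc.le]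
    congr 1
    have : 0 < N.rc ^ N.alphaC := by positivity
    field_simp
    ring
  simp_rw [hsplit]
  rw [integral_finsetSum]
  · refine Finset.sum_congr rfl fun n _ => ?_
    rw [integral_const_mul, integral_const_mul, S.integral_exp_neg_interference (by positivity),
      ← Real.exp_add, Network.muInterference]
    congr 2
    ring
  · intro n _
    refine Integrable.const_mul (Integrable.const_mul ?_ _) _
    refine Integrable.of_bound (C := 1) ?_ ?_
    · exact (Real.measurable_exp.comp
        (S.measurable_interference.const_mul _).neg).aestronglyMeasurable
    · filter_upwards [S.ae_interference_nonneg] with ω hω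
      rw [Real.norm_eq_abs, Real.abs_exp, Real.exp_le_one_iff, neg_nonpos]
      positivity

end ConnectedScenario

/-! ### Coverage probability of the connected user -/

lemma nakagamiTail_mem_Icc {m : ℕ} (hm : 0 < m) (x : ℝ) : nakagamiTail m x ∈ Set.Icc (0 : ℝ) 1 := by
  have := isProbabilityMeasure_nakagamiPower hm
  exact ⟨measureReal_nonneg, measureReal_le_one⟩

lemma antitone_nakagamiTail {m : ℕ} (hm : 0 < m) : Antitone (nakagamiTail m) := by
  have := isProbabilityMeasure_nakagamiPower hm
  exact fun x y hxy => measureReal_mono (Set.Ioi_subset_Ioi hxy)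

namespace ConnectedScenario

variable {N : Network} {Ω : Type*} [MeasurableSpace Ω] {P : Measure Ω} (S : ConnectedScenario N P)

/-- The value of the fading power at which the received SINR is `t`. -/
noncomputable def fadingLevel (t : ℝ) (ω : Ω) : ℝ :=
  t * (S.interference ω + N.noise) / (N.Pb * N.pathLossC N.xB)

lemma measurable_fadingLevel (t : ℝ) : Measurable (S.fadingLevel t) :=
  ((S.measurable_interference.add_const _).const_mul t).div_const _

/-- Almost surely the comparisons of the SINRs are comparisons of the fading power. -/
lemma ae_lt_sinrOMA_iff :
    ∀ᵐ ω ∂P, 0 ≤ S.sinrOMA ω ∧ (∀ t, t < S.sinrOMA ω ↔ S.fadingLevel t ω < S.h ω) ∧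
      ∀ t, t = S.sinrOMA ω ↔ S.fadingLevel t ω = S.h ω := by
  have hL := N.Pb_mul_pathLossC_xB_pos
  have hσ := N.noise_pos
  filter_upwards [S.ae_interference_nonneg, S.ae_h_nonneg] with ω hI hh
  have hIσ : 0 < S.interference ω + N.noise := by linarith
  have heq : S.sinrOMA ω = S.h ω * (N.Pb * N.pathLossC N.xB) / (S.interference ω + N.noise) := by
    rw [sinrOMA]; ring
  rw [heq]
  refine ⟨by positivity, fun t => ?_, fun t => ?_⟩
  · rw [fadingLevel, lt_div_iff₀ hIσ, div_lt_iff₀ hL]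
  · rw [fadingLevel, eq_div_iff hIσ.ne', div_eq_iff hL.ne']

/-- Clearing denominators leaves `γ_c^th (I_c + σ²) < (a_c - a_t γ_c^th) A` with `A` the desired
power; the standing assumption makes the coefficient of `A` positive. -/
lemma ae_gammaTh_lt_sinr_iff (hth : N.aT * N.gammaTh < N.ac) :
    ∀ᵐ ω ∂P, (N.gammaTh < S.sinr ω ↔ N.thetaC < S.sinrOMA ω) := by
  have hL := N.Pb_mul_pathLossC_xB_pos
  have hσ := N.noise_pos
  have ha := N.aT_pos
  filter_upwards [S.ae_interference_nonneg, S.ae_h_nonneg] with ω hI hh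
  have hIσ : 0 < S.interference ω + N.noise := by linarith
  set A := N.Pb * S.h ω * N.pathLossC N.xB with hA
  have hA0 : 0 ≤ A := by
    have : A = S.h ω * (N.Pb * N.pathLossC N.xB) := by rw [hA]; ring
    rw [this]; positivity
  have hs : S.sinr ω = N.ac * A / (N.aT * A + S.interference ω + N.noise) := by
    rw [sinr, hA]; ring_nf
  rw [hs, sinrOMA, ← hA, Network.thetaC, lt_div_iff₀ (by positivity), lt_div_iff₀ hIσ,
    div_mul_eq_mul_div, div_lt_iff₀ (by linarith)]
  constructor <;> intro h <;> linarith

variable [IsProbabilityMeasure P]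

lemma indepFun_fadingLevel_h (t : ℝ) : IndepFun (S.fadingLevel t) S.h P := by
  have h1 := indepFun_prodMk_of_indepFun_prodMk S.X_measurable S.g_measurable' S.h_measurable
    S.X_fading_indep S.g_h_indep
  have hI : Measurable fun p : (ℕ → Plane) × (ℕ → ℝ) =>
      t * (∑' n, p.2 n * N.interfererPower (p.1 n) + N.noise) / (N.Pb * N.pathLossC N.xB) := by
    refine (((Measurable.tsum fun n => ?_).add_const _).const_mul t).div_const _
    exact ((measurable_pi_apply n).comp measurable_snd).mul
      (N.measurable_interfererPower.comp ((measurable_pi_apply n).comp measurable_fst))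
  have h2 := h1.comp hI measurable_id
  have h3 : S.fadingLevel t = (fun p : (ℕ → Plane) × (ℕ → ℝ) =>
      t * (∑' n, p.2 n * N.interfererPower (p.1 n) + N.noise) / (N.Pb * N.pathLossC N.xB)) ∘
      fun ω => (fun n => S.X n ω, fun n => S.g n ω) := by
    funext ω
    rw [fadingLevel, interference_eq]
    rfl
  rw [h3]
  exact h2

/-- The level depends on locations and interfering fading only, so `h` can be integrated out first.
A half-plane as `R` gives the mean tail, the diagonal gives the absence of ties. -/
lemma measure_fadingLevel_rel (t : ℝ) {R : Set (ℝ × ℝ)} (hR : MeasurableSet R) :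
    P {ω | (S.fadingLevel t ω, S.h ω) ∈ R} =
      ∫⁻ ω, nakagamiPower N.mC {y | (S.fadingLevel t ω, y) ∈ R} ∂P := by
  have h1 := lintegral_of_indepFun (S.measurable_fadingLevel t) S.h_measurable
    (S.indepFun_fadingLevel_h t) (F := R.indicator 1) (measurable_one.indicator hR)
  have h2 : MeasurableSet {ω | (S.fadingLevel t ω, S.h ω) ∈ R} :=
    ((S.measurable_fadingLevel t).prodMk S.h_measurable) hR
  rw [← lintegral_indicator_one h2]
  refine Eq.trans ?_ (h1.trans ?_)
  · rfl
  · refine lintegral_congr fun ω => ?_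
    have h3 : MeasurableSet {y | (S.fadingLevel t ω, y) ∈ R} := measurable_prodMk_left hR
    rw [← S.h_law, Measure.map_apply S.h_measurable h3,
      ← lintegral_indicator_one (S.h_measurable h3)]
    rfl

lemma measureReal_fadingLevel_lt (t : ℝ) :
    P.real {ω | S.fadingLevel t ω < S.h ω} =
      ∫ ω, nakagamiTail N.mC (S.fadingLevel t ω) ∂P := by
  have := isProbabilityMeasure_nakagamiPower N.mC_pos
  have h1 := S.measure_fadingLevel_rel t (R := {p | p.1 < p.2})
    (measurableSet_lt measurable_fst measurable_snd)
  rw [measureReal_def]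
  change (P {ω | (S.fadingLevel t ω, S.h ω) ∈ {p : ℝ × ℝ | p.1 < p.2}}).toReal = _
  rw [h1, integral_eq_lintegral_of_nonneg_ae
    (Filter.Eventually.of_forall fun ω => (nakagamiTail_mem_Icc N.mC_pos _).1)
    ((antitone_nakagamiTail N.mC_pos).measurable.comp
      (S.measurable_fadingLevel t)).aestronglyMeasurable]
  congr 1
  refine lintegral_congr fun ω => ?_
  rw [nakagamiTail, ofReal_measureReal]
  rfl

/-- The law of `h` has no atoms. This reconciles the strict upper constraint in the coverage event
with the complement of a strict inequality. -/
lemma ae_fadingLevel_ne (t : ℝ) : ∀ᵐ ω ∂P, S.fadingLevel t ω ≠ S.h ω := by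
  have h1 := S.measure_fadingLevel_rel t (R := {p | p.1 = p.2})
    (measurableSet_eq_fun measurable_fst measurable_snd)
  rw [ae_iff]
  simp only [ne_eq, not_not]
  refine h1.trans ?_
  refine (lintegral_congr fun ω => ?_).trans lintegral_zero
  have : {y | (S.fadingLevel t ω, y) ∈ {p : ℝ × ℝ | p.1 = p.2}} = {S.fadingLevel t ω} := by
    ext y; exact eq_comm
  rw [this, measure_singleton]

lemma coverage_eq_zero (hth : N.aT * N.gammaTh < N.ac) {γ : ℝ≥0∞}
    (hγ : γ ≤ ENNReal.ofReal N.thetaC) : S.coverage γ = 0 := by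
  rw [coverage, measureReal_eq_zero_iff, measure_eq_zero_iff_ae_notMem]
  filter_upwards [S.ae_gammaTh_lt_sinr_iff hth] with ω h1
  rintro ⟨h2, h3⟩
  rw [h1] at h2
  have := h3.trans_le hγ
  exact (ENNReal.ofReal_le_ofReal h2.le).not_gt this

/-- Up to null sets the coverage event is the difference of two nested events, in which the OMA SINR
exceeds `θ_c` and `γ` respectively. -/
lemma coverage_eq (hth : N.aT * N.gammaTh < N.ac) {γ : ℝ≥0∞}
    (hγ : ENNReal.ofReal N.thetaC ≤ γ) :
    S.coverage γ = S.meanTail (nakagamiTail N.mC) (ENNReal.ofReal N.thetaC) -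
      S.meanTail (nakagamiTail N.mC) γ := by
  have hθ := N.thetaC_pos hth
  have hmean : ∀ τ : ℝ≥0∞, τ ≠ ∞ → S.meanTail (nakagamiTail N.mC) τ =
      P.real {ω | S.fadingLevel τ.toReal ω < S.h ω} := by
    intro τ hτ
    rw [S.measureReal_fadingLevel_lt, meanTail, if_neg hτ]
    rfl
  rw [hmean _ ENNReal.ofReal_ne_top, ENNReal.toReal_ofReal hθ.le, coverage]
  rcases eq_or_ne γ ∞ with rfl | hγtop
  -- At `γ = ∞` the upper constraint is empty, in agreement with the value `0` given to `meanTail`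
  -- there.
  · rw [meanTail, if_pos rfl, sub_zero]
    refine measureReal_congr ?_
    filter_upwards [S.ae_gammaTh_lt_sinr_iff hth, S.ae_lt_sinrOMA_iff] with ω h1 h2
    refine propext ?_
    change (N.gammaTh < S.sinr ω ∧ ENNReal.ofReal (S.sinrOMA ω) < ∞) ↔ _
    rw [h1, h2.2.1]
    exact ⟨fun h => h.1, fun h => ⟨h, ENNReal.ofReal_lt_top⟩⟩
  · rw [hmean γ hγtop]
    have hle : N.thetaC ≤ γ.toReal := (ENNReal.ofReal_le_iff_le_toReal hγtop).1 hγ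
    have hσ := N.noise_pos
    have hms : ∀ t, MeasurableSet {ω | S.fadingLevel t ω < S.h ω} := fun t =>
      measurableSet_lt (S.measurable_fadingLevel t) S.h_measurable
    have hsub : ({ω | S.fadingLevel γ.toReal ω < S.h ω} ∩
        {ω | S.fadingLevel N.thetaC ω < S.h ω} : Set Ω) =ᵐ[P]
        {ω | S.fadingLevel γ.toReal ω < S.h ω} := by
      filter_upwards [S.ae_lt_sinrOMA_iff] with ω h2
      refine propext ⟨fun h => h.1, fun h => ⟨h, ?_⟩⟩
      exact (h2.2.1 _).1 (hle.trans_lt ((h2.2.1 _).2 h))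
    rw [← measureReal_congr hsub, Set.inter_comm,
      ← measureReal_sdiff_add_inter (s := {ω | S.fadingLevel N.thetaC ω < S.h ω}) (hms γ.toReal),
      add_sub_cancel_right]
    refine measureReal_congr ?_
    filter_upwards [S.ae_gammaTh_lt_sinr_iff hth, S.ae_lt_sinrOMA_iff,
      S.ae_fadingLevel_ne γ.toReal] with ω h1 h2 h3
    refine propext ?_
    change (N.gammaTh < S.sinr ω ∧ ENNReal.ofReal (S.sinrOMA ω) < γ) ↔
      (S.fadingLevel N.thetaC ω < S.h ω ∧ ¬ S.fadingLevel γ.toReal ω < S.h ω)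
    have h4 : S.sinrOMA ω ≠ γ.toReal := fun h4 => h3 ((h2.2.2 _).1 h4.symm)
    rw [h1, ENNReal.ofReal_lt_iff_lt_toReal h2.1 hγtop, ← h2.2.1, ← h2.2.1, not_lt]
    exact ⟨fun h => ⟨h.1, h.2.le⟩, fun h => ⟨h.1, lt_of_le_of_ne h.2 h4⟩⟩

lemma integrable_comp_fadingLevel {F : ℝ → ℝ} (hF : Measurable F) {t : ℝ} (ht : 0 ≤ t)
    (hF01 : ∀ x, 0 ≤ x → F x ∈ Set.Icc (0 : ℝ) 1) :
    Integrable (fun ω => F (S.fadingLevel t ω)) P := by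
  have hL := N.Pb_mul_pathLossC_xB_pos
  have hσ := N.noise_pos
  refine Integrable.of_bound (C := 1)
    (hF.comp (S.measurable_fadingLevel t)).aestronglyMeasurable ?_
  filter_upwards [S.ae_interference_nonneg] with ω hI
  have h1 := hF01 (S.fadingLevel t ω) (by unfold fadingLevel; positivity)
  rw [Real.norm_of_nonneg h1.1]
  exact h1.2

lemma meanTail_mono {F G : ℝ → ℝ} (hF : Measurable F) (hG : Measurable G)
    (hF01 : ∀ x, 0 ≤ x → F x ∈ Set.Icc (0 : ℝ) 1) (hG01 : ∀ x, 0 ≤ x → G x ∈ Set.Icc (0 : ℝ) 1)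
    (hFG : ∀ x, 0 ≤ x → F x ≤ G x) (θ : ℝ≥0∞) : S.meanTail F θ ≤ S.meanTail G θ := by
  have hL := N.Pb_mul_pathLossC_xB_pos
  have hσ := N.noise_pos
  rw [meanTail, meanTail]
  split_ifs with hθ
  · exact le_rfl
  have ht : 0 ≤ θ.toReal := ENNReal.toReal_nonneg
  refine integral_mono_ae (S.integrable_comp_fadingLevel hF ht hF01)
    (S.integrable_comp_fadingLevel hG ht hG01) ?_
  filter_upwards [S.ae_interference_nonneg] with ω hI
  exact hFG _ (by positivity)

lemma binomialSum_le_meanTail (θ : ℝ≥0∞) :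
    N.binomialSum N.mC θ ≤ S.meanTail (nakagamiTail N.mC) θ := by
  rw [← S.meanTail_expTail (Nat.cast_nonneg _)]
  exact S.meanTail_mono (by unfold expTail; fun_prop) (antitone_nakagamiTail N.mC_pos).measurable
    (fun x hx => expTail_mem_Icc _ (Nat.cast_nonneg _) hx)
    (fun x _ => nakagamiTail_mem_Icc N.mC_pos x)
    (fun x hx => expTail_le_nakagamiTail N.mC_pos hx) θ

lemma meanTail_le_binomialSum (θ : ℝ≥0∞) :
    S.meanTail (nakagamiTail N.mC) θ ≤ N.binomialSum (alzerConst N.mC) θ := by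
  have hη := (alzerConst_pos N.mC_pos).le
  rw [← S.meanTail_expTail hη]
  exact S.meanTail_mono (antitone_nakagamiTail N.mC_pos).measurable (by unfold expTail; fun_prop)
    (fun x _ => nakagamiTail_mem_Icc N.mC_pos x) (fun x hx => expTail_mem_Icc _ hη hx)
    (fun x hx => nakagamiTail_le_expTail N.mC_pos hx) θ

end ConnectedScenario

/-! ### The nearest point, and sums over the points farther away -/

/-- Distance from `c` to the nearest of the points `y 0, y 1, …` that lie in `D`. -/
noncomputable def nearestDist (D : Set Plane) (c : Plane) (y : ℕ → Plane) : ℝ :=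
  sInf {d | ∃ n, y n ∈ D ∧ d = dist (y n) c}

lemma nearestDist_nonneg (D : Set Plane) (c : Plane) (y : ℕ → Plane) : 0 ≤ nearestDist D c y :=
  Real.sInf_nonneg (by rintro d ⟨n, -, rfl⟩; exact dist_nonneg)

/-- A point in `D` is required because the infimum of the empty set is `0`. -/
lemma nearestDist_lt_iff_of_exists {D : Set Plane} {c : Plane} {y : ℕ → Plane}
    (h : ∃ n, y n ∈ D) (t : ℝ) :
    nearestDist D c y < t ↔ ∃ n, y n ∈ D ∧ dist (y n) c < t := by
  obtain ⟨n₀, hn₀⟩ := h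
  have hbdd : BddBelow {d | ∃ n, y n ∈ D ∧ d = dist (y n) c} :=
    ⟨0, by rintro d ⟨n, -, rfl⟩; exact dist_nonneg⟩
  rw [nearestDist, csInf_lt_iff hbdd ⟨_, n₀, hn₀, rfl⟩]
  constructor
  · rintro ⟨d, ⟨n, hn, rfl⟩, hlt⟩
    exact ⟨n, hn, hlt⟩
  · rintro ⟨n, hn, hlt⟩
    exact ⟨_, ⟨n, hn, rfl⟩, hlt⟩

lemma nearestDist_of_forall_notMem {D : Set Plane} {c : Plane} {y : ℕ → Plane}
    (h : ∀ n, y n ∉ D) : nearestDist D c y = 0 := by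
  have : {d | ∃ n, y n ∈ D ∧ d = dist (y n) c} = ∅ := by
    ext d
    simp only [Set.mem_ofPred_eq, Set.mem_empty_iff_false, iff_false]
    rintro ⟨n, hn, -⟩
    exact h n hn
  rw [nearestDist, this, Real.sInf_empty]

lemma measurable_nearestDist {D : Set Plane} (hD : MeasurableSet D) :
    Measurable fun p : Plane × (ℕ → Plane) => nearestDist D p.1 p.2 := by
  refine measurable_of_Iio fun t => ?_
  have hn : ∀ n : ℕ, MeasurableSet {p : Plane × (ℕ → Plane) | p.2 n ∈ D} := fun n =>
    ((measurable_pi_apply n).comp measurable_snd) hD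
  have hd : ∀ n : ℕ, MeasurableSet {p : Plane × (ℕ → Plane) | dist (p.2 n) p.1 < t} := fun n =>
    measurableSet_lt (((measurable_pi_apply n).comp measurable_snd).dist measurable_fst)
      measurable_const
  -- The second piece accounts for configurations without points in `D`, where the distance takes
  -- the default value `0`.
  have heq : (fun p : Plane × (ℕ → Plane) => nearestDist D p.1 p.2) ⁻¹' Set.Iio t =
      (⋃ n, {p : Plane × (ℕ → Plane) | p.2 n ∈ D} ∩ {p | dist (p.2 n) p.1 < t}) ∪
      ((⋃ n, {p : Plane × (ℕ → Plane) | p.2 n ∈ D})ᶜ ∩ {_p | 0 < t}) := by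
    ext p
    by_cases h : ∃ n, p.2 n ∈ D
    · simp [nearestDist_lt_iff_of_exists h, h]
    · push Not at h
      simp [nearestDist_of_forall_notMem h, h]
  rw [heq]
  exact (MeasurableSet.iUnion fun n => (hn n).inter (hd n)).union
    ((MeasurableSet.iUnion hn).compl.inter (MeasurableSet.const _))

/-- The smallest multiple of `1 / (k + 1)` that exceeds `r ≥ 0`. -/
noncomputable def ceilGrid (k : ℕ) (r : ℝ) : ℝ := (⌊((k : ℝ) + 1) * r⌋₊ + 1) / ((k : ℝ) + 1)

lemma lt_ceilGrid (k : ℕ) (r : ℝ) : r < ceilGrid k r := by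
  rw [ceilGrid, lt_div_iff₀ (by positivity), mul_comm]
  exact Nat.lt_floor_add_one _

lemma measurable_ceilGrid (k : ℕ) : Measurable (ceilGrid k) :=
  ((measurable_from_nat.comp (Nat.measurable_floor.comp (measurable_id.const_mul _))).add_const
    1).div_const _

/-- The approach is strictly from the right, so that right continuity of the weights is all that the
limit needs. -/
lemma tendsto_ceilGrid {r : ℝ} (hr : 0 ≤ r) :
    Filter.Tendsto (fun k => ceilGrid k r) Filter.atTop (nhdsWithin r (Set.Ioi r)) := by
  refine tendsto_nhdsWithin_iff.2 ⟨?_, Filter.Eventually.of_forall fun k => lt_ceilGrid k r⟩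
  have h1 : Filter.Tendsto (fun k : ℕ => (k : ℝ) + 1) Filter.atTop Filter.atTop :=
    Filter.tendsto_atTop_add_const_right _ _ tendsto_natCast_atTop_atTop
  have h2 : Filter.Tendsto (fun k : ℕ => r + ((k : ℝ) + 1)⁻¹) Filter.atTop (nhds r) := by
    simpa using (tendsto_inv_atTop_zero.comp h1).const_add r
  refine tendsto_of_tendsto_of_tendsto_of_le_of_le tendsto_const_nhds h2
    (fun k => (lt_ceilGrid k r).le) fun k => ?_
  have h3 : (⌊((k : ℝ) + 1) * r⌋₊ : ℝ) ≤ ((k : ℝ) + 1) * r := Nat.floor_le (by positivity)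
  have h4 : ((k : ℝ) + 1)⁻¹ * ((k : ℝ) + 1) = 1 := inv_mul_cancel₀ (by positivity)
  rw [ceilGrid, div_le_iff₀ (by positivity)]
  linarith

namespace IsHomogeneousPoisson

variable {Ω : Type*} [MeasurableSpace Ω] {P : Measure Ω} {X : ℕ → Ω → Plane} {lam : ℝ}
  [IsProbabilityMeasure P]

open Classical in
/-- Discretized form of `lintegral_nearestDist_mul_tsum_le`: the event that the nearest point of
`D` is at a distance in `[s, t)` is independent of the points at distance more than `t`. -/
lemma lintegral_ceilGrid_mul_tsum_le (hX : IsHomogeneousPoisson P X lam) (hlam : 0 < lam)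
    {D : Set Plane} (hD : MeasurableSet D) (c : Plane) {v : Plane → ℝ≥0∞} (hv : Measurable v)
    (q b : ℝ → ℝ≥0∞)
    (hb : ∀ t, 0 < t → ENNReal.ofReal lam * ∫⁻ y in {y | t < dist y c}, v y ≤ b t) (k : ℕ) :
    let r := fun ω => ceilGrid k (nearestDist D c fun n => X n ω)
    ∫⁻ ω, q (r ω) * ∑' n, (if X n ω ∈ D ∧ r ω < dist (X n ω) c then v (X n ω) else 0) ∂P ≤
      ∫⁻ ω, q (r ω) * b (r ω) ∂P := by
  intro r
  let t : ℕ → ℝ := fun j => (j : ℝ) / ((k : ℝ) + 1)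
  have ht : ∀ j, 0 < t (j + 1) := fun j => by simp only [t]; positivity
  have htm : ∀ j, t j ≤ t (j + 1) := fun j => by simp only [t]; gcongr; simp
  let A : ℕ → Set Plane := fun j => D ∩ Metric.ball c (t j)
  let B : ℕ → Set Plane := fun j => D ∩ {y | t j < dist y c}
  have hA : ∀ j, MeasurableSet (A j) := fun j => hD.inter measurableSet_ball
  have hBd : ∀ s : ℝ, MeasurableSet {y : Plane | s < dist y c} := fun s =>
    measurableSet_lt measurable_const (by fun_prop)
  have hB : ∀ j, MeasurableSet (B j) := fun j => hD.inter (hBd _)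
  have hAB : ∀ j, Disjoint (A j) (B j) := fun j =>
    Set.disjoint_left.2 fun y hy hy' => (Metric.mem_ball.1 hy.2).not_gt hy'.2
  have hAm : ∀ j, A j ⊆ A (j + 1) := fun j =>
    Set.inter_subset_inter_right _ (Metric.ball_subset_ball (htm j))
  -- No point of `D` closer than `t j`, but one closer than `t (j + 1)`. Both counts concern sets
  -- disjoint from `B (j + 1)`, so Campbell's formula there is unaffected by the event.
  let K : Set (ℕ∞ × ℕ∞) := {p | p.1 = 0 ∧ p.2 ≠ 0}
  let E : ℕ → Set Ω := fun j => {ω | (pointCount (fun n => X n ω) (A j),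
    pointCount (fun n => X n ω) (A (j + 1) \ A j)) ∈ K}
  have hE : ∀ j, MeasurableSet (E j) := fun j =>
    ((hX.measurable_count (hA j)).prodMk (hX.measurable_count ((hA (j + 1)).diff (hA j))))
      (.of_discrete : MeasurableSet K)
  have hcampbell : ∀ j, ∫⁻ ω in E j, ∑' n, (B (j + 1)).indicator v (X n ω) ∂P =
      P (E j) * (ENNReal.ofReal lam * ∫⁻ x in B (j + 1), v x) := fun j =>
    hX.setLIntegral_tsum_indicator_of_disjoint hlam (hA j) ((hA (j + 1)).diff (hA j)) (hB (j + 1))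
      Set.disjoint_sdiff_right ((hAB (j + 1)).mono_left (hAm j))
      ((hAB (j + 1)).mono_left Set.sdiff_subset) K hv
  have hmemE : ∀ j ω, ω ∈ E j ↔ (∃ n, X n ω ∈ D) ∧
      ⌊((k : ℝ) + 1) * nearestDist D c fun n => X n ω⌋₊ = j := by
    intro j ω
    have hk : (0 : ℝ) < (k : ℝ) + 1 := by positivity
    have h1 : ω ∈ E j ↔ (∀ n, X n ω ∉ A j) ∧ ∃ n, X n ω ∈ A (j + 1) := by
      change (pointCount (fun n => X n ω) (A j) = 0 ∧
        pointCount (fun n => X n ω) (A (j + 1) \ A j) ≠ 0) ↔ _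
      rw [Ne, pointCount_eq_zero_iff, pointCount_eq_zero_iff]
      push Not
      refine and_congr_right fun h => exists_congr fun n => ?_
      exact ⟨fun h' => h'.1, fun h' => ⟨h', h n⟩⟩
    rw [h1]
    by_cases hex : ∃ n, X n ω ∈ D
    · have h2 : ∀ s, (∃ n, X n ω ∈ D ∩ Metric.ball c s) ↔
          nearestDist D c (fun n => X n ω) < s := fun s => by
        rw [nearestDist_lt_iff_of_exists hex]; rfl
      have h3 : (∀ n, X n ω ∉ A j) ↔ t j ≤ nearestDist D c (fun n => X n ω) := by
        rw [← not_lt, ← h2]; push Not; rfl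
      rw [h3, h2, Nat.floor_eq_iff (mul_nonneg hk.le (nearestDist_nonneg _ _ _))]
      simp only [hex, true_and, t]
      rw [div_le_iff₀ hk, lt_div_iff₀ hk, mul_comm]
      push_cast
      rfl
    · simp only [hex, false_and, iff_false]
      rintro ⟨-, n, hn⟩
      exact hex ⟨n, hn.1⟩
  have hr : ∀ j ω, ω ∈ E j → r ω = t (j + 1) := by
    intro j ω hω
    simp only [r, t, ceilGrid, ((hmemE j ω).1 hω).2]
    push_cast
    rfl
  calc ∫⁻ ω, q (r ω) * ∑' n, (if X n ω ∈ D ∧ r ω < dist (X n ω) c then v (X n ω) else 0) ∂P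
      ≤ ∫⁻ ω, ∑' j, (E j).indicator
          (fun ω => q (t (j + 1)) * ∑' n, (B (j + 1)).indicator v (X n ω)) ω ∂P := by
        refine lintegral_mono fun ω => ?_
        by_cases hex : ∃ n, X n ω ∈ D
        · have hω := (hmemE _ ω).2 ⟨hex, rfl⟩
          refine le_trans (le_of_eq ?_) (ENNReal.le_tsum
            ⌊((k : ℝ) + 1) * nearestDist D c fun n => X n ω⌋₊)
          rw [Set.indicator_of_mem hω, ← hr _ ω hω]
          congr 1
          refine tsum_congr fun n => ?_
          simp only [Set.indicator_apply, B, ← hr _ ω hω]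
          rfl
        -- Without points in `D` every summand on the left vanishes, so the default value of the
        -- distance does no harm.
        · push Not at hex
          simp [hex]
    _ = ∑' j, q (t (j + 1)) * (P (E j) * (ENNReal.ofReal lam * ∫⁻ x in B (j + 1), v x)) := by
        have hm : ∀ j, Measurable fun ω => ∑' n, (B (j + 1)).indicator v (X n ω) := fun j =>
          Measurable.tsum fun n => (hv.indicator (hB (j + 1))).comp (hX.measurable n)
        rw [lintegral_tsum fun j => (((hm j).const_mul _).indicator (hE j)).aemeasurable]
        refine tsum_congr fun j => ?_
        rw [lintegral_indicator (hE j), lintegral_const_mul _ (hm j), hcampbell]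
    _ ≤ ∑' j, q (t (j + 1)) * b (t (j + 1)) * P (E j) := by
        refine ENNReal.tsum_le_tsum fun j => ?_
        rw [mul_comm (P (E j)), ← mul_assoc]
        gcongr
        refine le_trans ?_ (hb _ (ht j))
        gcongr
        exact Set.inter_subset_right
    _ = ∫⁻ ω, ∑' j, (E j).indicator (fun _ => q (t (j + 1)) * b (t (j + 1))) ω ∂P := by
        rw [lintegral_tsum fun j => (measurable_const.indicator (hE j)).aemeasurable]
        refine tsum_congr fun j => ?_
        rw [lintegral_indicator_const (hE j)]
    _ ≤ ∫⁻ ω, q (r ω) * b (r ω) ∂P := by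
        refine lintegral_mono fun ω => ?_
        -- The events are disjoint, hence one index survives. Configurations without points in `D`
        -- belong to none of them, so only an inequality results.
        rw [tsum_eq_single ⌊((k : ℝ) + 1) * nearestDist D c fun n => X n ω⌋₊]
        · refine Set.indicator_apply_le' (fun hω => ?_) fun _ => bot_le
          rw [hr _ ω hω]
        · intro j hj
          refine Set.indicator_of_notMem (fun hω => hj ((hmemE j ω).1 hω).2.symm) _

open Classical in
/-- Given the distance of the nearest point of `D` from `c`, the mean of a sum over the points
of `D` that are farther away is at most the mean of the sum over all the points farther away. -/
lemma lintegral_nearestDist_mul_tsum_le (hX : IsHomogeneousPoisson P X lam) (hlam : 0 < lam)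
    {D : Set Plane} (hD : MeasurableSet D) (c : Plane) {v : Plane → ℝ≥0∞} (hv : Measurable v)
    (hvtop : ∀ y, v y ≠ ∞) {q b : ℝ → ℝ≥0∞} (hqm : Measurable q) (hbm : Measurable b)
    (hb : ∀ t, 0 < t → ENNReal.ofReal lam * ∫⁻ y in {y | t < dist y c}, v y ≤ b t)
    (hq : ∀ r, 0 ≤ r → Filter.Tendsto q (nhdsWithin r (Set.Ioi r)) (nhds (q r)))
    (hqb : ∀ r, 0 ≤ r → Filter.Tendsto (fun r => q r * b r) (nhdsWithin r (Set.Ioi r))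
      (nhds (q r * b r)))
    {M : ℝ≥0∞} (hM : M ≠ ∞) (hqbM : ∀ r, q r * b r ≤ M) :
    let r := fun ω => nearestDist D c fun n => X n ω
    ∫⁻ ω, q (r ω) * ∑' n, (if X n ω ∈ D ∧ r ω < dist (X n ω) c then v (X n ω) else 0) ∂P ≤
      ∫⁻ ω, q (r ω) * b (r ω) ∂P := by
  intro r
  have hr0 : ∀ ω, 0 ≤ r ω := fun ω => nearestDist_nonneg _ _ _
  have hrm : Measurable r := (measurable_nearestDist hD).comp
    (measurable_const.prodMk (measurable_pi_iff.2 hX.measurable))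
  have hrkm : ∀ k, Measurable fun ω => ceilGrid k (r ω) := fun k => (measurable_ceilGrid k).comp hrm
  let f : ℕ → Ω → ℕ → ℝ≥0∞ := fun k ω n =>
    if X n ω ∈ D ∧ ceilGrid k (r ω) < dist (X n ω) c then v (X n ω) else 0
  have hfm : ∀ k n, Measurable fun ω => f k ω n := fun k n => by
    refine Measurable.ite ?_ (hv.comp (hX.measurable n)) measurable_const
    exact (hX.measurable n hD).inter
      (measurableSet_lt (hrkm k) ((hX.measurable n).dist measurable_const))
  -- Fatou's lemma for the counting measure: a point farther than `r ω` is eventually farther than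
  -- the rounded radius too.
  have hpt : ∀ ω, q (r ω) * ∑' n, (if X n ω ∈ D ∧ r ω < dist (X n ω) c then v (X n ω) else 0) ≤
      Filter.liminf (fun k => q (ceilGrid k (r ω)) * ∑' n, f k ω n) Filter.atTop := by
    intro ω
    simp_rw [← ENNReal.tsum_mul_left, ← lintegral_count]
    refine le_trans (lintegral_mono fun n => ?_)
      (lintegral_liminf_le fun k => measurable_from_nat)
    dsimp only
    split_ifs with h
    · have h1 : Filter.Tendsto (fun k => q (ceilGrid k (r ω)) * v (X n ω)) Filter.atTop
          (nhds (q (r ω) * v (X n ω))) :=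
        ENNReal.Tendsto.mul_const ((hq _ (hr0 ω)).comp (tendsto_ceilGrid (hr0 ω)))
          (Or.inr (hvtop _))
      have h2 : ∀ᶠ k in Filter.atTop, ceilGrid k (r ω) < dist (X n ω) c :=
        ((tendsto_ceilGrid (hr0 ω)).mono_right nhdsWithin_le_nhds).eventually_lt_const h.2
      have h3 : Filter.Tendsto (fun k => q (ceilGrid k (r ω)) * f k ω n) Filter.atTop
          (nhds (q (r ω) * v (X n ω))) := by
        refine h1.congr' ?_
        filter_upwards [h2] with k hk
        simp only [f, h.1, hk, and_self, if_true]
      exact h3.liminf_eq.ge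
    · rw [mul_zero]
      exact bot_le
  calc ∫⁻ ω, q (r ω) * ∑' n, (if X n ω ∈ D ∧ r ω < dist (X n ω) c then v (X n ω) else 0) ∂P
      ≤ ∫⁻ ω, Filter.liminf (fun k => q (ceilGrid k (r ω)) * ∑' n, f k ω n) Filter.atTop ∂P :=
        lintegral_mono hpt
    _ ≤ Filter.liminf (fun k => ∫⁻ ω, q (ceilGrid k (r ω)) * ∑' n, f k ω n ∂P) Filter.atTop :=
        lintegral_liminf_le fun k => (hqm.comp (hrkm k)).mul (Measurable.tsum fun n => hfm k n)
    _ ≤ Filter.liminf (fun k => ∫⁻ ω, q (ceilGrid k (r ω)) * b (ceilGrid k (r ω)) ∂P)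
          Filter.atTop :=
        Filter.liminf_le_liminf (Filter.Eventually.of_forall fun k =>
          hX.lintegral_ceilGrid_mul_tsum_le hlam hD c hv q b hb k)
    _ = ∫⁻ ω, q (r ω) * b (r ω) ∂P := by
        -- On the bounding side the product `q * b` is bounded and right continuous, so its
        -- integrals converge.
        refine Filter.Tendsto.liminf_eq ?_
        refine tendsto_lintegral_of_dominated_convergence (fun _ => M)
          (fun k => (hqm.comp (hrkm k)).mul (hbm.comp (hrkm k)))
          (fun k => Filter.Eventually.of_forall fun ω => hqbM _) (by simpa using hM)
          (Filter.Eventually.of_forall fun ω =>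
            (hqb _ (hr0 ω)).comp (tendsto_ceilGrid (hr0 ω)))

end IsHomogeneousPoisson

lemma measurable_nearestDist_swap {D : Set Plane} (hD : MeasurableSet D) :
    Measurable fun p : (ℕ → Plane) × Plane => nearestDist D p.2 p.1 := by
  have hs : Measurable (Prod.swap : (ℕ → Plane) × Plane → Plane × (ℕ → Plane)) := measurable_swap
  exact (measurable_nearestDist hD).comp hs

lemma measurable_comp_snd_apply {w : Plane → Plane → ℝ}
    (hw : Measurable fun p : Plane × Plane => w p.1 p.2) (n : ℕ) :
    Measurable fun p : (ℕ → Plane) × Plane => w p.2 (p.1 n) := by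
  have hn : Measurable fun p : (ℕ → Plane) × Plane => p.1 n :=
    (measurable_pi_apply n).comp measurable_fst
  exact hw.comp (measurable_snd.prodMk hn)

lemma measurableSet_mem_and_nearestDist_lt {D : Set Plane} (hD : MeasurableSet D) (n : ℕ) :
    MeasurableSet {p : (ℕ → Plane) × Plane |
      p.1 n ∈ D ∧ nearestDist D p.2 p.1 < dist (p.1 n) p.2} := by
  have hn : Measurable fun p : (ℕ → Plane) × Plane => p.1 n :=
    (measurable_pi_apply n).comp measurable_fst
  exact (hn hD).inter
    (measurableSet_lt (measurable_nearestDist_swap hD) (hn.dist measurable_snd))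

/-! ### Power received through the surface and the tangent line -/

namespace Network

variable (N : Network)

lemma alphaT_pos : 0 < N.alphaT := by linarith [N.two_lt_alphaT]

lemma alphaT_sub_two_pos : 0 < N.alphaT - 2 := by linarith [N.two_lt_alphaT]

lemma pathLossRIS_eq {r u : ℝ} (hr : 0 ≤ r) (hu : 0 ≤ u) :
    N.pathLossRIS r u = N.coeffRISMean * u ^ (-N.alphaT) * r ^ (-N.alphaT) := by
  rw [pathLossRIS, Real.mul_rpow hr hu]; ring

lemma pathLossRIS_nonneg {r u : ℝ} (hr : 0 ≤ r) (hu : 0 ≤ u) : 0 ≤ N.pathLossRIS r u := by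
  have := N.coeffRISMean_pos
  rw [pathLossRIS]; positivity

lemma meanInterference_nonneg {r u : ℝ} (hr : 0 ≤ r) (hu : 0 ≤ u) :
    0 ≤ N.meanInterference r u := by
  have := N.coeffRISMean_pos
  have := N.alphaT_sub_two_pos
  have := N.Pb_pos
  have := N.lamB_pos
  have := N.rhoT_nonneg
  rw [meanInterference]; positivity

/-- Mean power received by the typical user through a RIS at `x` from an interfering base station
at `y`. -/
noncomputable def risPower (x y : Plane) : ℝ :=
  N.rhoT * (N.Pb * N.pathLossRIS (dist y x) ‖x‖)

lemma risPower_nonneg (x y : Plane) : 0 ≤ N.risPower x y :=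
  mul_nonneg N.rhoT_nonneg (mul_nonneg N.Pb_pos.le
    (N.pathLossRIS_nonneg dist_nonneg (norm_nonneg _)))

lemma measurable_risPower : Measurable fun p : Plane × Plane => N.risPower p.1 p.2 := by
  unfold risPower pathLossRIS
  fun_prop

lemma measurable_risPower_right (x : Plane) : Measurable (N.risPower x) := by
  unfold risPower pathLossRIS
  fun_prop

lemma risPower_eq (x y : Plane) : N.risPower x y =
    (N.rhoT * N.Pb * N.coeffRISMean * ‖x‖ ^ (-N.alphaT)) * dist y x ^ (-N.alphaT) := by
  rw [risPower, N.pathLossRIS_eq dist_nonneg (norm_nonneg _)]; ring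

lemma lamB_mul_lintegral_risPower (x : Plane) {r : ℝ} (hr : 0 < r) :
    ENNReal.ofReal N.lamB * ∫⁻ y : Plane, ENNReal.ofReal
      (if r < dist y x then N.risPower x y else 0) = ENNReal.ofReal (N.meanInterference r ‖x‖) := by
  have hC := N.coeffRISMean_pos
  have hP := N.Pb_pos
  have hρ := N.rhoT_nonneg
  simp_rw [risPower_eq]
  rw [lintegral_ite_dist_rpow hr N.two_lt_alphaT x (by positivity), ← ENNReal.ofReal_mul N.lamB_pos.le,
    meanInterference]
  congr 1
  ring

lemma signal_div_meanInterference {r u : ℝ} (hr : 0 < r) (hu : 0 < u) (hρ : 0 < N.rhoT) :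
    N.Pb * N.pathLossRIS r u / N.meanInterference r u =
      (N.alphaT - 2) / (2 * Real.pi * N.lamB * N.rhoT * r ^ 2) := by
  have hC := N.coeffRISMean_pos
  have hP := N.Pb_pos
  have hl := N.lamB_pos
  have hα := N.alphaT_sub_two_pos
  have h1 : r ^ (2 - N.alphaT) = r ^ 2 * r ^ (-N.alphaT) := by
    rw [sub_eq_add_neg, Real.rpow_add hr, Real.rpow_two]
  rw [N.pathLossRIS_eq hr.le hu.le, meanInterference, h1]
  have : 0 < r ^ (-N.alphaT) := by positivity
  have : 0 < u ^ (-N.alphaT) := by positivity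
  field_simp

/-- Slope of `I ↦ W / (I + σ²)` at the mean interference, up to sign, for a signal power `W`;
truncated near `r = 0` and `u = 0`. -/
noncomputable def sinrSlope (ε u r : ℝ) : ℝ :=
  if ε ≤ r ∧ ε ≤ u then
    N.Pb * N.pathLossRIS r u / (N.meanInterference r u + N.noise) ^ 2 else 0

lemma sinrSlope_nonneg {ε : ℝ} (hε : 0 < ε) (u r : ℝ) : 0 ≤ N.sinrSlope ε u r := by
  have hP := N.Pb_pos
  unfold sinrSlope
  split_ifs with h
  · have := N.pathLossRIS_nonneg (hε.le.trans h.1) (hε.le.trans h.2)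
    positivity
  · exact le_rfl

lemma measurable_pathLossRIS : Measurable fun p : ℝ × ℝ => N.pathLossRIS p.1 p.2 := by
  unfold pathLossRIS
  fun_prop

lemma measurable_meanInterference : Measurable fun p : ℝ × ℝ => N.meanInterference p.1 p.2 := by
  unfold meanInterference
  fun_prop

lemma measurable_sinrSlope (ε : ℝ) : Measurable fun p : ℝ × ℝ => N.sinrSlope ε p.2 p.1 := by
  have h1 := N.measurable_pathLossRIS
  have h2 := N.measurable_meanInterference
  unfold sinrSlope
  refine Measurable.ite ?_ ?_ measurable_const
  · exact (measurableSet_le measurable_const measurable_fst).inter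
      (measurableSet_le measurable_const measurable_snd)
  · exact (h1.const_mul _).div ((h2.add_const _).pow_const 2)

/-- The truncation bounds the path loss, and `c / (c + σ²)² ≤ 1 / σ²`. The bound serves twice: as
the dominating constant when the mesh tends to `0`, and to make the tangent term finite so that it
can be cancelled. -/
lemma sinrSlope_mul_meanInterference_le {ε : ℝ} (hε : 0 < ε) (u r : ℝ) :
    N.sinrSlope ε u r * N.meanInterference r u ≤
      N.Pb * (N.coeffRISMean * (ε * ε) ^ (-N.alphaT)) / N.noise := by
  have hP := N.Pb_pos
  have hC := N.coeffRISMean_pos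
  have hσ := N.noise_pos
  have hα := N.alphaT_pos
  unfold sinrSlope
  split_ifs with h
  · have hr := hε.trans_le h.1
    have hu := hε.trans_le h.2
    have hc := N.meanInterference_nonneg hr.le hu.le
    set c := N.meanInterference r u
    have h1 : N.pathLossRIS r u ≤ N.coeffRISMean * (ε * ε) ^ (-N.alphaT) := by
      rw [pathLossRIS]
      refine mul_le_mul_of_nonneg_left ?_ hC.le
      exact Real.rpow_le_rpow_of_nonpos (by positivity)
        (mul_le_mul h.1 h.2 hε.le hr.le) (by linarith)
    have hpl := N.pathLossRIS_nonneg hr.le hu.le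
    rw [div_mul_eq_mul_div, div_le_div_iff₀ (by positivity) hσ]
    have h2 : c * N.noise ≤ (c + N.noise) ^ 2 := by nlinarith
    calc N.Pb * N.pathLossRIS r u * c * N.noise
        = N.Pb * N.pathLossRIS r u * (c * N.noise) := by ring
      _ ≤ N.Pb * (N.coeffRISMean * (ε * ε) ^ (-N.alphaT)) * (c + N.noise) ^ 2 := by gcongr
  · rw [zero_mul]; positivity

/-- Right continuity of functions that are truncated near zero. -/
lemma tendsto_ite_le {ε u : ℝ} (hε : 0 < ε) {G : ℝ → ℝ} (hG : ∀ r, 0 < r → ContinuousAt G r) (r : ℝ) :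
    Filter.Tendsto (fun r => if ε ≤ r ∧ ε ≤ u then G r else 0) (nhdsWithin r (Set.Ioi r))
      (nhds (if ε ≤ r ∧ ε ≤ u then G r else 0)) := by
  by_cases hu : ε ≤ u
  -- The closed condition `ε ≤ r` persists to the right of `r`, also at `r = ε`, where the truncated
  -- function may jump from the left.
  · rcases le_or_gt ε r with h | h
    · rw [if_pos ⟨h, hu⟩]
      refine ((hG r (hε.trans_le h)).tendsto.mono_left nhdsWithin_le_nhds).congr' ?_
      filter_upwards [self_mem_nhdsWithin] with s hs
      rw [if_pos ⟨h.trans (le_of_lt hs), hu⟩]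
    · rw [if_neg fun h' => h.not_ge h'.1]
      refine tendsto_const_nhds.congr' ?_
      filter_upwards [nhdsWithin_le_nhds (Iio_mem_nhds h)] with s hs
      rw [if_neg fun h' => (show s < ε from hs).not_ge h'.1]
  · simp [hu]

lemma continuousAt_pathLossRIS {u r : ℝ} (hu : 0 < u) (hr : 0 < r) :
    ContinuousAt (fun r => N.pathLossRIS r u) r := by
  unfold pathLossRIS
  have h : ContinuousAt (fun r : ℝ => r * u) r := by fun_prop
  exact (h.rpow_const (Or.inl (mul_pos hr hu).ne')).const_mul _

lemma continuousAt_meanInterference {u r : ℝ} (hr : 0 < r) :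
    ContinuousAt (fun r => N.meanInterference r u) r := by
  unfold meanInterference
  exact (((Real.continuousAt_rpow_const r _ (Or.inl hr.ne')).const_mul _).div_const _).const_mul _

lemma tendsto_sinrSlope {ε : ℝ} (hε : 0 < ε) (u r : ℝ) :
    Filter.Tendsto (N.sinrSlope ε u) (nhdsWithin r (Set.Ioi r)) (nhds (N.sinrSlope ε u r)) ∧
    Filter.Tendsto (fun r => N.sinrSlope ε u r * N.meanInterference r u)
      (nhdsWithin r (Set.Ioi r)) (nhds (N.sinrSlope ε u r * N.meanInterference r u)) := by
  have hσ := N.noise_pos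
  rcases lt_or_ge u ε with hu | hu
  · have h0 : ∀ r, N.sinrSlope ε u r = 0 := fun r => if_neg fun h => hu.not_ge h.2
    simp only [h0, zero_mul]
    exact ⟨tendsto_const_nhds.congr fun r => (h0 r).symm, tendsto_const_nhds⟩
  have hu0 := hε.trans_le hu
  have hcont : ∀ r, 0 < r → ContinuousAt
      (fun r => N.Pb * N.pathLossRIS r u / (N.meanInterference r u + N.noise) ^ 2) r := by
    intro r hr
    have hc := N.meanInterference_nonneg hr.le hu0.le
    exact ((N.continuousAt_pathLossRIS hu0 hr).const_mul _).div
      (((N.continuousAt_meanInterference hr).add_const _).pow 2) (by positivity)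
  refine ⟨tendsto_ite_le hε hcont r, ?_⟩
  have h2 := tendsto_ite_le (u := u) hε
    (G := fun r => N.Pb * N.pathLossRIS r u / (N.meanInterference r u + N.noise) ^ 2 *
      N.meanInterference r u)
    (fun r hr => (hcont r hr).mul (N.continuousAt_meanInterference (u := u) hr)) r
  simpa only [sinrSlope, ite_mul, zero_mul] using h2

/-- Convexity of `I ↦ W / (I + σ²)`. -/
lemma tangent_le {W I c s : ℝ} (hW : 0 ≤ W) (hI : 0 ≤ I) (hc : 0 ≤ c) (hs : 0 < s) :
    W / (c + s) + W / (c + s) ^ 2 * c ≤ W / (I + s) + W / (c + s) ^ 2 * I := by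
  have h1 : W / (I + s) + W / (c + s) ^ 2 * I - (W / (c + s) + W / (c + s) ^ 2 * c) =
      W * (I - c) ^ 2 / ((I + s) * (c + s) ^ 2) := by
    field_simp
    ring
  have h2 : 0 ≤ W * (I - c) ^ 2 / ((I + s) * (c + s) ^ 2) := by positivity
  linarith

/-- The region outside the RIS ball. -/
def outside : Set Plane := {y | N.RL < ‖y‖}

lemma measurableSet_outside : MeasurableSet N.outside :=
  measurableSet_lt measurable_const measurable_norm

open Classical in
/-- Mean power received by the typical user from the `n`-th base station, if it interferes, for
base stations `p.1` and a RIS at `p.2`. -/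
noncomputable def farPower (n : ℕ) (p : (ℕ → Plane) × Plane) : ℝ :=
  if p.1 n ∈ N.outside ∧ nearestDist N.outside p.2 p.1 < dist (p.1 n) p.2 then
    N.risPower p.2 (p.1 n) else 0

lemma farPower_nonneg (n : ℕ) (p : (ℕ → Plane) × Plane) : 0 ≤ N.farPower n p := by
  unfold farPower
  split_ifs
  exacts [N.risPower_nonneg _ _, le_rfl]

lemma measurable_nearestDist_outside :
    Measurable fun p : (ℕ → Plane) × Plane => nearestDist N.outside p.2 p.1 :=
  measurable_nearestDist_swap N.measurableSet_outside

lemma measurable_farPower (n : ℕ) : Measurable (N.farPower n) := by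
  have h : N.farPower n = Set.indicator {p : (ℕ → Plane) × Plane | p.1 n ∈ N.outside ∧
      nearestDist N.outside p.2 p.1 < dist (p.1 n) p.2} (fun p => N.risPower p.2 (p.1 n)) := by
    funext p
    simp only [farPower, Set.indicator, Set.mem_ofPred_eq]
    congr
  rw [h]
  exact (measurable_comp_snd_apply N.measurable_risPower n).indicator
    (measurableSet_mem_and_nearestDist_lt N.measurableSet_outside n)

end Network

/-! ### The mean SINR of the typical user -/

namespace TypicalScenario

variable {N : Network} {Ω : Type*} [MeasurableSpace Ω] {P : Measure Ω} (T : TypicalScenario N P)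

/-- The base stations and the location of the RIS. -/
def geometry (ω : Ω) : (ℕ → Plane) × Plane := (fun n => T.X n ω, T.R ω)

lemma X_measurable : Measurable fun ω n => T.X n ω := measurable_pi_iff.2 T.poisson.measurable

lemma measurable_geometry : Measurable T.geometry := T.X_measurable.prodMk T.R_measurable

lemma g_measurable' : Measurable fun ω n => T.g n ω := measurable_pi_iff.2 T.g_measurable

lemma ae_g_nonneg : ∀ᵐ ω ∂P, ∀ n, 0 ≤ T.g n ω :=
  ae_all_iff.2 fun n => ae_nonneg_of_map_eq_nakagamiPower (T.g_measurable n) (T.g_law n)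

lemma rBR_eq (ω : Ω) : T.rBR ω = nearestDist N.outside (T.geometry ω).2 (T.geometry ω).1 := rfl

lemma rBR_nonneg (ω : Ω) : 0 ≤ T.rBR ω := by
  rw [rBR_eq]; exact nearestDist_nonneg _ _ _

lemma interference_eq (ω : Ω) :
    T.interference ω = ∑' n, T.g n ω * N.farPower n (T.geometry ω) := by
  classical
  unfold interference
  rw [← tsum_mul_left]
  refine tsum_congr fun n => ?_
  have h1 : N.farPower n (T.geometry ω) =
      if N.RL < ‖T.X n ω‖ ∧ T.rBR ω < dist (T.X n ω) (T.R ω) then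
        N.risPower (T.R ω) (T.X n ω) else 0 := by
    unfold Network.farPower
    rw [rBR_eq]
    congr 1
  rw [h1]
  split_ifs
  · rw [Network.risPower]; ring
  · simp

lemma interferenceBeyond_eq (x : Plane) (r : ℝ) (ω : Ω) :
    T.interferenceBeyond x r ω =
      ∑' n, T.g n ω * (if r < dist (T.X n ω) x then N.risPower x (T.X n ω) else 0) := by
  classical
  unfold interferenceBeyond
  rw [← tsum_mul_left]
  refine tsum_congr fun n => ?_
  split_ifs
  · rw [Network.risPower]; ring
  · simp

lemma X_g_indep : IndepFun (fun ω n => T.X n ω) (fun ω n => T.g n ω) P :=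
  T.geometry_fading_indep.comp measurable_fst measurable_fst

lemma geometry_g_indep : IndepFun T.geometry (fun ω n => T.g n ω) P :=
  T.geometry_fading_indep.comp measurable_id measurable_fst

lemma ae_interference_nonneg : ∀ᵐ ω ∂P, 0 ≤ T.interference ω := by
  filter_upwards [T.ae_g_nonneg] with ω hω
  rw [interference_eq]
  exact tsum_nonneg fun n => mul_nonneg (hω n) (N.farPower_nonneg _ _)

variable [IsProbabilityMeasure P]

/-- The mean of the interference received through a RIS at a fixed location. -/
lemma integral_interferenceBeyond (x : Plane) {r : ℝ} (hr : 0 < r) :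
    Integrable (T.interferenceBeyond x r) P ∧
      ∫ ω, T.interferenceBeyond x r ω ∂P = N.meanInterference r ‖x‖ := by
  set w : Plane → ℝ := fun y => if r < dist y x then N.risPower x y else 0 with hw
  have hwm : Measurable w := Measurable.ite
    (measurableSet_lt measurable_const (by fun_prop))
    (N.measurable_risPower_right x) measurable_const
  have hw0 : ∀ y, 0 ≤ w y := by
    intro y
    simp only [hw]
    split_ifs
    exacts [N.risPower_nonneg _ _, le_rfl]
  have hE := lintegral_tsum_ofReal_mul_poisson T.poisson N.lamB_pos N.mT_pos T.g_measurable T.g_law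
    T.X_g_indep hwm hw0
  rw [N.lamB_mul_lintegral_risPower x hr] at hE
  have htm : ∀ n, Measurable fun ω => T.g n ω * w (T.X n ω) := fun n =>
    (T.g_measurable n).mul (hwm.comp (T.poisson.measurable n))
  have hne : ∫⁻ ω, ∑' n, ENNReal.ofReal (T.g n ω * w (T.X n ω)) ∂P ≠ ∞ := by
    rw [hE]; exact ENNReal.ofReal_ne_top
  have hnonneg : ∀ᵐ ω ∂P, 0 ≤ T.interferenceBeyond x r ω := by
    filter_upwards [T.ae_g_nonneg] with ω hω
    rw [interferenceBeyond_eq]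
    exact tsum_nonneg fun n => mul_nonneg (hω n) (hw0 _)
  have hmeasE : Measurable fun ω => ∑' n, ENNReal.ofReal (T.g n ω * w (T.X n ω)) :=
    Measurable.tsum fun n => (htm n).ennreal_ofReal
  have hofReal : ∀ᵐ ω ∂P, ENNReal.ofReal (T.interferenceBeyond x r ω) =
      ∑' n, ENNReal.ofReal (T.g n ω * w (T.X n ω)) := by
    filter_upwards [T.ae_g_nonneg, ae_lt_top hmeasE hne] with ω hω hlt
    rw [interferenceBeyond_eq]
    exact ofReal_tsum_of_ne_top (fun n => mul_nonneg (hω n) (hw0 _)) hlt.ne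
  have hmeas : Measurable (T.interferenceBeyond x r) := by
    have : T.interferenceBeyond x r = fun ω => ∑' n, T.g n ω * w (T.X n ω) :=
      funext fun ω => T.interferenceBeyond_eq x r ω
    rw [this]
    exact Measurable.tsum htm
  have hlint : ∫⁻ ω, ENNReal.ofReal (T.interferenceBeyond x r ω) ∂P =
      ENNReal.ofReal (N.meanInterference r ‖x‖) := by
    rw [lintegral_congr_ae hofReal, hE]
  constructor
  · refine ⟨hmeas.aestronglyMeasurable, ?_⟩
    rw [hasFiniteIntegral_iff_ofReal hnonneg, hlint]
    exact ENNReal.ofReal_lt_top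
  · rw [integral_eq_lintegral_of_nonneg_ae hnonneg hmeas.aestronglyMeasurable, hlint,
      ENNReal.toReal_ofReal (N.meanInterference_nonneg hr.le (norm_nonneg _))]

/-- Averaging over the unit-mean fading of the desired link. -/
lemma avgSINR_eq : T.avgSINR = ∫⁻ ω, ENNReal.ofReal
    (N.Pb * N.pathLossRIS (T.rBR ω) ‖T.R ω‖ / (T.interference ω + N.noise)) ∂P := by
  have hP := N.Pb_pos
  have hσ := N.noise_pos
  let F : ((ℕ → Plane) × Plane) × (ℕ → ℝ) → ℝ := fun p =>
    N.Pb * N.pathLossRIS (nearestDist N.outside p.1.2 p.1.1) ‖p.1.2‖ /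
      (∑' n, p.2 n * N.farPower n p.1 + N.noise)
  have hF : Measurable F := by
    refine Measurable.div ?_ (Measurable.add_const (Measurable.tsum fun n => ?_) _)
    · have h1 : Measurable fun p : ((ℕ → Plane) × Plane) × (ℕ → ℝ) =>
          (nearestDist N.outside p.1.2 p.1.1, ‖p.1.2‖) :=
        (N.measurable_nearestDist_outside.comp measurable_fst).prodMk
          (measurable_snd.comp measurable_fst).norm
      have h2 : Measurable fun p : ((ℕ → Plane) × Plane) × (ℕ → ℝ) =>
          N.pathLossRIS (nearestDist N.outside p.1.2 p.1.1) ‖p.1.2‖ :=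
        N.measurable_pathLossRIS.comp h1
      exact h2.const_mul _
    · exact ((measurable_pi_apply n).comp measurable_snd).mul
        ((N.measurable_farPower n).comp measurable_fst)
  have hFω : ∀ ω, F (T.geometry ω, fun n => T.g n ω) =
      N.Pb * N.pathLossRIS (T.rBR ω) ‖T.R ω‖ / (T.interference ω + N.noise) := by
    intro ω
    rw [interference_eq]
    rfl
  have hind := indepFun_prodMk_of_indepFun_prodMk T.measurable_geometry T.g_measurable'
    T.h_measurable T.geometry_fading_indep T.g_h_indep
  have hFm : Measurable fun ω => ENNReal.ofReal (F (T.geometry ω, fun n => T.g n ω)) :=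
    (hF.comp (T.measurable_geometry.prodMk T.g_measurable')).ennreal_ofReal
  have hind' : IndepFun (fun ω => ENNReal.ofReal (T.h ω))
      (fun ω => ENNReal.ofReal (F (T.geometry ω, fun n => T.g n ω))) P :=
    (hind.comp hF.ennreal_ofReal ENNReal.measurable_ofReal).symm
  have hmul := lintegral_mul_eq_lintegral_mul_lintegral_of_indepFun''
    T.h_measurable.ennreal_ofReal.aemeasurable hFm.aemeasurable hind'
  rw [lintegral_ofReal_of_map_eq_nakagamiPower N.mT_pos T.h_measurable T.h_law, one_mul] at hmul
  simp_rw [hFω] at hmul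
  rw [← hmul, avgSINR]
  refine lintegral_congr_ae ?_
  filter_upwards [T.ae_interference_nonneg] with ω hI
  have hpl := N.pathLossRIS_nonneg (T.rBR_nonneg ω) (norm_nonneg (T.R ω))
  rw [← ENNReal.ofReal_mul' (by positivity), sinrOMA]
  congr 1
  ring

/-- Given the distances to the serving base station and to the RIS, the mean interference is at most
that of all base stations farther away than the serving one. -/
lemma lintegral_sinrSlope_mul_interference_le {ε : ℝ} (hε : 0 < ε) :
    ∫⁻ ω, ENNReal.ofReal (N.sinrSlope ε ‖T.R ω‖ (T.rBR ω) * T.interference ω) ∂P ≤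
      ∫⁻ ω, ENNReal.ofReal (N.sinrSlope ε ‖T.R ω‖ (T.rBR ω) *
        N.meanInterference (T.rBR ω) ‖T.R ω‖) ∂P := by
  let q : (ℕ → Plane) × Plane → ℝ≥0∞ := fun p =>
    ENNReal.ofReal (N.sinrSlope ε ‖p.2‖ (nearestDist N.outside p.2 p.1))
  let b : (ℕ → Plane) × Plane → ℝ≥0∞ := fun p =>
    ENNReal.ofReal (N.meanInterference (nearestDist N.outside p.2 p.1) ‖p.2‖)
  let φ : ℕ → (ℕ → Plane) × Plane → ℝ≥0∞ := fun n p => q p * ENNReal.ofReal (N.farPower n p)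
  have hru : Measurable fun p : (ℕ → Plane) × Plane => (nearestDist N.outside p.2 p.1, ‖p.2‖) :=
    N.measurable_nearestDist_outside.prodMk measurable_snd.norm
  have hq : Measurable q := ((N.measurable_sinrSlope ε).comp hru).ennreal_ofReal
  have hb : Measurable b := (N.measurable_meanInterference.comp hru).ennreal_ofReal
  have hφ : ∀ n, Measurable (φ n) := fun n => hq.mul (N.measurable_farPower n).ennreal_ofReal
  have hRX : IndepFun T.R (fun ω n => T.X n ω) P := T.X_R_indep.symm
  -- The surface is frozen at `x`, where the nearest-point comparison applies; independence of `R`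
  -- and the base stations restores its random location afterwards.
  have hcond : ∀ x : Plane, ∫⁻ ω, ∑' n, φ n (fun n => T.X n ω, x) ∂P ≤
      ∫⁻ ω, q (fun n => T.X n ω, x) * b (fun n => T.X n ω, x) ∂P := by
    intro x
    classical
    have hvm : Measurable fun y => ENNReal.ofReal (N.risPower x y) :=
      (N.measurable_risPower_right x).ennreal_ofReal
    have hqb : ∀ r, ENNReal.ofReal (N.sinrSlope ε ‖x‖ r) *
        ENNReal.ofReal (N.meanInterference r ‖x‖) =
        ENNReal.ofReal (N.sinrSlope ε ‖x‖ r * N.meanInterference r ‖x‖) := fun r =>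
      (ENNReal.ofReal_mul (N.sinrSlope_nonneg hε _ _)).symm
    have key := T.poisson.lintegral_nearestDist_mul_tsum_le N.lamB_pos N.measurableSet_outside x
      hvm (fun y => ENNReal.ofReal_ne_top)
      (q := fun r => ENNReal.ofReal (N.sinrSlope ε ‖x‖ r))
      (b := fun r => ENNReal.ofReal (N.meanInterference r ‖x‖))
      ((N.measurable_sinrSlope ε).comp (measurable_id.prodMk measurable_const)).ennreal_ofReal
      (N.measurable_meanInterference.comp (measurable_id.prodMk measurable_const)).ennreal_ofReal
      ?_ ?_ ?_ (M := ENNReal.ofReal (N.Pb * (N.coeffRISMean * (ε * ε) ^ (-N.alphaT)) / N.noise))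
      ENNReal.ofReal_ne_top ?_
    · refine le_trans (le_of_eq (lintegral_congr fun ω => ?_)) key
      simp only [φ, q]
      rw [ENNReal.tsum_mul_left]
      congr 1
      refine tsum_congr fun n => ?_
      unfold Network.farPower
      split_ifs
      · rfl
      · exact ENNReal.ofReal_zero
    · intro t ht
      rw [← N.lamB_mul_lintegral_risPower x ht, ← lintegral_indicator
        (measurableSet_lt measurable_const (by fun_prop))]
      refine le_of_eq ?_
      congr 1
      refine lintegral_congr fun y => ?_
      by_cases h : t < dist y x <;> simp [h]
    · exact fun r _ => (ENNReal.continuous_ofReal.tendsto _).comp (N.tendsto_sinrSlope hε _ r).1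
    · intro r _
      simp only [hqb]
      exact (ENNReal.continuous_ofReal.tendsto _).comp (N.tendsto_sinrSlope hε _ r).2
    · intro r
      rw [hqb]
      exact ENNReal.ofReal_le_ofReal (N.sinrSlope_mul_meanInterference_le hε _ _)
  have hswap : Measurable fun p : Plane × (ℕ → Plane) => (p.2, p.1) := measurable_swap
  calc ∫⁻ ω, ENNReal.ofReal (N.sinrSlope ε ‖T.R ω‖ (T.rBR ω) * T.interference ω) ∂P
      ≤ ∫⁻ ω, ∑' n, ENNReal.ofReal (T.g n ω) * φ n (T.geometry ω) ∂P := by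
        refine lintegral_mono_ae ?_
        filter_upwards [T.ae_g_nonneg] with ω hg
        have h1 : ∀ n, ENNReal.ofReal (T.g n ω) * φ n (T.geometry ω) =
            q (T.geometry ω) * ENNReal.ofReal (T.g n ω * N.farPower n (T.geometry ω)) := by
          intro n
          simp only [φ]
          rw [ENNReal.ofReal_mul (hg n)]
          ring
        simp_rw [h1]
        rw [ENNReal.ofReal_mul (N.sinrSlope_nonneg hε _ _), ENNReal.tsum_mul_left, interference_eq]
        exact mul_le_mul_right (ofReal_tsum_le fun n =>
          mul_nonneg (hg n) (N.farPower_nonneg _ _)) _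
    _ = ∫⁻ ω, ∑' n, φ n (T.geometry ω) ∂P :=
        lintegral_tsum_ofReal_mul T.measurable_geometry N.mT_pos T.g_measurable T.g_law
          T.geometry_g_indep hφ
    _ = ∫⁻ ω', ∫⁻ ω, ∑' n, φ n (fun n => T.X n ω, T.R ω') ∂P ∂P :=
        lintegral_of_indepFun (F := fun p : Plane × (ℕ → Plane) => ∑' n, φ n (p.2, p.1))
          T.R_measurable T.X_measurable hRX (Measurable.tsum fun n => (hφ n).comp hswap)
    _ ≤ ∫⁻ ω', ∫⁻ ω, q (fun n => T.X n ω, T.R ω') * b (fun n => T.X n ω, T.R ω') ∂P ∂P :=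
        lintegral_mono fun ω' => hcond _
    _ = ∫⁻ ω, q (T.geometry ω) * b (T.geometry ω) ∂P :=
        (lintegral_of_indepFun (F := fun p : Plane × (ℕ → Plane) => q (p.2, p.1) * b (p.2, p.1))
          T.R_measurable T.X_measurable hRX ((hq.mul hb).comp hswap)).symm
    _ = _ := by
        refine lintegral_congr fun ω => ?_
        exact (ENNReal.ofReal_mul (N.sinrSlope_nonneg hε _ _)).symm

/-- Truncated form of `lintegral_meanInterference_le_avgSINR`. -/
lemma lintegral_ite_le_avgSINR {ε : ℝ} (hε : 0 < ε) :
    ∫⁻ ω, (if ε ≤ T.rBR ω ∧ ε ≤ ‖T.R ω‖ then ENNReal.ofReal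
      (N.Pb * N.pathLossRIS (T.rBR ω) ‖T.R ω‖ /
        (N.meanInterference (T.rBR ω) ‖T.R ω‖ + N.noise)) else 0) ∂P ≤ T.avgSINR := by
  have hP := N.Pb_pos
  have hσ := N.noise_pos
  have hru : Measurable fun ω => (T.rBR ω, ‖T.R ω‖) :=
    (N.measurable_nearestDist_outside.comp T.measurable_geometry).prodMk T.R_measurable.norm
  have hqc : Measurable fun ω => ENNReal.ofReal (N.sinrSlope ε ‖T.R ω‖ (T.rBR ω) *
      N.meanInterference (T.rBR ω) ‖T.R ω‖) :=
    (((N.measurable_sinrSlope ε).comp hru).mul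
      (N.measurable_meanInterference.comp hru)).ennreal_ofReal
  have hfin : ∫⁻ ω, ENNReal.ofReal (N.sinrSlope ε ‖T.R ω‖ (T.rBR ω) *
      N.meanInterference (T.rBR ω) ‖T.R ω‖) ∂P ≠ ∞ := by
    refine ne_top_of_le_ne_top (b := ENNReal.ofReal
      (N.Pb * (N.coeffRISMean * (ε * ε) ^ (-N.alphaT)) / N.noise)) ENNReal.ofReal_ne_top ?_
    refine le_trans (lintegral_mono fun ω => ENNReal.ofReal_le_ofReal
      (N.sinrSlope_mul_meanInterference_le hε _ _)) ?_
    simp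
  have hIm : Measurable T.interference := by
    have : T.interference = fun ω => ∑' n, T.g n ω * N.farPower n (T.geometry ω) :=
      funext T.interference_eq
    rw [this]
    exact Measurable.tsum fun n => (T.g_measurable n).mul
      ((N.measurable_farPower n).comp T.measurable_geometry)
  have hqI : Measurable fun ω => ENNReal.ofReal
      (N.sinrSlope ε ‖T.R ω‖ (T.rBR ω) * T.interference ω) :=
    (((N.measurable_sinrSlope ε).comp hru).mul hIm).ennreal_ofReal
  rw [avgSINR_eq]
  -- The finite term slope times mean interference is added to both sides; on the right it may be
  -- lowered to slope times true interference, and the tangent inequality then holds pointwise.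
  refine (ENNReal.add_le_add_iff_right hfin).1 ?_
  refine le_trans ?_ (add_le_add_right (T.lintegral_sinrSlope_mul_interference_le hε) _)
  rw [← lintegral_add_right _ hqc, ← lintegral_add_right _ hqI]
  refine lintegral_mono_ae ?_
  filter_upwards [T.ae_interference_nonneg] with ω hI
  have hr := T.rBR_nonneg ω
  have hu := norm_nonneg (T.R ω)
  have hpl := N.pathLossRIS_nonneg hr hu
  have hc := N.meanInterference_nonneg hr hu
  by_cases h : ε ≤ T.rBR ω ∧ ε ≤ ‖T.R ω‖
  · rw [if_pos h, Network.sinrSlope, if_pos h, ← ENNReal.ofReal_add (by positivity) (by positivity),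
      ← ENNReal.ofReal_add (by positivity) (by positivity)]
    exact ENNReal.ofReal_le_ofReal (Network.tangent_le (by positivity) hI hc hσ)
  · rw [if_neg h, Network.sinrSlope, if_neg h]
    simp

/-- Replacing the interference by its mean gives a lower bound of the average SINR. -/
lemma lintegral_meanInterference_le_avgSINR :
    ∫⁻ ω, ENNReal.ofReal (N.Pb * N.pathLossRIS (T.rBR ω) ‖T.R ω‖ /
      (N.meanInterference (T.rBR ω) ‖T.R ω‖ + N.noise)) ∂P ≤ T.avgSINR := by
  have hα := N.alphaT_pos
  have hru : Measurable fun ω => (T.rBR ω, ‖T.R ω‖) :=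
    (N.measurable_nearestDist_outside.comp T.measurable_geometry).prodMk T.R_measurable.norm
  have hfm : Measurable fun ω => ENNReal.ofReal (N.Pb * N.pathLossRIS (T.rBR ω) ‖T.R ω‖ /
      (N.meanInterference (T.rBR ω) ‖T.R ω‖ + N.noise)) :=
    (((N.measurable_pathLossRIS.comp hru).const_mul _).div
      ((N.measurable_meanInterference.comp hru).add_const _)).ennreal_ofReal
  let ε : ℕ → ℝ := fun k => 1 / ((k : ℝ) + 1)
  have hε : ∀ k, 0 < ε k := fun k => by positivity
  let F : ℕ → Ω → ℝ≥0∞ := fun k ω => if ε k ≤ T.rBR ω ∧ ε k ≤ ‖T.R ω‖ then ENNReal.ofReal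
      (N.Pb * N.pathLossRIS (T.rBR ω) ‖T.R ω‖ /
        (N.meanInterference (T.rBR ω) ‖T.R ω‖ + N.noise)) else 0
  have hFm : ∀ k, Measurable (F k) := fun k => by
    refine Measurable.ite ?_ hfm measurable_const
    exact (measurableSet_le measurable_const (measurable_fst.comp hru)).inter
      (measurableSet_le measurable_const (measurable_snd.comp hru))
  calc _ ≤ ∫⁻ ω, Filter.liminf (fun k => F k ω) Filter.atTop ∂P := by
        refine lintegral_mono fun ω => ?_
        rcases (T.rBR_nonneg ω).eq_or_lt with hr | hr
        -- At distance `0` the real power `0 ^ (-α_t)` is `0` by convention, so configurations never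
        -- reached by the truncation contribute nothing.
        · simp [← hr, Network.pathLossRIS, Real.zero_rpow (neg_ne_zero.2 hα.ne')]
        rcases (norm_nonneg (T.R ω)).eq_or_lt with hu | hu
        · simp [← hu, Network.pathLossRIS, Real.zero_rpow (neg_ne_zero.2 hα.ne')]
        have h1 : Filter.Tendsto ε Filter.atTop (nhds 0) := tendsto_one_div_add_atTop_nhds_zero_nat
        have h2 : Filter.Tendsto (fun k => F k ω) Filter.atTop (nhds (ENNReal.ofReal
            (N.Pb * N.pathLossRIS (T.rBR ω) ‖T.R ω‖ /
              (N.meanInterference (T.rBR ω) ‖T.R ω‖ + N.noise)))) := by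
          refine tendsto_const_nhds.congr' ?_
          filter_upwards [h1.eventually_le_const hr, h1.eventually_le_const hu] with k hk hk'
          simp only [F]
          rw [if_pos ⟨hk, hk'⟩]
        exact h2.liminf_eq.ge
    _ ≤ Filter.liminf (fun k => ∫⁻ ω, F k ω ∂P) Filter.atTop := lintegral_liminf_le hFm
    _ ≤ T.avgSINR := by
        refine Filter.liminf_le_of_le (by isBoundedDefault) fun b hb => ?_
        obtain ⟨k, hk⟩ := hb.exists
        exact hk.trans (T.lintegral_ite_le_avgSINR (hε k))

end TypicalScenario

theorem theorem2 {Ω : Type*} [MeasurableSpace Ω] (P : Measure Ω) [IsProbabilityMeasure P]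
    {Ω' : Type*} [MeasurableSpace Ω'] (Q : Measure Ω') [IsProbabilityMeasure Q]
    (N : Network) (S : ConnectedScenario N P) (T : TypicalScenario N Q)
    (hth : N.aT * N.gammaTh < N.ac) :
    -- The surrogate tail with `η_c` bounds the Gamma tail from above, that with `m_c` from below.
    (∀ x : ℝ, 0 ≤ x →
      expTail N.mC (N.mC : ℝ) x ≤ nakagamiTail N.mC x ∧
      nakagamiTail N.mC x ≤ expTail N.mC (alzerConst N.mC) x) ∧
    -- If `θ_c ≤ γ_t^E`, the coverage probability is a difference of two Gamma tails.
    (ENNReal.ofReal N.thetaC ≤ T.avgSINR →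
      S.coverage T.avgSINR =
        S.meanTail (nakagamiTail N.mC) (ENNReal.ofReal N.thetaC) -
          S.meanTail (nakagamiTail N.mC) T.avgSINR) ∧
    -- Its approximation, by the surrogate tail with `η_c`, has the closed form;
    -- here `γ` is `γ_t^E` or any approximate value of it.
    (∀ γ : ℝ≥0∞,
      S.meanTail (expTail N.mC (alzerConst N.mC)) (ENNReal.ofReal N.thetaC) -
          S.meanTail (expTail N.mC (alzerConst N.mC)) γ =
        N.binomialSum (alzerConst N.mC) (ENNReal.ofReal N.thetaC) -
          N.binomialSum (alzerConst N.mC) γ) ∧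
    -- Two-sided closed-form control of the error of the approximation.
    (ENNReal.ofReal N.thetaC ≤ T.avgSINR →
      N.binomialSum (N.mC : ℝ) (ENNReal.ofReal N.thetaC) -
          N.binomialSum (alzerConst N.mC) T.avgSINR ≤ S.coverage T.avgSINR ∧
      S.coverage T.avgSINR ≤
        N.binomialSum (alzerConst N.mC) (ENNReal.ofReal N.thetaC) -
          N.binomialSum (N.mC : ℝ) T.avgSINR) ∧
    -- Otherwise the coverage event is impossible.
    (T.avgSINR ≤ ENNReal.ofReal N.thetaC → S.coverage T.avgSINR = 0) ∧
    -- The mean of the typical user's interference, and the resulting SINR without noise.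
    (∀ (x : Plane) (r : ℝ), x ≠ 0 → 0 < r →
      Integrable (T.interferenceBeyond x r) Q ∧
      (∫ ω, T.interferenceBeyond x r ω ∂Q) = N.meanInterference r ‖x‖ ∧
      (0 < N.rhoT →
        N.Pb * N.pathLossRIS r ‖x‖ / N.meanInterference r ‖x‖ =
          (N.alphaT - 2) / (2 * Real.pi * N.lamB * N.rhoT * r ^ 2))) ∧
    -- Replacing the interference by its mean gives a lower approximation of `γ_t^E`.
    (∫⁻ ω, ENNReal.ofReal (N.Pb * N.pathLossRIS (T.rBR ω) ‖T.R ω‖ /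
        (N.meanInterference (T.rBR ω) ‖T.R ω‖ + N.noise)) ∂Q) ≤ T.avgSINR := by
  have hη := (alzerConst_pos N.mC_pos).le
  refine ⟨fun x hx => ⟨expTail_le_nakagamiTail N.mC_pos hx, nakagamiTail_le_expTail N.mC_pos hx⟩,
    fun h => S.coverage_eq hth h, fun γ => ?_, fun h => ?_, fun h => S.coverage_eq_zero hth h,
    fun x r hx hr => ?_, T.lintegral_meanInterference_le_avgSINR⟩
  · rw [S.meanTail_expTail hη, S.meanTail_expTail hη]
  · rw [S.coverage_eq hth h]
    exact ⟨sub_le_sub (S.binomialSum_le_meanTail _) (S.meanTail_le_binomialSum _),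
      sub_le_sub (S.meanTail_le_binomialSum _) (S.binomialSum_le_meanTail _)⟩
  · exact ⟨(T.integral_interferenceBeyond x hr).1, (T.integral_interferenceBeyond x hr).2,
      fun hρ => N.signal_div_meanInterference hr (norm_pos_iff.2 hx) hρ⟩
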